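/- **Conventions.** Manifolds are smooth, finite-dimensional, without boundary, Hausdorff and second countable. A *Lie 2-groupoid* $\Gamma=(\Gamma_2\rightrightarrows\Gamma_1\rightrightarrows\Gamma_0)$ is a double Lie groupoid whose right column is the trivial groupoid on $\Gamma_0$; a *morphism* is a triple of smooth maps compatible with all structure maps. For a surjective submersion $f:M\to\Delta_0$ put $\Delta_i[M]=\{(m,x,n): s(x)=f(m),\ t(x)=f(n)\}$. A morphism $\varphi:\Gamma\to\Delta$ is *Morita* if $\Gamma_0\to\Delta_0$ and $\Gamma_1\to\Delta_1[\Gamma_0]$ are surjective submersions and the induced map $\Gamma_2\to(\Delta_2[\Gamma_0])[\Gamma_1]$ is a diffeomorphism. A *generalized morphism* $F:\Gamma\rightsquigarrow\Delta$ is a finite zigzag of morphisms from $\Gamma$ to $\Delta$ in which every backward arrow is Morita; composition is concatenation. The *cohomology* $H^\bullet(\Gamma)=\bigoplus_n H^n(\Gamma)$ is that of the total complex of $\big(\Omega^p(N_q\Gamma),\ d+\partial\big)$, where $N_\bullet\Gamma$ is the geometric (Street) nerve and $\partial=(-1)^p\sum_{i=0}^{q+1}(-1)^i d_i^*$. It is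 contravariant for morphisms. For a generalized morphism $F$, the map $F^*:H^\bullet(\Delta)\to H^\bullet(\Gamma)$ is the composite of the maps $f^*$ for the forward arrows and $(\varphi^*)^{-1}$ for the backward (Morita) arrows. For a crossed module of Lie groups $G\to H$, let $[G\to H]$ be the Lie 2-groupoid $G\times H\rightrightarrows H\rightrightarrows \mathrm{pt}$. A *principal $[G\to H]$-bundle* $\mathcal B$ over $\Gamma$ is a generalized morphism $\Gamma\rightsquigarrow[G\to H]$, and its *characteristic homomorphism* is $\Phi_{\mathcal B}=\mathcal B^*:H^\bullet([G\to H])\to H^\bullet(\Gamma)$. For $F:\Gamma\rightsquigarrow\Delta$ and a bundle $\mathcal B$ over $\Delta$, the pullback bundle $F^*(\mathcal B)$ over $\Gamma$ is the composite $\mathcal B\circ F$. The *Whitney sum* of $\mathcal B:\Gamma\xleftarrow{\varphi}E\xrightarrow{f}[G\to H]$ and $\mathcal B':\Gamma\xleftarrow{\varphi'}E'\xrightarrow{f'}[G'\to H']$ ($\varphi,\varphi'$ Morita) is the $[G\times G'\to H\times H']$-bundle $$\mathcal B\oplus\mathcal B':\ \Gamma\longleftarrow E\times_\Gamma E'\xrightarrow{(f,f')}[G\times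 G'\to H\times H'],$$ where $E\times_\Gamma E'$ is the levelwise fibre product and the backward arrow (again Morita) is $\varphi(e)=\varphi'(e')$. The *cross product* is $a\times b=p_1^*a\cup p_2^*b$, where $p_1,p_2$ are the projections of $\Gamma\times\Gamma$, respectively of $[G\times G'\to H\times H']$, onto the two factors, and $\cup$ is the cup product. **Statement.** Every Morita morphism induces an isomorphism in cohomology (so the maps above are well defined), and: 1. For every generalized morphism $F:\Gamma\rightsquigarrow\Delta$ of Lie 2-groupoids (in particular, of Lie groupoids) and every principal $[G\to H]$-bundle $\mathcal B$ over $\Delta$, $$\Phi_{F^*(\mathcal B)}=F^*\circ\Phi_{\mathcal B}.$$ 2. For all bundles $\mathcal B:\Gamma\xleftarrow{\varphi}E\xrightarrow{f}[G\to H]$ and $\mathcal B':\Gamma\xleftarrow{\varphi'}E'\xrightarrow{f'}[G'\to H']$ and all $a\in H^\bullet([G\to H])$, $b\in H^\bullet([G'\to H'])$, $$\Phi_{\mathcal B\oplus\mathcal B'}(a\times b)=\Delta^*\big(\Phi_{\mathcal B}(a)\times\Phi_{\mathcal B'}(b)\big),$$ where $\Delta:\Gamma\to\Gamma\times\Gamma$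 is the diagonal. That is, $\Phi_{\mathcal B\oplus\mathcal B'}=\Delta^*\circ(\Phi_{\mathcal B}\times\Phi_{\mathcal B'})$ on $H^\bullet([G\to H])\otimes H^\bullet([G'\to H'])$, which is mapped to $H^\bullet([G\times G'\to H\times H'])$ by the cross product. -/

import Mathlib

open scoped Manifold ContDiff TensorProduct

universe u

namespace TwoGroupBundle

set_option linter.unusedVariables false

noncomputable section

open Diffeology

section

/-! ### The exterior product of alternating forms -/

/-- The test space `ℝⁿ`. -/
abbrev Euc (n : ℕ) : Type := EuclideanSpace ℝ (Fin n)

/-- The first `a` of `p = a + b` indices. -/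
def wL {a b p : ℕ} (h : a + b = p) (i : Fin a) : Fin p := Fin.cast h (Fin.castAdd b i)

/-- The last `b` of `p = a + b` indices. -/
def wR {a b p : ℕ} (h : a + b = p) (j : Fin b) : Fin p := Fin.cast h (Fin.natAdd a j)

theorem wL_or_wR {a b p : ℕ} (h : a + b = p) (k : Fin p) :
    (∃ i, k = wL h i) ∨ ∃ j, k = wR h j := by
  subst h
  refine Fin.addCases (fun i => Or.inl ⟨i, rfl⟩) (fun j => Or.inr ⟨j, rfl⟩) k

theorem wL_injective {a b p : ℕ} (h : a + b = p) : Function.Injective (wL h) := by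
  subst h
  intro i j hij
  simpa [wL, Fin.ext_iff] using hij

theorem wR_injective {a b p : ℕ} (h : a + b = p) : Function.Injective (wR h) := by
  subst h
  intro i j hij
  simpa [wR, Fin.ext_iff] using hij

theorem wL_ne_wR {a b p : ℕ} (h : a + b = p) (i : Fin a) (j : Fin b) : wL h i ≠ wR h j := by
  intro hij
  have := congrArg Fin.val hij
  simp [wL, wR] at this
  omega

section Update

variable {V : Type*} {a b p : ℕ} (h : a + b = p) (m : Fin p → V) (x : V)

theorem update_wL_wL (i : Fin a) :
    (fun k => Function.update m (wL h i) x (wL h k)) =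
      Function.update (fun k => m (wL h k)) i x :=
  Function.update_comp_eq_of_injective m (wL_injective h) i x

theorem update_wR_wR (i : Fin b) :
    (fun k => Function.update m (wR h i) x (wR h k)) =
      Function.update (fun k => m (wR h k)) i x :=
  Function.update_comp_eq_of_injective m (wR_injective h) i x

theorem update_wL_wR (i : Fin a) :
    (fun k => Function.update m (wL h i) x (wR h k)) = fun k => m (wR h k) :=
  funext fun _ => Function.update_of_ne (wL_ne_wR h _ _).symm _ _

theorem update_wR_wL (i : Fin b) :
    (fun k => Function.update m (wR h i) x (wL h k)) = fun k => m (wL h k) :=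
  funext fun _ => Function.update_of_ne (wL_ne_wR h _ _) _ _

end Update

section Wedge

variable {V W : Type*} [NormedAddCommGroup V] [NormedSpace ℝ V]
  [NormedAddCommGroup W] [NormedSpace ℝ W]

/-- The multilinear map `v ↦ α (v₁, …, v_a) * β (v_{a+1}, …, v_{a+b})`. -/
def tensorForm {a b p : ℕ} (h : a + b = p) (α : V [⋀^Fin a]→L[ℝ] ℝ) (β : V [⋀^Fin b]→L[ℝ] ℝ) :
    ContinuousMultilinearMap ℝ (fun _ : Fin p => V) ℝ where
  toFun v := α (fun i => v (wL h i)) * β (fun j => v (wR h j))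
  map_update_add' := by
    intro inst m k x y
    have e : inst = instDecidableEqFin p := Subsingleton.elim _ _
    subst e
    rcases wL_or_wR h k with ⟨i, rfl⟩ | ⟨j, rfl⟩
    · simp only [update_wL_wL, update_wL_wR, α.map_update_add, add_mul]
    · simp only [update_wR_wL, update_wR_wR, β.map_update_add, mul_add]
  map_update_smul' := by
    intro inst m k c x
    have e : inst = instDecidableEqFin p := Subsingleton.elim _ _
    subst e
    rcases wL_or_wR h k with ⟨i, rfl⟩ | ⟨j, rfl⟩
    · simp only [update_wL_wL, update_wL_wR, α.map_update_smul, smul_eq_mul, mul_assoc]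
    · simp only [update_wR_wL, update_wR_wR, β.map_update_smul, smul_eq_mul, mul_left_comm]
  cont := by
    have h1 : Continuous fun v : Fin p → V => α (fun i => v (wL h i)) :=
      α.cont.comp (continuous_pi fun i => continuous_apply _)
    have h2 : Continuous fun v : Fin p → V => β (fun i => v (wR h i)) :=
      β.cont.comp (continuous_pi fun i => continuous_apply _)
    exact h1.mul h2

/-- The exterior product of an alternating `a`-form and an alternating `b`-form:
`(α ∧ β)(v) = 1/(a! b!) ∑_σ sign σ • α (v_{σ 1}, …, v_{σ a}) β (v_{σ (a+1)}, …, v_{σ (a+b)})`.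
The degree `p` of the result is `a + b`. -/
def wedge {a b p : ℕ} (h : a + b = p) (α : V [⋀^Fin a]→L[ℝ] ℝ) (β : V [⋀^Fin b]→L[ℝ] ℝ) :
    V [⋀^Fin p]→L[ℝ] ℝ :=
  ((a.factorial * b.factorial : ℝ)⁻¹) •
    ContinuousMultilinearMap.alternatization (tensorForm h α β)

theorem wedge_apply {a b p : ℕ} (h : a + b = p) (α : V [⋀^Fin a]→L[ℝ] ℝ)
    (β : V [⋀^Fin b]→L[ℝ] ℝ) (v : Fin p → V) :
    wedge h α β v = ((a.factorial * b.factorial : ℝ)⁻¹) *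
      ∑ σ : Equiv.Perm (Fin p), ((Equiv.Perm.sign σ : ℤ) : ℝ) *
        (α (fun i => v (σ (wL h i))) * β (fun j => v (σ (wR h j)))) := by
  simp only [wedge, ContinuousAlternatingMap.smul_apply, smul_eq_mul,
    ContinuousMultilinearMap.alternatization_apply_apply]
  congr 1
  refine Finset.sum_congr rfl fun σ _ => ?_
  rw [Units.smul_def, zsmul_eq_mul]
  rfl

theorem wedge_add_left {a b p : ℕ} (h : a + b = p) (α α' : V [⋀^Fin a]→L[ℝ] ℝ)
    (β : V [⋀^Fin b]→L[ℝ] ℝ) : wedge h (α + α') β = wedge h α β + wedge h α' β := by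
  ext v
  simp only [wedge_apply, ContinuousAlternatingMap.add_apply, add_mul, mul_add,
    Finset.sum_add_distrib]

theorem wedge_add_right {a b p : ℕ} (h : a + b = p) (α : V [⋀^Fin a]→L[ℝ] ℝ)
    (β β' : V [⋀^Fin b]→L[ℝ] ℝ) : wedge h α (β + β') = wedge h α β + wedge h α β' := by
  ext v
  simp only [wedge_apply, ContinuousAlternatingMap.add_apply, mul_add,
    Finset.sum_add_distrib]

theorem wedge_smul_left {a b p : ℕ} (h : a + b = p) (c : ℝ) (α : V [⋀^Fin a]→L[ℝ] ℝ)
    (β : V [⋀^Fin b]→L[ℝ] ℝ) : wedge h (c • α) β = c • wedge h α β := by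
  ext v
  simp only [wedge_apply, ContinuousAlternatingMap.smul_apply, smul_eq_mul, mul_assoc,
    mul_left_comm _ c, ← Finset.mul_sum]

theorem wedge_smul_right {a b p : ℕ} (h : a + b = p) (c : ℝ) (α : V [⋀^Fin a]→L[ℝ] ℝ)
    (β : V [⋀^Fin b]→L[ℝ] ℝ) : wedge h α (c • β) = c • wedge h α β := by
  ext v
  simp only [wedge_apply, ContinuousAlternatingMap.smul_apply, smul_eq_mul,
    mul_left_comm _ c, ← Finset.mul_sum]

theorem wedge_comp {a b p : ℕ} (h : a + b = p) (α : V [⋀^Fin a]→L[ℝ] ℝ)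
    (β : V [⋀^Fin b]→L[ℝ] ℝ) (g : W →L[ℝ] V) :
    (wedge h α β).compContinuousLinearMap g =
      wedge h (α.compContinuousLinearMap g) (β.compContinuousLinearMap g) := by
  ext v
  simp [wedge_apply, Function.comp_def]

theorem norm_wedge_le {a b p : ℕ} (h : a + b = p) (α : V [⋀^Fin a]→L[ℝ] ℝ)
    (β : V [⋀^Fin b]→L[ℝ] ℝ) :
    ‖wedge h α β‖ ≤ ((a.factorial * b.factorial : ℝ)⁻¹ * p.factorial) * ‖α‖ * ‖β‖ := by
  refine ContinuousAlternatingMap.opNorm_le_bound _ (by positivity) fun v => ?_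
  rw [wedge_apply, norm_mul, Real.norm_of_nonneg (by positivity : (0:ℝ) ≤ (_)⁻¹), mul_assoc,
    mul_assoc, mul_assoc]
  refine mul_le_mul_of_nonneg_left ?_ (by positivity)
  refine (norm_sum_le _ _).trans ?_
  have : ∀ σ ∈ (Finset.univ : Finset (Equiv.Perm (Fin p))),
      ‖((Equiv.Perm.sign σ : ℤ) : ℝ) *
        (α (fun i => v (σ (wL h i))) * β (fun j => v (σ (wR h j))))‖ ≤
        ‖α‖ * (‖β‖ * ∏ i, ‖v i‖) := by
    intro σ _
    have hs : ‖((Equiv.Perm.sign σ : ℤ) : ℝ)‖ = 1 := by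
      rcases Int.units_eq_one_or (Equiv.Perm.sign σ) with h | h <;> simp [h]
    have hp : ∏ i, ‖v i‖ = (∏ i, ‖v (σ (wL h i))‖) * ∏ j, ‖v (σ (wR h j))‖ := by
      rw [← Equiv.prod_comp σ]
      subst h
      rw [Fin.prod_univ_add]
      rfl
    rw [norm_mul, hs, one_mul, norm_mul, hp]
    calc _ ≤ (‖α‖ * ∏ i, ‖v (σ (wL h i))‖) * (‖β‖ * ∏ j, ‖v (σ (wR h j))‖) :=
          mul_le_mul (α.le_opNorm _) (β.le_opNorm _) (norm_nonneg _) (by positivity)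
      _ = _ := by ring
  refine (Finset.sum_le_sum this).trans (le_of_eq ?_)
  rw [Finset.sum_const, Finset.card_univ, Fintype.card_perm, Fintype.card_fin, nsmul_eq_mul]

/-- The exterior product as a continuous bilinear map. -/
def wedgeL (V : Type*) [NormedAddCommGroup V] [NormedSpace ℝ V] {a b p : ℕ} (h : a + b = p) :
    (V [⋀^Fin a]→L[ℝ] ℝ) →L[ℝ] (V [⋀^Fin b]→L[ℝ] ℝ) →L[ℝ] (V [⋀^Fin p]→L[ℝ] ℝ) :=
  LinearMap.mkContinuous₂
    (LinearMap.mk₂ ℝ (wedge h) (wedge_add_left h) (fun c α β => wedge_smul_left h c α β)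
      (wedge_add_right h) (fun c α β => wedge_smul_right h c α β)) _ (norm_wedge_le h)

@[simp]
theorem wedgeL_apply {a b p : ℕ} (h : a + b = p) (α : V [⋀^Fin a]→L[ℝ] ℝ)
    (β : V [⋀^Fin b]→L[ℝ] ℝ) : wedgeL V h α β = wedge h α β := rfl

/-! #### The Leibniz rule -/

theorem sum_perm_succ {p : ℕ} (Φ : Equiv.Perm (Fin (p + 1)) → ℝ) :
    ∑ σ, Φ σ = ∑ i : Fin (p + 1), ∑ τ : Equiv.Perm (Fin p),
      Φ (i.cycleRange.symm * Equiv.Perm.decomposeFin.symm (0, τ)) := by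
  rw [← Fintype.sum_prod_type']
  symm
  let f : Fin (p + 1) × Equiv.Perm (Fin p) → Equiv.Perm (Fin (p + 1)) :=
    fun x => x.1.cycleRange.symm * Equiv.Perm.decomposeFin.symm (0, x.2)
  have hf : Function.Bijective f := by
    rw [Fintype.bijective_iff_injective_and_card]
    constructor
    · rintro ⟨i, τ⟩ ⟨j, τ'⟩ hij
      have h0 : i = j := by
        have := congrArg (fun e : Equiv.Perm (Fin (p + 1)) => e 0) hij
        simpa [f] using this
      subst h0
      have h1 := mul_left_cancel hij
      have h2 := Equiv.Perm.decomposeFin.symm.injective h1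
      simpa using h2
    · simp [Fintype.card_perm, Nat.factorial_succ]
  exact hf.sum_comp Φ

theorem extPerm_succ {p : ℕ} (i : Fin (p + 1)) (τ : Equiv.Perm (Fin p)) (j : Fin p) :
    (i.cycleRange.symm * Equiv.Perm.decomposeFin.symm (0, τ)) j.succ = i.succAbove (τ j) := by
  simp [Equiv.Perm.decomposeFin_symm_apply_succ]

theorem extPerm_zero {p : ℕ} (i : Fin (p + 1)) (τ : Equiv.Perm (Fin p)) :
    (i.cycleRange.symm * Equiv.Perm.decomposeFin.symm (0, τ)) 0 = i := by
  simp

theorem extPerm_sign {p : ℕ} (i : Fin (p + 1)) (τ : Equiv.Perm (Fin p)) :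
    ((Equiv.Perm.sign (i.cycleRange.symm * Equiv.Perm.decomposeFin.symm (0, τ)) : ℤ) : ℝ) =
      (-1) ^ (i : ℕ) * ((Equiv.Perm.sign τ : ℤ) : ℝ) := by
  rw [Equiv.Perm.sign_mul, Equiv.Perm.sign_symm, Fin.sign_cycleRange,
    Equiv.Perm.decomposeFin.symm_sign]
  simp

/-- A permutation of the first block and a permutation of the second block. -/
def blockPerm {a b p : ℕ} (h : a + b = p) (ρ : Equiv.Perm (Fin a)) (ρ' : Equiv.Perm (Fin b)) :
    Equiv.Perm (Fin p) :=
  (finSumFinEquiv.trans (finCongr h)).permCongr (Equiv.Perm.sumCongr ρ ρ')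

theorem blockPerm_wL {a b p : ℕ} (h : a + b = p) (ρ : Equiv.Perm (Fin a))
    (ρ' : Equiv.Perm (Fin b)) (i : Fin a) : blockPerm h ρ ρ' (wL h i) = wL h (ρ i) := by
  subst h
  simp [blockPerm, wL, Equiv.permCongr_apply]

theorem blockPerm_wR {a b p : ℕ} (h : a + b = p) (ρ : Equiv.Perm (Fin a))
    (ρ' : Equiv.Perm (Fin b)) (i : Fin b) : blockPerm h ρ ρ' (wR h i) = wR h (ρ' i) := by
  subst h
  simp [blockPerm, wR, Equiv.permCongr_apply]

theorem blockPerm_sign {a b p : ℕ} (h : a + b = p) (ρ : Equiv.Perm (Fin a))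
    (ρ' : Equiv.Perm (Fin b)) :
    Equiv.Perm.sign (blockPerm h ρ ρ') = Equiv.Perm.sign ρ * Equiv.Perm.sign ρ' := by
  simp [blockPerm]

theorem sign_mul_cast {p : ℕ} (σ π : Equiv.Perm (Fin p)) :
    ((Equiv.Perm.sign (σ * π) : ℤ) : ℝ) =
      ((Equiv.Perm.sign σ : ℤ) : ℝ) * ((Equiv.Perm.sign π : ℤ) : ℝ) := by
  simp

theorem neg_one_pow_mul_self' (k : ℕ) : ((-1 : ℝ) ^ k) * (-1) ^ k = 1 := by
  rw [← mul_pow]; simp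

theorem altUncurry_wedge_left {a b p : ℕ} (h : a + b = p) (h' : (a + 1) + b = p + 1)
    (A : V →L[ℝ] V [⋀^Fin a]→L[ℝ] ℝ) (β : V [⋀^Fin b]→L[ℝ] ℝ) :
    ContinuousAlternatingMap.alternatizeUncurryFin ((wedgeL V h).flip β ∘L A) =
      wedge h' (ContinuousAlternatingMap.alternatizeUncurryFin A) β := by
  ext v
  have e0 : wL h' 0 = 0 := by ext; simp [wL]
  have eS : ∀ k, wL h' (Fin.succ k) = (wL h k).succ := by intro k; ext; simp [wL]
  have eR : ∀ k, wR h' k = (wR h k).succ := by intro k; ext; simp [wR]; omega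
  set S : ℝ := ∑ σ : Equiv.Perm (Fin (p + 1)), ((Equiv.Perm.sign σ : ℤ) : ℝ) *
    (A (v (σ 0)) (fun k => v (σ (wL h k).succ)) * β (fun k => v (σ (wR h k).succ))) with hS
  have lhs : ContinuousAlternatingMap.alternatizeUncurryFin ((wedgeL V h).flip β ∘L A) v =
      ((a.factorial * b.factorial : ℝ)⁻¹) * S := by
    rw [ContinuousAlternatingMap.alternatizeUncurryFin_apply, hS, sum_perm_succ, Finset.mul_sum]
    refine Finset.sum_congr rfl fun i _ => ?_
    simp only [extPerm_zero, extPerm_succ, extPerm_sign]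
    simp only [ContinuousLinearMap.comp_apply, ContinuousLinearMap.flip_apply, wedgeL_apply,
      wedge_apply, Fin.removeNth, zsmul_eq_mul, Int.cast_pow, Int.cast_neg, Int.cast_one,
      mul_assoc]
    rw [mul_left_comm, Finset.mul_sum]
  have rhs : wedge h' (ContinuousAlternatingMap.alternatizeUncurryFin A) β v =
      (((a + 1).factorial * b.factorial : ℝ)⁻¹) * ((a + 1) * S) := by
    rw [wedge_apply]
    congr 1
    simp only [ContinuousAlternatingMap.alternatizeUncurryFin_apply, Finset.sum_mul,
      Finset.mul_sum]
    rw [Finset.sum_comm]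
    have : ∀ j ∈ (Finset.univ : Finset (Fin (a + 1))), ∑ σ : Equiv.Perm (Fin (p + 1)),
        ((Equiv.Perm.sign σ : ℤ) : ℝ) * (((-1 : ℤ) ^ (j : ℕ) • A (v (σ (wL h' j)))
          (j.removeNth fun i => v (σ (wL h' i)))) * β (fun k => v (σ (wR h' k)))) = S := by
      intro j _
      rw [← Equiv.sum_comp (Equiv.mulRight (blockPerm h' j.cycleRange 1)), hS]
      refine Finset.sum_congr rfl fun σ _ => ?_
      have hr : ∀ f : Fin (a + 1) → V, j.removeNth f = fun k => f (j.succAbove k) := fun _ => rfl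
      have hR : ∀ k, blockPerm h' j.cycleRange 1 (wR h' k) = (wR h k).succ := fun k => by
        rw [blockPerm_wR, eR, Equiv.Perm.one_apply]
      simp only [Equiv.coe_mulRight, sign_mul_cast, blockPerm_sign, Fin.sign_cycleRange,
        hr, Equiv.Perm.mul_apply, blockPerm_wL, hR, Fin.cycleRange_self,
        Fin.cycleRange_succAbove, e0, eS, zsmul_eq_mul, map_one,
        mul_one, Int.cast_pow, Int.cast_neg, Int.cast_one, Units.val_pow_eq_pow_val,
        Units.val_neg, Units.val_one]
      linear_combination (((Equiv.Perm.sign σ : ℤ) : ℝ) *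
        (A (v (σ 0)) (fun k => v (σ (wL h k).succ)) * β (fun k => v (σ (wR h k).succ)))) *
          neg_one_pow_mul_self' (j : ℕ)
    rw [Finset.sum_congr rfl this, Finset.sum_const]
    simp
  rw [lhs, rhs, Nat.factorial_succ]
  have : (a.factorial : ℝ) ≠ 0 := by positivity
  have : (b.factorial : ℝ) ≠ 0 := by positivity
  have : (a + 1 : ℝ) ≠ 0 := by positivity
  push_cast
  field_simp

theorem altUncurry_wedge_right {a b p : ℕ} (h : a + b = p) (h' : a + (b + 1) = p + 1)
    (α : V [⋀^Fin a]→L[ℝ] ℝ) (B : V →L[ℝ] V [⋀^Fin b]→L[ℝ] ℝ) :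
    ContinuousAlternatingMap.alternatizeUncurryFin (wedgeL V h α ∘L B) =
      ((-1 : ℝ) ^ a) • wedge h' α (ContinuousAlternatingMap.alternatizeUncurryFin B) := by
  ext v
  set S : ℝ := ∑ σ : Equiv.Perm (Fin (p + 1)), ((Equiv.Perm.sign σ : ℤ) : ℝ) *
    (α (fun k => v (σ (wL h k).succ)) *
      B (v (σ 0)) (fun k => v (σ (wR h k).succ))) with hS
  have lhs : ContinuousAlternatingMap.alternatizeUncurryFin (wedgeL V h α ∘L B) v =
      ((a.factorial * b.factorial : ℝ)⁻¹) * S := by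
    rw [ContinuousAlternatingMap.alternatizeUncurryFin_apply, hS, sum_perm_succ, Finset.mul_sum]
    refine Finset.sum_congr rfl fun i _ => ?_
    simp only [extPerm_zero, extPerm_succ, extPerm_sign]
    simp only [ContinuousLinearMap.comp_apply, wedgeL_apply,
      wedge_apply, Fin.removeNth, zsmul_eq_mul, Int.cast_pow, Int.cast_neg, Int.cast_one,
      mul_assoc]
    rw [mul_left_comm, Finset.mul_sum]
  have hap : a < p + 1 := by omega
  set i₀ : Fin (p + 1) := ⟨a, hap⟩ with hi₀
  have c0 : i₀.cycleRange (wR h' 0) = 0 := by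
    have : wR h' 0 = i₀ := by ext; simp [wR, hi₀]
    rw [this, Fin.cycleRange_self]
  have cL : ∀ k, i₀.cycleRange (wL h' k) = (wL h k).succ := by
    intro k
    have hk : wL h' k < i₀ := by simp [wL, hi₀, Fin.lt_def]
    ext
    rw [Fin.coe_cycleRange_of_lt hk]
    simp [wL]
  have cR : ∀ k, i₀.cycleRange (wR h' (Fin.succ k)) = (wR h k).succ := by
    intro k
    have hk : i₀ < wR h' (Fin.succ k) := by simp [wR, hi₀, Fin.lt_def]
    rw [Fin.cycleRange_of_gt hk]
    ext
    simp [wR]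
    omega
  have rhs : wedge h' α (ContinuousAlternatingMap.alternatizeUncurryFin B) v =
      ((a.factorial * (b + 1).factorial : ℝ)⁻¹) * ((b + 1) * ((-1 : ℝ) ^ a * S)) := by
    rw [wedge_apply]
    congr 1
    simp only [ContinuousAlternatingMap.alternatizeUncurryFin_apply,
      Finset.mul_sum]
    rw [Finset.sum_comm]
    have : ∀ j ∈ (Finset.univ : Finset (Fin (b + 1))), ∑ σ : Equiv.Perm (Fin (p + 1)),
        ((Equiv.Perm.sign σ : ℤ) : ℝ) * (α (fun k => v (σ (wL h' k))) *
          ((-1 : ℤ) ^ (j : ℕ) • B (v (σ (wR h' j)))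
          (j.removeNth fun i => v (σ (wR h' i))))) = (-1 : ℝ) ^ a * S := by
      intro j _
      rw [← Equiv.sum_comp (Equiv.mulRight (i₀.cycleRange * blockPerm h' 1 j.cycleRange)), hS,
        Finset.mul_sum]
      refine Finset.sum_congr rfl fun σ _ => ?_
      have hr : ∀ f : Fin (b + 1) → V, j.removeNth f = fun k => f (j.succAbove k) := fun _ => rfl
      have hv : (i₀ : ℕ) = a := rfl
      simp only [Equiv.coe_mulRight, sign_mul_cast, blockPerm_sign, Fin.sign_cycleRange,
        hr, hv, Equiv.Perm.mul_apply, blockPerm_wL, blockPerm_wR, Fin.cycleRange_self,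
        Fin.cycleRange_succAbove, c0, cL, cR, Equiv.Perm.one_apply, zsmul_eq_mul, map_one,
        one_mul, Int.cast_pow, Int.cast_neg, Int.cast_one, Units.val_pow_eq_pow_val,
        Units.val_neg, Units.val_one]
      linear_combination (((Equiv.Perm.sign σ : ℤ) : ℝ) * (-1 : ℝ) ^ a *
        (α (fun k => v (σ (wL h k).succ)) *
          B (v (σ 0)) (fun k => v (σ (wR h k).succ)))) * neg_one_pow_mul_self' (j : ℕ)
    rw [Finset.sum_congr rfl this, Finset.sum_const]
    simp
  rw [ContinuousAlternatingMap.smul_apply, lhs, rhs, Nat.factorial_succ, smul_eq_mul]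
  have : (a.factorial : ℝ) ≠ 0 := by positivity
  have : (b.factorial : ℝ) ≠ 0 := by positivity
  have : (b + 1 : ℝ) ≠ 0 := by positivity
  have hs := neg_one_pow_mul_self' a
  push_cast
  field_simp
  linear_combination -S * hs

/-- The Leibniz rule for differential forms on a normed space. -/
theorem extDeriv_wedge {a b p : ℕ} (h : a + b = p) (h₁ : (a + 1) + b = p + 1)
    (h₂ : a + (b + 1) = p + 1) {α : V → V [⋀^Fin a]→L[ℝ] ℝ} {β : V → V [⋀^Fin b]→L[ℝ] ℝ} {x : V}
    (hα : DifferentiableAt ℝ α x) (hβ : DifferentiableAt ℝ β x) :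
    extDeriv (fun y => wedge h (α y) (β y)) x =
      wedge h₁ (extDeriv α x) (β x) + ((-1 : ℝ) ^ a) • wedge h₂ (α x) (extDeriv β x) := by
  have hd : fderiv ℝ (fun y => wedge h (α y) (β y)) x =
      (wedgeL V h).flip (β x) ∘L fderiv ℝ α x + wedgeL V h (α x) ∘L fderiv ℝ β x := by
    have := ((wedgeL V h).hasFDerivAt_of_bilinear hα.hasFDerivAt hβ.hasFDerivAt).fderiv
    refine Eq.trans this ?_
    ext v : 1
    simp [add_comm]
  rw [extDeriv, hd, ContinuousAlternatingMap.alternatizeUncurryFin_add,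
    altUncurry_wedge_left h h₁, altUncurry_wedge_right h h₂]
  rfl

end Wedge

end

section

/-! ### Differential forms and the de Rham differential

A differential form on a diffeological space `X` is a family of smooth forms, one on the domain of
each plot of `X`, compatible with smooth changes of the plot. On a manifold (whose plots are the
smooth maps `ℝⁿ → X`), and on an embedded submanifold of a manifold with the induced plots, these
are the usual smooth differential forms `θ`, the form on the plot `P` being `P^* θ`. -/

/-- Pullback of a form on `ℝⁿ` along a map `ℝᵐ → ℝⁿ`. -/
def pull {m n p : ℕ} (g : Euc m → Euc n) (θ : Euc n → Euc n [⋀^Fin p]→L[ℝ] ℝ) :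
    Euc m → Euc m [⋀^Fin p]→L[ℝ] ℝ :=
  fun x => (θ (g x)).compContinuousLinearMap (fderiv ℝ g x)

/-- The real vector space `Ω^p(X)` of differential `p`-forms on a diffeological space, as a space of
families of forms. -/
def formSubmodule (p : ℕ) (X : Type u) [DiffeologicalSpace X] :
    Submodule ℝ (∀ n : ℕ, {P : Euc n → X // IsPlot P} → Euc n → Euc n [⋀^Fin p]→L[ℝ] ℝ) where
  carrier := {θ | (∀ n P, ContDiff ℝ ∞ (θ n P)) ∧
    ∀ (m n : ℕ) (P : {P : Euc n → X // IsPlot P}) (g : Euc m → Euc n) (hg : ContDiff ℝ ∞ g),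
      θ m ⟨P.1 ∘ g, isPlot_reparam P.2 hg⟩ = pull g (θ n P)}
  add_mem' := by
    rintro θ η ⟨h1, h2⟩ ⟨h3, h4⟩
    refine ⟨fun n P => (h1 n P).add (h3 n P), fun m n P g hg => ?_⟩
    funext x
    ext v
    have a := congrFun (h2 m n P g hg) x
    have b := congrFun (h4 m n P g hg) x
    simp only [Pi.add_apply, a, b, pull]
    rfl
  zero_mem' := ⟨fun _ _ => contDiff_const, fun _ _ _ _ _ => rfl⟩
  smul_mem' := by
    rintro c θ ⟨h1, h2⟩
    refine ⟨fun n P => (h1 n P).const_smul c, fun m n P g hg => ?_⟩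
    funext x
    ext v
    have a := congrFun (h2 m n P g hg) x
    simp only [Pi.smul_apply, a, pull]
    rfl

/-- The real vector space `Ω^p(X)` of differential `p`-forms on a diffeological space. -/
def Form (p : ℕ) (X : Type u) [DiffeologicalSpace X] : Type u := formSubmodule p X

instance (p : ℕ) (X : Type u) [DiffeologicalSpace X] : AddCommGroup (Form p X) :=
  inferInstanceAs (AddCommGroup (formSubmodule p X))

instance (p : ℕ) (X : Type u) [DiffeologicalSpace X] : Module ℝ (Form p X) :=
  inferInstanceAs (Module ℝ (formSubmodule p X))

namespace Form

variable {X Y Z : Type u} [DiffeologicalSpace X] [DiffeologicalSpace Y] [DiffeologicalSpace Z]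

theorem contDiff {p : ℕ} (θ : Form p X) (n : ℕ) (P : {P : Euc n → X // IsPlot P}) :
    ContDiff ℝ ∞ (θ.1 n P) := θ.2.1 n P

theorem differentiable {p : ℕ} (θ : Form p X) (n : ℕ) (P : {P : Euc n → X // IsPlot P}) :
    Differentiable ℝ (θ.1 n P) := (Form.contDiff θ n P).differentiable (by simp)

theorem ext {p : ℕ} {θ η : Form p X} (h : ∀ n P x, θ.1 n P x = η.1 n P x) : θ = η :=
  Subtype.ext (funext fun n => funext fun P => funext fun x => h n P x)

/-- The de Rham differential `Ω^p(X) → Ω^{p+1}(X)`. -/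
def d (p : ℕ) : Form p X →ₗ[ℝ] Form (p + 1) X where
  toFun θ := ⟨fun n P => extDeriv (θ.1 n P), by
    refine ⟨fun n P => ?_, fun m n P g hg => ?_⟩
    · have h : ContDiff ℝ ∞ (fderiv ℝ (θ.1 n P)) := (Form.contDiff θ n P).fderiv_right (by simp)
      exact (ContinuousAlternatingMap.alternatizeUncurryFinCLM ℝ (Euc n) ℝ).contDiff.comp h
    · funext x
      have h := congrArg (fun f => extDeriv f x) (θ.2.2 m n P g hg)
      refine h.trans ?_
      exact extDeriv_pullback (r := ∞) (Form.differentiable θ n P _) hg.contDiffAt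
        (by
          rw [minSmoothness_of_isRCLikeNormedField]
          exact WithTop.coe_le_coe.2 (le_top : (2 : ℕ∞) ≤ ⊤))⟩
  map_add' θ η := by
    refine Form.ext fun n P x => ?_
    exact extDeriv_add (Form.differentiable θ n P x) (Form.differentiable η n P x)
  map_smul' c θ := by
    refine Form.ext fun n P x => ?_
    exact extDeriv_smul c (θ.1 n P)

/-- The pullback of differential forms along a smooth map. -/
def pullback (p : ℕ) (f : X → Y) (hf : DSmooth f) : Form p Y →ₗ[ℝ] Form p X where
  toFun θ := ⟨fun n P => θ.1 n ⟨f ∘ P.1, hf n P.1 P.2⟩,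
    fun _ _ => θ.2.1 _ _, fun m n P g hg => θ.2.2 m n ⟨f ∘ P.1, hf n P.1 P.2⟩ g hg⟩
  map_add' _ _ := rfl
  map_smul' _ _ := rfl

/-- The exterior product `Ω^a(X) × Ω^b(X) → Ω^{a+b}(X)`. -/
def wedge {a b p : ℕ} (h : a + b = p) : Form a X →ₗ[ℝ] Form b X →ₗ[ℝ] Form p X :=
  LinearMap.mk₂ ℝ
    (fun α β => ⟨fun n P x => TwoGroupBundle.wedge h (α.1 n P x) (β.1 n P x), by
      refine ⟨fun n P => ?_, fun m n P g hg => ?_⟩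
      · exact ((wedgeL (Euc n) h).contDiff.comp (Form.contDiff α n P)).clm_apply (Form.contDiff β n P)
      · funext x
        have e1 := congrFun (α.2.2 m n P g hg) x
        have e2 := congrFun (β.2.2 m n P g hg) x
        refine Eq.trans (congrArg₂ (TwoGroupBundle.wedge h) e1 e2) ?_
        exact (wedge_comp h _ _ _).symm⟩)
    (fun α α' β => Form.ext fun n P x => wedge_add_left h _ _ _)
    (fun c α β => Form.ext fun n P x => wedge_smul_left h c _ _)
    (fun α β β' => Form.ext fun n P x => wedge_add_right h _ _ _)
    (fun c α β => Form.ext fun n P x => wedge_smul_right h c _ _)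

theorem d_pullback {p : ℕ} (f : X → Y) (hf : DSmooth f) (θ : Form p Y) :
    d p (pullback p f hf θ) = pullback (p + 1) f hf (d p θ) := rfl

theorem pullback_comp {p : ℕ} (f : X → Y) (hf : DSmooth f) (g : Y → Z) (hg : DSmooth g)
    (hgf : DSmooth (g ∘ f)) (θ : Form p Z) :
    pullback p f hf (pullback p g hg θ) = pullback p (g ∘ f) hgf θ := rfl

theorem pullback_congr {p : ℕ} {f g : X → Y} (hf : DSmooth f) (hg : DSmooth g) (h : f = g)
    (θ : Form p Y) : pullback p f hf θ = pullback p g hg θ := by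
  subst h; rfl

theorem pullback_wedge {a b p : ℕ} (h : a + b = p) (f : X → Y) (hf : DSmooth f)
    (α : Form a Y) (β : Form b Y) :
    pullback p f hf (wedge h α β) = wedge h (pullback a f hf α) (pullback b f hf β) := rfl

theorem d_wedge {a b p : ℕ} (h : a + b = p) (h₁ : (a + 1) + b = p + 1)
    (h₂ : a + (b + 1) = p + 1) (α : Form a X) (β : Form b X) :
    d p (wedge h α β) = wedge h₁ (d a α) β + ((-1 : ℝ) ^ a) • wedge h₂ α (d b β) := by
  refine Form.ext fun n P x => ?_
  exact extDeriv_wedge h h₁ h₂ (Form.differentiable α n P x) (Form.differentiable β n P x)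

end Form

end

section

/-! ### Smooth manifolds, submersions and fibre products -/

/-- Smooth manifolds: finite-dimensional, without boundary, Hausdorff and second countable. -/
structure Mfd : Type (u + 1) where
  /-- the points -/
  carrier : Type u
  /-- the model vector space -/
  E : Type
  /-- the model space of the charts -/
  H : Type
  [normedAddCommGroup : NormedAddCommGroup E]
  [normedSpace : NormedSpace ℝ E]
  [finiteDimensional : FiniteDimensional ℝ E]
  [topologicalSpaceH : TopologicalSpace H]
  /-- the model -/
  I : ModelWithCorners ℝ E H
  [boundaryless : I.Boundaryless]
  [topologicalSpace : TopologicalSpace carrier]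
  [chartedSpace : ChartedSpace H carrier]
  [isManifold : IsManifold I ∞ carrier]
  [t2Space : T2Space carrier]
  [secondCountable : SecondCountableTopology carrier]

namespace Mfd

instance : CoeSort Mfd.{u} (Type u) := ⟨Mfd.carrier⟩

attribute [instance] normedAddCommGroup normedSpace finiteDimensional topologicalSpaceH
  boundaryless topologicalSpace chartedSpace isManifold t2Space secondCountable

variable {M N P Q : Mfd.{u}}

/-- Smooth maps between manifolds. -/
def Smooth {M N : Mfd.{u}} (f : M → N) : Prop := ContMDiff M.I N.I ∞ f

/-- Smooth maps from `ℝⁿ` to a manifold. -/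
def SmoothPlot {n : ℕ} {M : Mfd.{u}} (f : Euc n → M) : Prop := ContMDiff 𝓘(ℝ, Euc n) M.I ∞ f

theorem Smooth.comp {g : N → P} {f : M → N} (hg : Smooth g) (hf : Smooth f) :
    Smooth (fun x => g (f x)) := ContMDiff.comp hg hf

theorem smooth_id : Smooth (fun x : M => x) := contMDiff_id

theorem smooth_const (y : N) : Smooth (fun _ : M => y) := contMDiff_const

theorem Smooth.comp_plot {n : ℕ} {f : M → N} (hf : Smooth f) {P : Euc n → M} (hP : SmoothPlot P) :
    SmoothPlot (fun x => f (P x)) := ContMDiff.comp hf hP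

/-- A smooth self-map of `ℝⁿ` with values in a given neighbourhood of `x`, equal to the identity
near `x`. -/
theorem exists_shrink {n : ℕ} (x : Euc n) {s : Set (Euc n)} (hs : IsOpen s) (hx : x ∈ s) :
    ∃ f : Euc n → Euc n, ContDiff ℝ ∞ f ∧ (∀ y, f y ∈ s) ∧ ∀ᶠ y in nhds x, f y = y := by
  obtain ⟨r, hr, hrs⟩ := Metric.isOpen_iff.1 hs x hx
  let χ : ContDiffBump x := ⟨r / 4, r / 2, by positivity, by linarith⟩
  refine ⟨fun y => x + χ y • (y - x), ?_, fun y => hrs ?_, ?_⟩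
  · exact contDiff_const.add (χ.contDiff.smul (contDiff_id.sub contDiff_const))
  · rw [Metric.mem_ball, dist_eq_norm, add_sub_cancel_left, norm_smul,
      Real.norm_of_nonneg χ.nonneg]
    by_cases h : dist y x < r / 2
    · rw [dist_eq_norm] at h
      calc χ y * ‖y - x‖ ≤ 1 * ‖y - x‖ := by
            gcongr; exact χ.le_one
        _ < r := by linarith
    · rw [χ.zero_of_le_dist (not_lt.1 h)]
      simpa using hr
  · filter_upwards [χ.eventuallyEq_one] with y hy
    simp [hy]

/-- The diffeology of a manifold: the plots are the smooth maps `ℝⁿ → M`. -/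
instance diffeology (M : Mfd.{u}) : DiffeologicalSpace M where
  plots n := {P | SmoothPlot P}
  constant_plots x := contMDiff_const
  plot_reparam {n m p f} hp hf := ContMDiff.comp (I' := 𝓘(ℝ, Euc m)) hp hf.contMDiff
  locality {n p} hp := by
    intro x
    obtain ⟨s, hs, hxs, h⟩ := hp x
    obtain ⟨f, hf, hfs, hfe⟩ := exists_shrink x hs hxs
    have h1 : ContMDiffAt 𝓘(ℝ, Euc n) M.I ∞ (p ∘ f) x := (h hfs hf) x
    refine h1.congr_of_eventuallyEq ?_
    filter_upwards [hfe] with y hy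
    simp [hy]

theorem isPlot_iff {n : ℕ} {f : Euc n → M} : IsPlot f ↔ SmoothPlot f := Iff.rfl

/-- The derivative of a map of manifolds at a point. -/
def dmap {M N : Mfd.{u}} (f : M → N) (x : M) : M.E →L[ℝ] N.E := mfderiv M.I N.I f x

theorem Smooth.mdiff {f : M → N} (hf : Smooth f) (x : M) : MDifferentiableAt M.I N.I f x :=
  (ContMDiff.contMDiffAt hf).mdifferentiableAt (by simp)

theorem dmap_comp {g : N → P} {f : M → N} (hg : Smooth g) (hf : Smooth f) (x : M) (v : M.E) :
    dmap (fun x => g (f x)) x v = dmap g (f x) (dmap f x v) := by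
  have := mfderiv_comp x (hg.mdiff (f x)) (hf.mdiff x)
  exact congrArg (fun L : M.E →L[ℝ] P.E => L v) this

theorem dmap_id (x : M) (v : M.E) : dmap (fun x : M => x) x v = v := by
  have : mfderiv M.I M.I (fun x : M => x) x = ContinuousLinearMap.id ℝ _ := mfderiv_id
  exact congrArg (fun L : M.E →L[ℝ] M.E => L v) this

/-- Surjective submersions: surjective smooth maps whose derivative at each point is surjective. -/
structure IsSurjSubmersion {M N : Mfd.{u}} (f : M → N) : Prop where
  smooth : Smooth f
  surjective : Function.Surjective f
  submersive : ∀ x, Function.Surjective (dmap f x)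

theorem IsSurjSubmersion.of_sections {f : M → N} (hf : Smooth f) (hs : Function.Surjective f)
    (h : ∀ x, ∃ g : N → M, Smooth g ∧ g (f x) = x ∧ ∀ y, f (g y) = y) :
    IsSurjSubmersion f := by
  refine ⟨hf, hs, fun x v => ?_⟩
  obtain ⟨g, hg, hgx, hfg⟩ := h x
  refine ⟨dmap g (f x) v, ?_⟩
  have h1 := dmap_comp hf hg (f x) v
  have h2 : (fun y => f (g y)) = fun y => y := funext hfg
  rw [h2, dmap_id, hgx] at h1
  exact h1.symm

theorem IsSurjSubmersion.comp {g : N → P} {f : M → N} (hg : IsSurjSubmersion g)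
    (hf : IsSurjSubmersion f) : IsSurjSubmersion (fun x => g (f x)) := by
  refine ⟨hg.smooth.comp hf.smooth, hg.surjective.comp hf.surjective, fun x v => ?_⟩
  obtain ⟨w, hw⟩ := hg.submersive (f x) v
  obtain ⟨z, hz⟩ := hf.submersive x w
  exact ⟨z, by rw [dmap_comp hg.smooth hf.smooth, hz, hw]⟩

/-! #### The point and products -/

/-- The one-point manifold. -/
def pt : Mfd.{u} where
  carrier := PUnit.{u + 1}
  E := Euc 0
  H := Euc 0
  I := 𝓘(ℝ, Euc 0)
  chartedSpace := ChartedSpace.ofDiscreteTopology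
  isManifold := IsManifold.of_discreteTopology _

instance : Subsingleton pt.{u} := inferInstanceAs (Subsingleton PUnit.{u + 1})
instance : Subsingleton pt.{u}.E := inferInstanceAs (Subsingleton (Euc 0))

/-- The product of two manifolds. -/
abbrev prod (M N : Mfd.{u}) : Mfd.{u} where
  carrier := M × N
  E := M.E × N.E
  H := ModelProd M.H N.H
  I := M.I.prod N.I

theorem smooth_fst : Smooth (M := prod M N) (N := M) Prod.fst := contMDiff_fst
theorem smooth_snd : Smooth (M := prod M N) (N := N) Prod.snd := contMDiff_snd

theorem Smooth.prodMk {f : M → N} {g : M → P} (hf : Smooth f) (hg : Smooth g) :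
    Smooth (N := prod N P) (fun x => (f x, g x)) := ContMDiff.prodMk hf hg

theorem SmoothPlot.prodMk {n : ℕ} {f : Euc n → N} {g : Euc n → P} (hf : SmoothPlot f)
    (hg : SmoothPlot g) : SmoothPlot (M := prod N P) (fun x => (f x, g x)) :=
  ContMDiff.prodMk hf hg

theorem dmap_prodMk {f : M → N} {g : M → P} (hf : Smooth f) (hg : Smooth g) (x : M) (v : M.E) :
    dmap (N := prod N P) (fun x => (f x, g x)) x v = (dmap f x v, dmap g x v) := by
  have := mfderiv_prodMk (hf.mdiff x) (hg.mdiff x)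
  exact congrArg (fun L : M.E →L[ℝ] N.E × P.E => L v) this

theorem dmap_fst (x : prod M N) (v : (prod M N).E) :
    dmap (M := prod M N) (N := M) Prod.fst x v = v.1 := by
  have : mfderiv (M.I.prod N.I) M.I Prod.fst x = ContinuousLinearMap.fst ℝ M.E N.E := mfderiv_fst
  exact congrArg (fun L : (prod M N).E →L[ℝ] M.E => L v) this

theorem dmap_snd (x : prod M N) (v : (prod M N).E) :
    dmap (M := prod M N) (N := N) Prod.snd x v = v.2 := by
  have : mfderiv (M.I.prod N.I) N.I Prod.snd x = ContinuousLinearMap.snd ℝ M.E N.E := mfderiv_snd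
  exact congrArg (fun L : (prod M N).E →L[ℝ] N.E => L v) this

/-- The product of two maps. -/
def pmap {M N P Q : Mfd.{u}} (f : M → P) (g : N → Q) (x : prod M N) : prod P Q :=
  (f x.1, g x.2)

theorem Smooth.pmap {f : M → P} {g : N → Q} (hf : Smooth f) (hg : Smooth g) :
    Smooth (Mfd.pmap f g) :=
  Smooth.prodMk (M := prod M N) (Smooth.comp hf smooth_fst) (Smooth.comp hg smooth_snd)

theorem dmap_pmap {f : M → P} {g : N → Q} (hf : Smooth f) (hg : Smooth g) (x : prod M N)
    (v : M.E × N.E) :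
    dmap (Mfd.pmap f g) x v = (dmap f x.1 v.1, dmap g x.2 v.2) := by
  have h := dmap_prodMk (M := prod M N) (Smooth.comp hf smooth_fst) (Smooth.comp hg smooth_snd) x v
  rw [dmap_comp hf smooth_fst, dmap_comp hg smooth_snd, dmap_fst, dmap_snd] at h
  exact h

theorem IsSurjSubmersion.pmap {f : M → P} {g : N → Q} (hf : IsSurjSubmersion f)
    (hg : IsSurjSubmersion g) : IsSurjSubmersion (Mfd.pmap f g) := by
  refine ⟨hf.smooth.pmap hg.smooth, ?_, ?_⟩
  · rintro ⟨y, z⟩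
    obtain ⟨a, rfl⟩ := hf.surjective y
    obtain ⟨b, rfl⟩ := hg.surjective z
    exact ⟨(a, b), rfl⟩
  · rintro x ⟨v, w⟩
    obtain ⟨a, ha⟩ := hf.submersive x.1 v
    obtain ⟨b, hb⟩ := hg.submersive x.2 w
    exact ⟨(a, b), by rw [dmap_pmap hf.smooth hg.smooth, ha, hb]⟩

end Mfd

end

section

namespace Mfd

/-! #### Embedded submanifolds -/

/-- A local parametrization `V → S` of a subset `S` of a manifold near `x`, with a local inverse
that extends smoothly to an open subset `U` of the ambient manifold. -/
structure LocalParam (A : Mfd.{u}) (S : Set A) (K : Type) [NormedAddCommGroup K]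
    [NormedSpace ℝ K] (x : A) where
  /-- the chart -/
  chart : A → K
  /-- the parametrization -/
  param : K → A
  /-- the domain of the chart -/
  U : Set A
  /-- the domain of the parametrization -/
  V : Set K
  isOpen_U : IsOpen U
  isOpen_V : IsOpen V
  mem_U : x ∈ U
  chart_smooth : ContMDiffOn A.I 𝓘(ℝ, K) ∞ chart U
  param_smooth : ContMDiffOn 𝓘(ℝ, K) A.I ∞ param V
  param_mem_S : ∀ k ∈ V, param k ∈ S
  param_mem_U : ∀ k ∈ V, param k ∈ U
  chart_mem : ∀ y ∈ S, y ∈ U → chart y ∈ V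
  chart_param : ∀ k ∈ V, chart (param k) = k
  param_chart : ∀ y ∈ S, y ∈ U → param (chart y) = y

section Sub

variable {A : Mfd.{u}} {S : Set A} {K : Type} [NormedAddCommGroup K] [NormedSpace ℝ K]

open Classical in
/-- The chart of a subset given by a local parametrization. -/
def LocalParam.toHomeo {x : S} (c : LocalParam A S K x.1) : OpenPartialHomeomorph S K where
  toFun y := c.chart y.1
  invFun k := if h : c.param k ∈ S then ⟨c.param k, h⟩ else x
  source := {y | y.1 ∈ c.U}
  target := c.V
  map_source' y hy := c.chart_mem y.1 y.2 hy
  map_target' k hk := by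
    simp only [dif_pos (c.param_mem_S k hk)]
    exact c.param_mem_U k hk
  left_inv' y hy := by
    have h := c.param_chart y.1 y.2 hy
    rw [dif_pos (by rw [h]; exact y.2)]
    exact Subtype.ext h
  right_inv' k hk := by
    simp only [dif_pos (c.param_mem_S k hk)]
    exact c.chart_param k hk
  open_source := c.isOpen_U.preimage continuous_subtype_val
  open_target := c.isOpen_V
  continuousOn_toFun :=
    c.chart_smooth.continuousOn.comp continuous_subtype_val.continuousOn fun _ hy => hy
  continuousOn_invFun := by
    rw [Topology.IsInducing.subtypeVal.continuousOn_iff]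
    refine c.param_smooth.continuousOn.congr fun k hk => ?_
    simp only [Function.comp_apply, dif_pos (c.param_mem_S k hk)]

theorem LocalParam.toHomeo_symm_val {x : S} (c : LocalParam A S K x.1) {k : K} (hk : k ∈ c.V) :
    (c.toHomeo.symm k).1 = c.param k := by
  exact congrArg Subtype.val (dif_pos (c.param_mem_S k hk))

/-- A subset of a manifold with local parametrizations near each of its points is a manifold. -/
def sub (A : Mfd.{u}) (S : Set A) (K : Type) [NormedAddCommGroup K] [NormedSpace ℝ K]
    [FiniteDimensional ℝ K] (c : ∀ x : S, LocalParam A S K x.1) : Mfd.{u} where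
  carrier := S
  E := K
  H := K
  I := 𝓘(ℝ, K)
  chartedSpace :=
    { atlas := Set.range fun x => (c x).toHomeo
      chartAt := fun x => (c x).toHomeo
      mem_chart_source := fun x => (c x).mem_U
      chart_mem_atlas := fun x => ⟨x, rfl⟩ }
  isManifold := by
    let _ : ChartedSpace K S :=
      { atlas := Set.range fun x => (c x).toHomeo
        chartAt := fun x => (c x).toHomeo
        mem_chart_source := fun x => (c x).mem_U
        chart_mem_atlas := fun x => ⟨x, rfl⟩ }
    refine isManifold_of_contDiffOn 𝓘(ℝ, K) ∞ S ?_
    rintro _ _ ⟨x, rfl⟩ ⟨y, rfl⟩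
    have key : ContMDiffOn 𝓘(ℝ, K) 𝓘(ℝ, K) ∞ (fun k => (c y).chart ((c x).param k))
        ((c x).V ∩ (c x).param ⁻¹' (c y).U) :=
      (c y).chart_smooth.comp ((c x).param_smooth.mono Set.inter_subset_left) fun k hk => hk.2
    rw [contMDiffOn_iff_contDiffOn] at key
    refine (key.mono ?_).congr ?_
    · rintro k ⟨⟨hk, hk'⟩, -⟩
      refine ⟨hk, ?_⟩
      have := (c x).toHomeo_symm_val (k := k) hk
      change ((c x).toHomeo.symm k).1 ∈ (c y).U at hk'
      rwa [this] at hk'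
    · rintro k ⟨⟨hk, hk'⟩, -⟩
      have := (c x).toHomeo_symm_val (k := k) hk
      change (c y).chart ((c x).toHomeo.symm k).1 = _
      rw [this]

variable [FiniteDimensional ℝ K] (c : ∀ x : S, LocalParam A S K x.1)

/-- The inclusion of a submanifold. -/
def incl (x : sub A S K c) : A := x.1

theorem smooth_incl : Smooth (incl c) := by
  intro x
  have h1 : ContMDiffAt (sub A S K c).I 𝓘(ℝ, K) ∞ (fun y : sub A S K c => (c x).chart y.1) x :=
    (contMDiffOn_chart (I := (sub A S K c).I) (n := ∞) (H := (sub A S K c).H) (x := x)).contMDiffAt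
      ((c x).toHomeo.open_source.mem_nhds (c x).mem_U)
  have hV : (c x).chart x.1 ∈ (c x).V := (c x).chart_mem x.1 x.2 (c x).mem_U
  have h2 : ContMDiffAt 𝓘(ℝ, K) A.I ∞ (c x).param ((c x).chart x.1) :=
    (c x).param_smooth.contMDiffAt ((c x).isOpen_V.mem_nhds hV)
  refine (h2.comp x h1).congr_of_eventuallyEq ?_
  filter_upwards [(c x).toHomeo.open_source.mem_nhds (c x).mem_U] with y hy
  exact ((c x).param_chart y.1 y.2 hy).symm

theorem contMDiffAt_sub {E' H' X : Type*} [NormedAddCommGroup E'] [NormedSpace ℝ E']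
    [TopologicalSpace H'] {J : ModelWithCorners ℝ E' H'} [TopologicalSpace X] [ChartedSpace H' X]
    {f : X → sub A S K c} (hf : ContMDiff J A.I ∞ fun x => (f x).1) :
    ContMDiff J (sub A S K c).I ∞ f := by
  intro x
  have hcont : Continuous f := continuous_induced_rng.2 hf.continuous
  have hU : (f x).1 ∈ (c (f x)).U := (c (f x)).mem_U
  have hV : (c (f x)).chart (f x).1 ∈ (c (f x)).V := (c (f x)).chart_mem _ (f x).2 hU
  have h1 : ContMDiffAt J 𝓘(ℝ, K) ∞ (fun y => (c (f x)).chart (f y).1) x :=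
    ((c (f x)).chart_smooth.contMDiffAt ((c (f x)).isOpen_U.mem_nhds hU)).comp x (hf x)
  have h2 : ContMDiffAt (M' := (sub A S K c).carrier) 𝓘(ℝ, K) (sub A S K c).I ∞ (c (f x)).toHomeo.symm
      ((c (f x)).chart (f x).1) :=
    (contMDiffOn_chart_symm (I := (sub A S K c).I) (n := ∞) (H := (sub A S K c).H)
      (x := f x)).contMDiffAt ((c (f x)).isOpen_V.mem_nhds hV)
  refine (h2.comp x h1).congr_of_eventuallyEq ?_
  filter_upwards [hcont.continuousAt ((c (f x)).toHomeo.open_source.mem_nhds hU)] with y hy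
  exact ((c (f x)).toHomeo.left_inv hy).symm

theorem dmap_incl_injective (x : sub A S K c) : Function.Injective (dmap (incl c) x) := by
  have hU : x.1 ∈ (c x).U := (c x).mem_U
  have hV : (c x).chart x.1 ∈ (c x).V := (c x).chart_mem _ x.2 hU
  have h1 : ContMDiffAt A.I 𝓘(ℝ, K) ∞ (c x).chart (incl c x) :=
    (c x).chart_smooth.contMDiffAt ((c x).isOpen_U.mem_nhds hU)
  obtain ⟨σ, hσ⟩ : ∃ σ : K → (sub A S K c).carrier, σ = (c x).toHomeo.symm := ⟨_, rfl⟩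
  have h2 : ContMDiffAt (M' := (sub A S K c).carrier) 𝓘(ℝ, K) (sub A S K c).I ∞ σ ((c x).chart x.1) := by
    rw [hσ]
    exact (contMDiffOn_chart_symm (I := (sub A S K c).I) (n := ∞) (H := (sub A S K c).H)
      (x := x)).contMDiffAt ((c x).isOpen_V.mem_nhds hV)
  have h3 := (smooth_incl c).mdiff x
  have h4 := h1.mdifferentiableAt (by simp)
  have h5 := h2.mdifferentiableAt (by simp)
  have e : (fun y => σ ((c x).chart (incl c y))) =ᶠ[nhds x] fun y => y := by
    filter_upwards [(c x).toHomeo.open_source.mem_nhds hU] with y hy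
    rw [hσ]
    exact (c x).toHomeo.left_inv hy
  have h45 := h4.comp x h3
  have h6 := mfderiv_comp x (f := fun y => (c x).chart (incl c y)) h5 h45
  have h7 := mfderiv_comp x (f := incl c) (g := (c x).chart) h4 h3
  have h8 := e.mfderiv_eq (I := (sub A S K c).I) (I' := (sub A S K c).I)
  intro v w hvw
  have h9 := dmap_id x v
  have h10 := dmap_id x w
  have key : ∀ v, dmap (fun y : sub A S K c => y) x v =
      mfderiv 𝓘(ℝ, K) (sub A S K c).I σ ((c x).chart x.1)
        (mfderiv A.I 𝓘(ℝ, K) (c x).chart (incl c x) (dmap (incl c) x v)) := by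
    intro v
    have h11 := congrArg (fun L : K →L[ℝ] K => L v) h8
    refine h11.symm.trans ?_
    have h12 := congrArg (fun L : K →L[ℝ] K => L v) h6
    refine h12.trans ?_
    have h13 := congrArg (fun L : K →L[ℝ] K => L v) h7
    exact congrArg (mfderiv 𝓘(ℝ, K) (sub A S K c).I σ ((c x).chart x.1)) h13
  rw [← h9, ← h10, key, key, hvw]

end Sub

end Mfd

end

section

namespace Mfd

/-! #### Fibre products along submersions -/

/-- A surjective linear map is a coordinate projection. -/
theorem exists_linear_split {V W : Type} [NormedAddCommGroup V] [NormedSpace ℝ V]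
    [FiniteDimensional ℝ V] [NormedAddCommGroup W] [NormedSpace ℝ W] [FiniteDimensional ℝ W]
    (A : V →L[ℝ] W) (hA : Function.Surjective A) :
    ∃ (q : V →L[ℝ] Euc (Module.finrank ℝ V - Module.finrank ℝ W))
      (C : V ≃L[ℝ] W × Euc (Module.finrank ℝ V - Module.finrank ℝ W)),
      (C : V →L[ℝ] _) = A.prod q := by
  have hr := LinearMap.finrank_range_add_finrank_ker (A : V →ₗ[ℝ] W)
  rw [LinearMap.range_eq_top.2 hA, finrank_top] at hr
  obtain ⟨g, hg⟩ := LinearMap.exists_leftInverse_of_injective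
    (LinearMap.ker (A : V →ₗ[ℝ] W)).subtype (Submodule.ker_subtype _)
  have hk : Module.finrank ℝ (LinearMap.ker (A : V →ₗ[ℝ] W)) =
      Module.finrank ℝ (Euc (Module.finrank ℝ V - Module.finrank ℝ W)) := by
    rw [finrank_euclideanSpace, Fintype.card_fin]; omega
  let e := LinearEquiv.ofFinrankEq _ _ hk
  let q : V →L[ℝ] Euc (Module.finrank ℝ V - Module.finrank ℝ W) :=
    LinearMap.toContinuousLinearMap (e.toLinearMap ∘ₗ g)
  have hinj : Function.Injective (A.prod q).toLinearMap := by
    rw [← LinearMap.ker_eq_bot, LinearMap.ker_eq_bot']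
    intro v hv
    have h1 : A v = 0 := congrArg Prod.fst hv
    have h2 : e (g v) = 0 := congrArg Prod.snd hv
    have h3 : g v = 0 := by simpa using h2
    have h4 := congrArg (fun L => L ⟨v, h1⟩) hg
    simp only [LinearMap.comp_apply, Submodule.subtype_apply, LinearMap.id_apply] at h4
    rw [h3] at h4
    exact (congrArg Subtype.val h4).symm
  have hd : Module.finrank ℝ V =
      Module.finrank ℝ (W × Euc (Module.finrank ℝ V - Module.finrank ℝ W)) := by
    rw [Module.finrank_prod, finrank_euclideanSpace, Fintype.card_fin]; omega
  refine ⟨q, (LinearEquiv.ofInjectiveOfFinrankEq _ hinj hd).toContinuousLinearEquiv, ?_⟩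
  ext v <;> rfl

variable {M M' N : Mfd.{u}}

/-- The dimension of the fibres of a submersion. -/
abbrev fibDim (M N : Mfd.{u}) : ℕ := Module.finrank ℝ M.E - Module.finrank ℝ N.E

/-- A submersion is locally a projection. -/
theorem exists_split {f : M → N} (hf : Smooth f) (x : M) (hx : Function.Surjective (dmap f x)) :
    ∃ (π : M → Euc (fibDim M N)) (τ : N × Euc (fibDim M N) → M) (W : Set M)
      (D : Set (N × Euc (fibDim M N))), IsOpen W ∧ IsOpen D ∧ x ∈ W ∧
      ContMDiffOn M.I 𝓘(ℝ, Euc (fibDim M N)) ∞ π W ∧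
      ContMDiffOn (N.I.prod 𝓘(ℝ, Euc (fibDim M N))) M.I ∞ τ D ∧
      (∀ y ∈ W, (f y, π y) ∈ D ∧ τ (f y, π y) = y) ∧
      (∀ z ∈ D, τ z ∈ W ∧ f (τ z) = z.1 ∧ π (τ z) = z.2) := by
  obtain ⟨q, C, hC⟩ := exists_linear_split (dmap f x) hx
  set φ := extChartAt M.I x with hφ
  set ψ := extChartAt N.I (f x) with hψ
  set F : M.E → N.E := fun e => ψ (f (φ.symm e)) with hF
  set G : M.E → N.E × Euc (fibDim M N) := fun e => (F e, q e) with hG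
  set D₀ : Set M.E := φ.target ∩ φ.symm ⁻¹' (f ⁻¹' ψ.source) with hD₀
  have hfc : Continuous f := ContMDiff.continuous hf
  have hφso : IsOpen φ.source := isOpen_extChartAt_source x
  have hψso : IsOpen ψ.source := isOpen_extChartAt_source (f x)
  have hφto : IsOpen φ.target := isOpen_extChartAt_target x
  have hD₀o : IsOpen D₀ :=
    (continuousOn_extChartAt_symm x).isOpen_inter_preimage hφto (hψso.preimage hfc)
  have hxφ : x ∈ φ.source := mem_extChartAt_source x
  have hφx : φ x ∈ D₀ := by
    refine ⟨φ.map_source hxφ, ?_⟩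
    change f (φ.symm (φ x)) ∈ ψ.source
    rw [φ.left_inv hxφ]
    exact mem_extChartAt_source (f x)
  have hFs : ContDiffOn ℝ ∞ F D₀ := by
    rw [← contMDiffOn_iff_contDiffOn]
    have h1 : ContMDiffOn 𝓘(ℝ, M.E) N.I ∞ (fun e => f (φ.symm e)) D₀ :=
      ContMDiff.comp_contMDiffOn hf ((contMDiffOn_extChartAt_symm x).mono Set.inter_subset_left)
    exact (contMDiffOn_extChartAt (x := f x)).comp h1 fun e he => by
      have := he.2
      rwa [Set.mem_preimage, Set.mem_preimage, hψ, extChartAt_source] at this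
  have hGs : ContDiffOn ℝ ∞ G D₀ := hFs.prodMk q.contDiff.contDiffOn
  have hGat : ∀ e ∈ D₀, ContDiffAt ℝ ∞ G e := fun e he => hGs.contDiffAt (hD₀o.mem_nhds he)
  have hFd : fderiv ℝ F (φ x) = dmap f x := by
    have h1 : mfderiv M.I N.I f x = _ := (hf.mdiff x).mfderiv
    rw [dmap, h1, M.I.range_eq_univ, fderivWithin_univ]
    rfl
  have hGd : HasFDerivAt G (C : M.E →L[ℝ] N.E × Euc (fibDim M N)) (φ x) := by
    have h1 : HasFDerivAt F (dmap f x) (φ x) := by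
      rw [← hFd]
      exact ((hFs.contDiffAt (hD₀o.mem_nhds hφx)).differentiableAt (by simp)).hasFDerivAt
    rw [hC]
    exact h1.prodMk q.hasFDerivAt
  have hinf : (∞ : WithTop ℕ∞) ≠ 0 := by simp
  let h := (hGat _ hφx).toOpenPartialHomeomorph G hGd hinf
  let D₁ : Set M.E := D₀ ∩ fderiv ℝ G ⁻¹'
    Set.range ((↑) : (M.E ≃L[ℝ] N.E × Euc (fibDim M N)) → M.E →L[ℝ] N.E × Euc (fibDim M N))
  have hD₁o : IsOpen D₁ :=
    (hGs.continuousOn_fderiv_of_isOpen hD₀o (by simp)).isOpen_inter_preimage hD₀o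
      ContinuousLinearEquiv.isOpen
  let R := h.restrOpen D₁ hD₁o
  have hRG : ∀ e, R e = G e := fun e => rfl
  have hRD : ∀ e ∈ R.source, e ∈ D₁ := fun e he => he.2
  have hRx : φ x ∈ R.source :=
    ⟨(hGat _ hφx).mem_toOpenPartialHomeomorph_source hGd hinf, hφx, C, hGd.fderiv.symm⟩
  have hRs : ContDiffOn ℝ ∞ R.symm R.target := by
    intro y hy
    have h1 := hRD _ (R.map_target hy)
    obtain ⟨C', hC'⟩ := h1.2
    refine ContDiffAt.contDiffWithinAt (R.contDiffAt_symm hy (f₀' := C') ?_ ?_)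
    · have h2 := ((hGat _ h1.1).differentiableAt (by simp)).hasFDerivAt
      rw [← hC'] at h2
      exact h2
    · exact hGat _ h1.1
  refine ⟨fun y => q (φ y), fun z => φ.symm (R.symm (ψ z.1, z.2)), φ.source ∩ φ ⁻¹' R.source,
    (Prod.fst ⁻¹' ψ.source) ∩ (fun z : N × Euc (fibDim M N) => (ψ z.1, z.2)) ⁻¹' R.target,
    ?_, ?_, ⟨hxφ, hRx⟩, ?_, ?_, ?_, ?_⟩
  · exact (continuousOn_extChartAt x).isOpen_inter_preimage hφso R.open_source
  · refine ContinuousOn.isOpen_inter_preimage ?_ (hψso.preimage continuous_fst) R.open_target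
    exact ((continuousOn_extChartAt (f x)).comp continuousOn_fst fun z hz => hz).prodMk
      continuousOn_snd
  · have h1 : ContMDiffOn M.I 𝓘(ℝ, M.E) ∞ φ (φ.source ∩ φ ⁻¹' R.source) :=
      (contMDiffOn_extChartAt (x := x)).mono fun y hy => by
        have := hy.1
        rwa [hφ, extChartAt_source] at this
    exact q.contDiff.contMDiff.comp_contMDiffOn h1
  · have h1 : ContMDiffOn (N.I.prod 𝓘(ℝ, Euc (fibDim M N))) 𝓘(ℝ, N.E × Euc (fibDim M N)) ∞
        (fun z : N × Euc (fibDim M N) => (ψ z.1, z.2))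
        ((Prod.fst ⁻¹' ψ.source) ∩
          (fun z : N × Euc (fibDim M N) => (ψ z.1, z.2)) ⁻¹' R.target) := by
      refine ContMDiffOn.prodMk_space ?_ contMDiffOn_snd
      refine (contMDiffOn_extChartAt (x := f x)).comp contMDiffOn_fst fun z hz => ?_
      have := hz.1
      rwa [Set.mem_preimage, hψ, extChartAt_source] at this
    have h2 := (contMDiffOn_iff_contDiffOn.2 hRs).comp h1 fun z hz => hz.2
    exact (contMDiffOn_extChartAt_symm x).comp h2 fun z hz => (hRD _ (R.map_target hz.2)).1.1
  · rintro y ⟨hy, hyR⟩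
    have h1 := (hRD _ hyR).1.2
    have h2 : (ψ (f y), q (φ y)) = R (φ y) := by
      rw [hRG, hG, hF]
      simp only [φ.left_inv hy]
    refine ⟨⟨?_, ?_⟩, ?_⟩
    · change f (φ.symm (φ y)) ∈ ψ.source at h1
      rwa [φ.left_inv hy] at h1
    · change (ψ (f y), q (φ y)) ∈ R.target
      rw [h2]; exact R.map_source hyR
    · change φ.symm (R.symm (ψ (f y), q (φ y))) = y
      rw [h2, R.left_inv hyR, φ.left_inv hy]
  · rintro ⟨z, k⟩ ⟨hz, hzR⟩
    change z ∈ ψ.source at hz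
    change (ψ z, k) ∈ R.target at hzR
    have h0 := R.map_target hzR
    have h1 := (hRD _ h0).1
    have h2 : G (R.symm (ψ z, k)) = (ψ z, k) := R.right_inv hzR
    have h3 : ψ (f (φ.symm (R.symm (ψ z, k)))) = ψ z := congrArg Prod.fst h2
    have h4 : q (R.symm (ψ z, k)) = k := congrArg Prod.snd h2
    refine ⟨⟨φ.map_target h1.1, ?_⟩, ψ.injOn h1.2 hz h3, ?_⟩
    · change φ (φ.symm _) ∈ R.source
      rwa [φ.right_inv h1.1]
    · change q (φ (φ.symm _)) = k
      rw [φ.right_inv h1.1, h4]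

end Mfd

end

section

namespace Mfd

variable {M M' N X : Mfd.{u}}

/-- The underlying set of the fibre product of two maps. -/
def fibSet (f : M → N) (f' : M' → N) : Set (prod M M') := {p | f p.1 = f' p.2}

theorem exists_fibParam {f : M → N} {f' : M' → N} (hf : IsSurjSubmersion f) (hf' : Smooth f')
    (p : fibSet f f') :
    Nonempty (LocalParam (prod M M') (fibSet f f') (M'.E × Euc (fibDim M N)) p.1) := by
  obtain ⟨⟨x, x'⟩, hp⟩ := p
  obtain ⟨π, τ, W, D, hW, hD, hxW, hπ, hτ, h1, h2⟩ := exists_split hf.smooth x (hf.submersive x)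
  set φ := extChartAt M'.I x' with hφ
  have hφso : IsOpen φ.source := isOpen_extChartAt_source x'
  have hφto : IsOpen φ.target := isOpen_extChartAt_target x'
  have hpair : ContMDiffOn 𝓘(ℝ, M'.E × Euc (fibDim M N)) (N.I.prod 𝓘(ℝ, Euc (fibDim M N))) ∞
      (fun k : M'.E × Euc (fibDim M N) => (f' (φ.symm k.1), k.2)) (Prod.fst ⁻¹' φ.target) := by
    refine ContMDiffOn.prodMk ?_ contDiff_snd.contMDiff.contMDiffOn
    refine ContMDiff.comp_contMDiffOn hf' ?_
    exact (contMDiffOn_extChartAt_symm x').comp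
      (contDiff_fst.contMDiff.contMDiffOn (s := Prod.fst ⁻¹' φ.target)) fun k hk => hk
  refine ⟨⟨fun y => (φ y.2, π y.1), fun k => (τ (f' (φ.symm k.1), k.2), φ.symm k.1),
    W ×ˢ φ.source,
    Prod.fst ⁻¹' φ.target ∩ (fun k : M'.E × Euc (fibDim M N) => (f' (φ.symm k.1), k.2)) ⁻¹' D,
    hW.prod hφso, ?_, ⟨hxW, mem_extChartAt_source x'⟩, ?_, ?_, ?_, ?_, ?_, ?_, ?_⟩⟩
  · exact hpair.continuousOn.isOpen_inter_preimage (hφto.preimage continuous_fst) hD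
  · refine ContMDiffOn.prodMk_space ?_ ?_
    · refine (contMDiffOn_extChartAt (x := x')).comp contMDiffOn_snd fun y hy => ?_
      have := hy.2
      rwa [hφ, extChartAt_source] at this
    · exact hπ.comp contMDiffOn_fst fun y hy => hy.1
  · refine ContMDiffOn.prodMk ?_ ?_
    · exact hτ.comp (hpair.mono Set.inter_subset_left) fun k hk => hk.2
    · exact (contMDiffOn_extChartAt_symm x').comp
        (contDiff_fst.contMDiff.contMDiffOn) fun k hk => hk.1
  · rintro k ⟨hk, hkD⟩
    exact (h2 _ hkD).2.1
  · rintro k ⟨hk, hkD⟩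
    exact ⟨(h2 _ hkD).1, φ.map_target hk⟩
  · rintro ⟨y, y'⟩ hy ⟨hyW, hy'⟩
    change f y = f' y' at hy
    refine ⟨φ.map_source hy', ?_⟩
    change (f' (φ.symm (φ y')), π y) ∈ D
    rw [φ.left_inv hy', ← hy]
    exact (h1 y hyW).1
  · rintro ⟨e, k⟩ ⟨hk, hkD⟩
    exact Prod.ext (φ.right_inv hk) (h2 _ hkD).2.2
  · rintro ⟨y, y'⟩ hy ⟨hyW, hy'⟩
    change f y = f' y' at hy
    refine Prod.ext ?_ (φ.left_inv hy')
    change τ (f' (φ.symm (φ y')), π y) = y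
    rw [φ.left_inv hy', ← hy]
    exact (h1 y hyW).2

/-- The fibre product `M ×_N M'` of a surjective submersion `f : M → N` and a smooth map
`f' : M' → N`, with its structure of embedded submanifold of `M × M'`. -/
def fib (f : M → N) (f' : M' → N) (hf : IsSurjSubmersion f) (hf' : Smooth f') : Mfd.{u} :=
  sub (prod M M') (fibSet f f') (M'.E × Euc (fibDim M N)) fun p =>
    Classical.choice (exists_fibParam hf hf' p)

section Fib

variable {f : M → N} {f' : M' → N} {hf : IsSurjSubmersion f} {hf' : Smooth f'}

/-- Points of the fibre product. -/
def fib.mk (x : M) (y : M') (h : f x = f' y) : fib f f' hf hf' := ⟨(x, y), h⟩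

/-- First projection of the fibre product. -/
def fib.fst (p : fib f f' hf hf') : M := p.1.1

/-- Second projection of the fibre product. -/
def fib.snd (p : fib f f' hf hf') : M' := p.1.2

@[simp] theorem fib.fst_mk (x : M) (y : M') (h : f x = f' y) :
    fib.fst (hf := hf) (hf' := hf') (fib.mk x y h) = x := rfl

@[simp] theorem fib.snd_mk (x : M) (y : M') (h : f x = f' y) :
    fib.snd (hf := hf) (hf' := hf') (fib.mk x y h) = y := rfl

theorem fib.cond (p : fib f f' hf hf') : f (fib.fst p) = f' (fib.snd p) := p.2

theorem fib.ext {p q : fib f f' hf hf'} (h1 : fib.fst p = fib.fst q)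
    (h2 : fib.snd p = fib.snd q) : p = q := Subtype.ext (Prod.ext h1 h2)

theorem fib.smooth_fst : Smooth (fib.fst (hf := hf) (hf' := hf')) :=
  Smooth.comp (N := prod M M') Mfd.smooth_fst (smooth_incl _)

theorem fib.smooth_snd : Smooth (fib.snd (hf := hf) (hf' := hf')) :=
  Smooth.comp (N := prod M M') Mfd.smooth_snd (smooth_incl _)

theorem fib.smooth_iff {g : X → fib f f' hf hf'} :
    Smooth g ↔ Smooth (fun x => fib.fst (g x)) ∧ Smooth fun x => fib.snd (g x) :=
  ⟨fun h => ⟨fib.smooth_fst.comp h, fib.smooth_snd.comp h⟩, fun h =>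
    contMDiffAt_sub _ (Smooth.prodMk h.1 h.2)⟩

theorem fib.plot_iff {n : ℕ} {g : Euc n → fib f f' hf hf'} :
    SmoothPlot g ↔ SmoothPlot (fun x => fib.fst (g x)) ∧ SmoothPlot fun x => fib.snd (g x) :=
  ⟨fun h => ⟨fib.smooth_fst.comp_plot h, fib.smooth_snd.comp_plot h⟩, fun h =>
    contMDiffAt_sub _ (SmoothPlot.prodMk h.1 h.2)⟩

theorem fib.tangent_ext (p : fib f f' hf hf') {v w : (fib f f' hf hf').E}
    (h1 : dmap fib.fst p v = dmap fib.fst p w) (h2 : dmap fib.snd p v = dmap fib.snd p w) :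
    v = w := by
  refine dmap_incl_injective _ p ?_
  have h := dmap_prodMk (fib.smooth_fst (hf := hf) (hf' := hf')) fib.smooth_snd p
  refine (h v).trans ((Prod.ext h1 h2).trans (h w).symm)

theorem fib.tangent_cond (p : fib f f' hf hf') (v : (fib f f' hf hf').E) :
    dmap f (fib.fst p) (dmap fib.fst p v) = dmap f' (fib.snd p) (dmap fib.snd p v) := by
  rw [← dmap_comp hf.smooth fib.smooth_fst, ← dmap_comp hf' fib.smooth_snd]
  have : (fun p : fib f f' hf hf' => f (fib.fst p)) = fun p => f' (fib.snd p) :=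
    funext fun p => fib.cond p
  rw [this]

theorem fib.tangent_lift (p : fib f f' hf hf') (v : M.E) (v' : M'.E)
    (h : dmap f (fib.fst p) v = dmap f' (fib.snd p) v') :
    ∃ w, dmap fib.fst p w = v ∧ dmap fib.snd p w = v' := by
  let L : (fib f f' hf hf').E →ₗ[ℝ] M.E × M'.E :=
    (dmap (fib.fst (hf := hf) (hf' := hf')) p).toLinearMap.prod
      (dmap (fib.snd (hf := hf) (hf' := hf')) p).toLinearMap
  let T : M.E × M'.E →ₗ[ℝ] N.E :=
    (dmap f (fib.fst p)).toLinearMap ∘ₗ LinearMap.fst ℝ _ _ -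
      (dmap f' (fib.snd p)).toLinearMap ∘ₗ LinearMap.snd ℝ _ _
  have hT : Function.Surjective T := by
    intro z
    obtain ⟨a, ha⟩ := hf.submersive (fib.fst p) z
    exact ⟨(a, 0), by simp [T, ha]⟩
  have hL : Function.Injective L := by
    intro a b hab
    exact fib.tangent_ext p (congrArg Prod.fst hab) (congrArg Prod.snd hab)
  have hle : LinearMap.range L ≤ LinearMap.ker T := by
    rintro _ ⟨a, rfl⟩
    have := fib.tangent_cond p a
    simp [L, T, this]
  have h1 := LinearMap.finrank_range_add_finrank_ker T
  have h2 := LinearMap.finrank_range_add_finrank_ker L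
  have h3 := LinearMap.finrank_range_add_finrank_ker (dmap f (fib.fst p)).toLinearMap
  rw [LinearMap.range_eq_top.2 hT, finrank_top, Module.finrank_prod] at h1
  rw [LinearMap.ker_eq_bot.2 hL, finrank_bot, add_zero] at h2
  rw [LinearMap.range_eq_top.2 (hf.submersive (fib.fst p)), finrank_top] at h3
  have h4 : Module.finrank ℝ (fib f f' hf hf').E =
      Module.finrank ℝ M'.E + (Module.finrank ℝ M.E - Module.finrank ℝ N.E) := by
    change Module.finrank ℝ (M'.E × Euc (fibDim M N)) = _
    rw [Module.finrank_prod, finrank_euclideanSpace, Fintype.card_fin]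
  have h5 : LinearMap.range L = LinearMap.ker T :=
    Submodule.eq_of_le_of_finrank_eq hle (by omega)
  have h6 : ((v, v') : M.E × M'.E) ∈ LinearMap.range L := by
    rw [h5]
    simp [T, h]
  obtain ⟨w, hw⟩ := h6
  exact ⟨w, congrArg Prod.fst hw, congrArg Prod.snd hw⟩

theorem fib.snd_surjSubmersion : IsSurjSubmersion (fib.snd (hf := hf) (hf' := hf')) := by
  refine ⟨fib.smooth_snd, fun y => ?_, fun p v' => ?_⟩
  · obtain ⟨x, hx⟩ := hf.surjective (f' y)
    exact ⟨fib.mk x y hx, rfl⟩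
  · obtain ⟨v, hv⟩ := hf.submersive (fib.fst p) (dmap f' (fib.snd p) v')
    obtain ⟨w, -, hw⟩ := fib.tangent_lift p v v' hv
    exact ⟨w, hw⟩

end Fib

end Mfd

end

section

/-! ### Lie groupoids and Lie 2-groupoids -/

/-- The structure of a Lie groupoid with manifold of objects `M` and manifold of arrows `A`.
Composition is written from right to left: `mul g f` is defined when `src g = tgt f`. Its smoothness,
as a map on the submanifold of composable pairs, is expressed through smooth families of
composable pairs. -/
structure LieGroupoidStr (A M : Mfd.{u}) where
  /-- source -/
  src : A → M
  /-- target -/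
  tgt : A → M
  /-- units -/
  one : M → A
  /-- composition -/
  mul : ∀ g f : A, src g = tgt f → A
  /-- inversion -/
  inv : A → A
  src_submersion : Mfd.IsSurjSubmersion src
  tgt_submersion : Mfd.IsSurjSubmersion tgt
  one_smooth : Mfd.Smooth one
  inv_smooth : Mfd.Smooth inv
  mul_smooth : ∀ (n : ℕ) (p q : Euc n → A) (_ : Mfd.SmoothPlot p) (_ : Mfd.SmoothPlot q)
    (h : ∀ x, src (p x) = tgt (q x)), Mfd.SmoothPlot fun x => mul (p x) (q x) (h x)
  src_one : ∀ m, src (one m) = m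
  tgt_one : ∀ m, tgt (one m) = m
  src_mul : ∀ g f h, src (mul g f h) = src f
  tgt_mul : ∀ g f h, tgt (mul g f h) = tgt g
  mul_assoc : ∀ k g f (h₁ : src k = tgt g) (h₂ : src g = tgt f),
    mul (mul k g h₁) f ((src_mul k g h₁).trans h₂) =
      mul k (mul g f h₂) (h₁.trans (tgt_mul g f h₂).symm)
  mul_one : ∀ f, mul f (one (src f)) (tgt_one (src f)).symm = f
  one_mul : ∀ f, mul (one (tgt f)) f (src_one (tgt f)) = f
  src_inv : ∀ f, src (inv f) = tgt f
  tgt_inv : ∀ f, tgt (inv f) = src f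
  inv_mul : ∀ f, mul (inv f) f (src_inv f) = one (src f)
  mul_inv : ∀ f, mul f (inv f) (tgt_inv f).symm = one (tgt f)

theorem LieGroupoidStr.mul_congr {A M : Mfd.{u}} (S : LieGroupoidStr A M) {g g' f f' : A}
    (hg : g = g') (hf : f = f') (h : S.src g = S.tgt f) (h' : S.src g' = S.tgt f') :
    S.mul g f h = S.mul g' f' h' := by
  subst hg hf; rfl

/-- Functors (not necessarily smooth) of groupoids. -/
structure IsFunctor {A M A' M' : Mfd.{u}} (S : LieGroupoidStr A M) (S' : LieGroupoidStr A' M')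
    (f₁ : A → A') (f₀ : M → M') : Prop where
  map_src : ∀ a, S'.src (f₁ a) = f₀ (S.src a)
  map_tgt : ∀ a, S'.tgt (f₁ a) = f₀ (S.tgt a)
  map_one : ∀ m, f₁ (S.one m) = S'.one (f₀ m)
  map_mul : ∀ g f (h : S.src g = S.tgt f) (h' : S'.src (f₁ g) = S'.tgt (f₁ f)),
    f₁ (S.mul g f h) = S'.mul (f₁ g) (f₁ f) h'

/-- Lie 2-groupoids `Γ₂ ⇉ Γ₁ ⇉ Γ₀`: double Lie groupoids whose right column is the trivial groupoid
on the manifold `Γ₀`. The structure `h₁` is the groupoid `Γ₁ ⇉ Γ₀`, the structure `v` is the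
vertical groupoid `Γ₂ ⇉ Γ₁` (source `l` and target `u`), and the structure `h₂` is the horizontal
groupoid `Γ₂ ⇉ Γ₀`. -/
structure Lie2Groupoid : Type (u + 1) where
  /-- objects -/
  G₀ : Mfd.{u}
  /-- arrows -/
  G₁ : Mfd.{u}
  /-- 2-arrows -/
  G₂ : Mfd.{u}
  /-- composition of arrows -/
  h₁ : LieGroupoidStr G₁ G₀
  /-- vertical composition of 2-arrows -/
  v : LieGroupoidStr G₂ G₁
  /-- horizontal composition of 2-arrows -/
  h₂ : LieGroupoidStr G₂ G₀
  src_l : ∀ x, h₁.src (v.src x) = h₂.src x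
  src_u : ∀ x, h₁.src (v.tgt x) = h₂.src x
  tgt_l : ∀ x, h₁.tgt (v.src x) = h₂.tgt x
  tgt_u : ∀ x, h₁.tgt (v.tgt x) = h₂.tgt x
  l_one : ∀ m, v.src (h₂.one m) = h₁.one m
  u_one : ∀ m, v.tgt (h₂.one m) = h₁.one m
  l_mul : ∀ y x (h : h₂.src y = h₂.tgt x) (h' : h₁.src (v.src y) = h₁.tgt (v.src x)),
    v.src (h₂.mul y x h) = h₁.mul (v.src y) (v.src x) h'
  u_mul : ∀ y x (h : h₂.src y = h₂.tgt x) (h' : h₁.src (v.tgt y) = h₁.tgt (v.tgt x)),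
    v.tgt (h₂.mul y x h) = h₁.mul (v.tgt y) (v.tgt x) h'
  one_one : ∀ m, v.one (h₁.one m) = h₂.one m
  one_mul : ∀ g f (h : h₁.src g = h₁.tgt f) (h' : h₂.src (v.one g) = h₂.tgt (v.one f)),
    v.one (h₁.mul g f h) = h₂.mul (v.one g) (v.one f) h'
  interchange : ∀ y' y x' x (hy : v.src y' = v.tgt y) (hx : v.src x' = v.tgt x)
    (h : h₂.src (v.mul y' y hy) = h₂.tgt (v.mul x' x hx))
    (h' : h₂.src y' = h₂.tgt x') (h'' : h₂.src y = h₂.tgt x)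
    (k : v.src (h₂.mul y' x' h') = v.tgt (h₂.mul y x h'')),
    h₂.mul (v.mul y' y hy) (v.mul x' x hx) h = v.mul (h₂.mul y' x' h') (h₂.mul y x h'') k

/-- (Strict) morphisms of Lie 2-groupoids: triples of smooth maps commuting with all structure
maps. -/
structure Hom (Γ Δ : Lie2Groupoid.{u}) where
  /-- the map on objects -/
  f₀ : Γ.G₀ → Δ.G₀
  /-- the map on arrows -/
  f₁ : Γ.G₁ → Δ.G₁
  /-- the map on 2-arrows -/
  f₂ : Γ.G₂ → Δ.G₂
  smooth₀ : Mfd.Smooth f₀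
  smooth₁ : Mfd.Smooth f₁
  smooth₂ : Mfd.Smooth f₂
  functor_h₁ : IsFunctor Γ.h₁ Δ.h₁ f₁ f₀
  functor_v : IsFunctor Γ.v Δ.v f₂ f₁
  functor_h₂ : IsFunctor Γ.h₂ Δ.h₂ f₂ f₀

theorem IsFunctor.comp {A M A' M' A'' M'' : Mfd.{u}} {S : LieGroupoidStr A M}
    {S' : LieGroupoidStr A' M'} {S'' : LieGroupoidStr A'' M''} {g₁ : A' → A''} {g₀ : M' → M''}
    {f₁ : A → A'} {f₀ : M → M'} (hg : IsFunctor S' S'' g₁ g₀) (hf : IsFunctor S S' f₁ f₀) :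
    IsFunctor S S'' (fun x => g₁ (f₁ x)) (fun x => g₀ (f₀ x)) where
  map_src a := by rw [hg.map_src, hf.map_src]
  map_tgt a := by rw [hg.map_tgt, hf.map_tgt]
  map_one m := by rw [hf.map_one, hg.map_one]
  map_mul g f h h' := by
    have h1 : S'.src (f₁ g) = S'.tgt (f₁ f) := by rw [hf.map_src, hf.map_tgt, h]
    rw [hf.map_mul g f h h1, hg.map_mul _ _ h1 h']

/-- Composition of morphisms. -/
def Hom.comp {Γ Δ Λ : Lie2Groupoid.{u}} (g : Hom Δ Λ) (f : Hom Γ Δ) : Hom Γ Λ where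
  f₀ x := g.f₀ (f.f₀ x)
  f₁ x := g.f₁ (f.f₁ x)
  f₂ x := g.f₂ (f.f₂ x)
  smooth₀ := g.smooth₀.comp f.smooth₀
  smooth₁ := g.smooth₁.comp f.smooth₁
  smooth₂ := g.smooth₂.comp f.smooth₂
  functor_h₁ := g.functor_h₁.comp f.functor_h₁
  functor_v := g.functor_v.comp f.functor_v
  functor_h₂ := g.functor_h₂.comp f.functor_h₂

/-! ### Morita morphisms -/

/-- The manifold `A[M] = {(m, a, n) | s(a) = f(m), t(a) = f(n)}`, written as pairs `((m, n), a)`, for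
smooth maps `s, t : A → N` and a surjective submersion `f : M → N`. -/
abbrev pb {A M N : Mfd.{u}} (s t : A → N) (hs : Mfd.Smooth s) (ht : Mfd.Smooth t) (f : M → N)
    (hf : Mfd.IsSurjSubmersion f) : Mfd.{u} :=
  Mfd.fib (Mfd.pmap f f) (fun a => ((s a, t a) : Mfd.prod N N)) (hf.pmap hf) (hs.prodMk ht)

namespace Hom

variable {Γ Δ : Lie2Groupoid.{u}} (φ : Hom Γ Δ) (hφ : Mfd.IsSurjSubmersion φ.f₀)

/-- The manifold `Δ₁[Γ₀]` of arrows of the pullback of `Δ` along `φ₀`. -/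
abbrev pb₁ : Mfd.{u} :=
  pb Δ.h₁.src Δ.h₁.tgt Δ.h₁.src_submersion.smooth Δ.h₁.tgt_submersion.smooth φ.f₀ hφ

/-- The manifold `Δ₂[Γ₀]` of 2-arrows of the pullback of `Δ` along `φ₀`. -/
abbrev pb₂ : Mfd.{u} :=
  pb Δ.h₂.src Δ.h₂.tgt Δ.h₂.src_submersion.smooth Δ.h₂.tgt_submersion.smooth φ.f₀ hφ

/-- The map `Γ₁ → Δ₁[Γ₀]`. -/
def toPb₁ (γ : Γ.G₁) : φ.pb₁ hφ :=
  Mfd.fib.mk ((Γ.h₁.src γ, Γ.h₁.tgt γ) : Mfd.prod Γ.G₀ Γ.G₀) (φ.f₁ γ)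
    (Prod.ext (φ.functor_h₁.map_src γ).symm (φ.functor_h₁.map_tgt γ).symm)

/-- The map `Γ₂ → Δ₂[Γ₀]`. -/
def toPb₂ (x : Γ.G₂) : φ.pb₂ hφ :=
  Mfd.fib.mk ((Γ.h₂.src x, Γ.h₂.tgt x) : Mfd.prod Γ.G₀ Γ.G₀) (φ.f₂ x)
    (Prod.ext (φ.functor_h₂.map_src x).symm (φ.functor_h₂.map_tgt x).symm)

/-- The source map `l : Δ₂[Γ₀] → Δ₁[Γ₀]`, `(m, x, n) ↦ (m, l(x), n)`. -/
def pbL (x : φ.pb₂ hφ) : φ.pb₁ hφ :=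
  Mfd.fib.mk (Mfd.fib.fst x) (Δ.v.src (Mfd.fib.snd x))
    ((Mfd.fib.cond x).trans (Prod.ext (Δ.src_l _).symm (Δ.tgt_l _).symm))

/-- The target map `u : Δ₂[Γ₀] → Δ₁[Γ₀]`, `(m, x, n) ↦ (m, u(x), n)`. -/
def pbU (x : φ.pb₂ hφ) : φ.pb₁ hφ :=
  Mfd.fib.mk (Mfd.fib.fst x) (Δ.v.tgt (Mfd.fib.snd x))
    ((Mfd.fib.cond x).trans (Prod.ext (Δ.src_u _).symm (Δ.tgt_u _).symm))

theorem smooth_pbL : Mfd.Smooth (φ.pbL hφ) :=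
  Mfd.fib.smooth_iff.2 ⟨Mfd.fib.smooth_fst, Δ.v.src_submersion.smooth.comp Mfd.fib.smooth_snd⟩

theorem smooth_pbU : Mfd.Smooth (φ.pbU hφ) :=
  Mfd.fib.smooth_iff.2 ⟨Mfd.fib.smooth_fst, Δ.v.tgt_submersion.smooth.comp Mfd.fib.smooth_snd⟩

theorem smooth_toPb₁ : Mfd.Smooth (φ.toPb₁ hφ) :=
  Mfd.fib.smooth_iff.2
    ⟨Γ.h₁.src_submersion.smooth.prodMk Γ.h₁.tgt_submersion.smooth, φ.smooth₁⟩

theorem smooth_toPb₂ : Mfd.Smooth (φ.toPb₂ hφ) :=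
  Mfd.fib.smooth_iff.2
    ⟨Γ.h₂.src_submersion.smooth.prodMk Γ.h₂.tgt_submersion.smooth, φ.smooth₂⟩

variable (hφ₁ : Mfd.IsSurjSubmersion (φ.toPb₁ hφ))

/-- The manifold `Δ₂[Γ₀][Γ₁]` of arrows of the pullback of the groupoid `Δ₂[Γ₀] ⇉ Δ₁[Γ₀]` along
`Γ₁ → Δ₁[Γ₀]`. -/
abbrev pb₂₁ : Mfd.{u} :=
  pb (φ.pbL hφ) (φ.pbU hφ) (φ.smooth_pbL hφ) (φ.smooth_pbU hφ) (φ.toPb₁ hφ) hφ₁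

/-- The map `Γ₂ → Δ₂[Γ₀][Γ₁]`. -/
def toPb₂₁ (x : Γ.G₂) : φ.pb₂₁ hφ hφ₁ :=
  Mfd.fib.mk ((Γ.v.src x, Γ.v.tgt x) : Mfd.prod Γ.G₁ Γ.G₁) (φ.toPb₂ hφ x)
    (Prod.ext
      (Mfd.fib.ext (Prod.ext (Γ.src_l x) (Γ.tgt_l x)) (φ.functor_v.map_src x).symm)
      (Mfd.fib.ext (Prod.ext (Γ.src_u x) (Γ.tgt_u x)) (φ.functor_v.map_tgt x).symm))

/-- Morita morphisms of Lie 2-groupoids: `Γ₀ → Δ₀` and `Γ₁ → Δ₁[Γ₀]` are surjective submersions, and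
`(Γ₂ ⇉ Γ₁) → (Δ₂[Γ₀] ⇉ Δ₁[Γ₀])` is a Morita morphism of groupoids, that is, the induced map
`Γ₂ → Δ₂[Γ₀][Γ₁]` is moreover a diffeomorphism. -/
structure IsMorita : Prop where
  sub₀ : Mfd.IsSurjSubmersion φ.f₀
  sub₁ : Mfd.IsSurjSubmersion (φ.toPb₁ sub₀)
  diffeo₂ : ∃ g : φ.pb₂₁ sub₀ sub₁ → Γ.G₂, Mfd.Smooth g ∧
    (∀ x, g (φ.toPb₂₁ sub₀ sub₁ x) = x) ∧ ∀ y, φ.toPb₂₁ sub₀ sub₁ (g y) = y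

end Hom

/-! ### Generalized morphisms -/

/-- Generalized morphisms: zigzags of morphisms of Lie 2-groupoids in which the arrows pointing
backwards are Morita morphisms. -/
inductive GenMor : Lie2Groupoid.{u} → Lie2Groupoid.{u} → Type (u + 1)
  | refl (Γ : Lie2Groupoid.{u}) : GenMor Γ Γ
  | fwd {Γ E Δ : Lie2Groupoid.{u}} (f : Hom Γ E) (F : GenMor E Δ) : GenMor Γ Δ
  | bwd {Γ E Δ : Lie2Groupoid.{u}} (φ : Hom E Γ) (hφ : φ.IsMorita) (F : GenMor E Δ) : GenMor Γ Δ

/-- The composition `G ∘ F` of generalized morphisms: concatenation of zigzags. -/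
def GenMor.comp {Δ Λ : Lie2Groupoid.{u}} (G : GenMor Δ Λ) :
    ∀ {Γ : Lie2Groupoid.{u}}, GenMor Γ Δ → GenMor Γ Λ
  | _, .refl _ => G
  | _, .fwd f F => .fwd f (GenMor.comp G F)
  | _, .bwd φ hφ F => .bwd φ hφ (GenMor.comp G F)

/-- The generalized morphism `Γ ← E → Δ` given by a Morita morphism `φ : E → Γ` and a morphism
`f : E → Δ`. -/
def GenMor.span {Γ E Δ : Lie2Groupoid.{u}} (φ : Hom E Γ) (hφ : φ.IsMorita) (f : Hom E Δ) :
    GenMor Γ Δ := .bwd φ hφ (.fwd f (.refl Δ))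

end

section

/-! ### Fibre products of Lie 2-groupoids -/

theorem LieGroupoidStr.inv_inv {A M : Mfd.{u}} (S : LieGroupoidStr A M) (f : A) :
    S.inv (S.inv f) = f := by
  have h1 := S.mul_assoc (S.inv (S.inv f)) (S.inv f) f (S.src_inv _) (S.src_inv _)
  have h2 := S.mul_one (S.inv (S.inv f))
  have h3 := S.one_mul f
  have e : S.src (S.inv (S.inv f)) = S.src f := by rw [S.src_inv, S.tgt_inv]
  rw [S.mul_congr rfl (S.inv_mul f) _ (by rw [S.tgt_one, e]),
    S.mul_congr rfl (congrArg S.one e.symm) _ (S.tgt_one _).symm, h2] at h1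
  rw [← h1]
  refine Eq.trans (S.mul_congr ?_ rfl _ _) h3
  rw [S.inv_mul, S.src_inv]

section FibGroupoid

variable {A M A' M' A'' M'' : Mfd.{u}} {S : LieGroupoidStr A M} {S' : LieGroupoidStr A' M'}
  {S'' : LieGroupoidStr A'' M''} {φA : A → A''} {φM : M → M''} {φA' : A' → A''} {φM' : M' → M''}

/-- Tangent vectors can be lifted along `φA` with prescribed source. -/
def Lifts (S : LieGroupoidStr A M) (S'' : LieGroupoidStr A'' M'') (φA : A → A'') (φM : M → M'') :
    Prop :=
  ∀ (a : A) (v : M.E) (η : A''.E), Mfd.dmap S''.src (φA a) η = Mfd.dmap φM (S.src a) v →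
    ∃ ξ, Mfd.dmap S.src a ξ = v ∧ Mfd.dmap φA a ξ = η

variable (hF : IsFunctor S S'' φA φM) (hF' : IsFunctor S' S'' φA' φM')
  (hA : Mfd.IsSurjSubmersion φA) (hM : Mfd.IsSurjSubmersion φM)
  (hA' : Mfd.Smooth φA') (hM' : Mfd.Smooth φM')

theorem IsFunctor.map_inv (hF : IsFunctor S S'' φA φM) (a : A) : φA (S.inv a) = S''.inv (φA a) := by
  have e1 : S''.src (φA (S.inv a)) = S''.tgt (φA a) := by
    rw [hF.map_src, hF.map_tgt, S.src_inv]
  have h1 : S''.mul (φA (S.inv a)) (φA a) e1 = S''.one (S''.src (φA a)) := by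
    rw [← hF.map_mul _ _ (S.src_inv a), S.inv_mul, hF.map_one, hF.map_src]
  have h2 := S''.mul_assoc (φA (S.inv a)) (φA a) (S''.inv (φA a)) e1 (S''.tgt_inv _).symm
  have h3 := S''.mul_one (φA (S.inv a))
  have h4 := S''.one_mul (S''.inv (φA a))
  rw [S''.mul_congr rfl (S''.mul_inv (φA a)) _ (by rw [S''.tgt_one, e1])] at h2
  rw [S''.mul_congr rfl (congrArg S''.one e1) _ (by rw [S''.tgt_one, e1])] at h3
  rw [h3] at h2
  rw [← h2]
  refine Eq.trans (S''.mul_congr ?_ rfl _ _) h4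
  rw [h1, S''.tgt_inv]

/-- The fibre product of two Lie groupoids. -/
def LieGroupoidStr.fib (hl : Lifts S S'' φA φM) :
    LieGroupoidStr (Mfd.fib φA φA' hA hA') (Mfd.fib φM φM' hM hM') :=
  have hsrc : ∀ p : Mfd.fib φA φA' hA hA', φM (S.src (Mfd.fib.fst p)) = φM' (S'.src (Mfd.fib.snd p)) :=
    fun p => by rw [← hF.map_src, ← hF'.map_src, Mfd.fib.cond p]
  have htgt : ∀ p : Mfd.fib φA φA' hA hA', φM (S.tgt (Mfd.fib.fst p)) = φM' (S'.tgt (Mfd.fib.snd p)) :=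
    fun p => by rw [← hF.map_tgt, ← hF'.map_tgt, Mfd.fib.cond p]
  have hinv : ∀ p : Mfd.fib φA φA' hA hA', φA (S.inv (Mfd.fib.fst p)) = φA' (S'.inv (Mfd.fib.snd p)) :=
    fun p => by rw [hF.map_inv, hF'.map_inv, Mfd.fib.cond p]
  have hone : ∀ p : Mfd.fib φM φM' hM hM', φA (S.one (Mfd.fib.fst p)) = φA' (S'.one (Mfd.fib.snd p)) :=
    fun p => by rw [hF.map_one, hF'.map_one, Mfd.fib.cond p]
  have hsub : Mfd.IsSurjSubmersion (fun p : Mfd.fib φA φA' hA hA' =>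
      (Mfd.fib.mk (S.src (Mfd.fib.fst p)) (S'.src (Mfd.fib.snd p)) (hsrc p) :
        Mfd.fib φM φM' hM hM')) := by
    have hsm : Mfd.Smooth (fun p : Mfd.fib φA φA' hA hA' =>
      (Mfd.fib.mk (S.src (Mfd.fib.fst p)) (S'.src (Mfd.fib.snd p)) (hsrc p) :
        Mfd.fib φM φM' hM hM')) := Mfd.fib.smooth_iff.2
        ⟨S.src_submersion.smooth.comp Mfd.fib.smooth_fst,
          S'.src_submersion.smooth.comp Mfd.fib.smooth_snd⟩
    refine ⟨hsm, fun m => ⟨Mfd.fib.mk (S.one (Mfd.fib.fst m)) (S'.one (Mfd.fib.snd m)) (hone m),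
      Mfd.fib.ext (S.src_one _) (S'.src_one _)⟩, fun p v => ?_⟩
    set q : Mfd.fib φM φM' hM hM' :=
      Mfd.fib.mk (S.src (Mfd.fib.fst p)) (S'.src (Mfd.fib.snd p)) (hsrc p) with hq
    obtain ⟨ξ', hξ'⟩ := S'.src_submersion.submersive (Mfd.fib.snd p) (Mfd.dmap Mfd.fib.snd q v)
    have hc := Mfd.fib.tangent_cond q v
    have e1 : Mfd.dmap S''.src (φA (Mfd.fib.fst p)) (Mfd.dmap φA' (Mfd.fib.snd p) ξ') =
        Mfd.dmap φM (S.src (Mfd.fib.fst p)) (Mfd.dmap Mfd.fib.fst q v) := by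
      rw [Mfd.fib.cond p, ← Mfd.dmap_comp S''.src_submersion.smooth hA']
      have : (fun x => S''.src (φA' x)) = fun x => φM' (S'.src x) := funext hF'.map_src
      rw [this, Mfd.dmap_comp hM' S'.src_submersion.smooth, hξ']
      exact hc.symm
    obtain ⟨ξ, h1, h2⟩ := hl _ _ _ e1
    obtain ⟨w, hw, hw'⟩ := Mfd.fib.tangent_lift p ξ ξ' h2
    refine ⟨w, Mfd.fib.tangent_ext q ?_ ?_⟩
    · rw [← Mfd.dmap_comp Mfd.fib.smooth_fst hsm]
      simp only [Mfd.fib.fst_mk]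
      rw [Mfd.dmap_comp S.src_submersion.smooth Mfd.fib.smooth_fst, hw, h1]
    · rw [← Mfd.dmap_comp Mfd.fib.smooth_snd hsm]
      simp only [Mfd.fib.snd_mk]
      rw [Mfd.dmap_comp S'.src_submersion.smooth Mfd.fib.smooth_snd, hw', hξ']
  have hinvsm : Mfd.Smooth (fun p : Mfd.fib φA φA' hA hA' =>
      (Mfd.fib.mk (S.inv (Mfd.fib.fst p)) (S'.inv (Mfd.fib.snd p)) (hinv p) :
        Mfd.fib φA φA' hA hA')) := Mfd.fib.smooth_iff.2
        ⟨S.inv_smooth.comp Mfd.fib.smooth_fst, S'.inv_smooth.comp Mfd.fib.smooth_snd⟩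
  { src p := Mfd.fib.mk (S.src (Mfd.fib.fst p)) (S'.src (Mfd.fib.snd p)) (hsrc p)
    tgt p := Mfd.fib.mk (S.tgt (Mfd.fib.fst p)) (S'.tgt (Mfd.fib.snd p)) (htgt p)
    one m := Mfd.fib.mk (S.one (Mfd.fib.fst m)) (S'.one (Mfd.fib.snd m)) (hone m)
    mul g f h := Mfd.fib.mk
      (S.mul (Mfd.fib.fst g) (Mfd.fib.fst f) (congrArg Mfd.fib.fst h))
      (S'.mul (Mfd.fib.snd g) (Mfd.fib.snd f) (congrArg Mfd.fib.snd h)) (by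
        have h1 : S.src (Mfd.fib.fst g) = S.tgt (Mfd.fib.fst f) := congrArg Mfd.fib.fst h
        have h2 : S'.src (Mfd.fib.snd g) = S'.tgt (Mfd.fib.snd f) := congrArg Mfd.fib.snd h
        rw [hF.map_mul _ _ h1 (by rw [hF.map_src, hF.map_tgt, h1]),
          hF'.map_mul _ _ h2 (by rw [hF'.map_src, hF'.map_tgt, h2])]
        exact S''.mul_congr (Mfd.fib.cond g) (Mfd.fib.cond f) _ _)
    inv p := Mfd.fib.mk (S.inv (Mfd.fib.fst p)) (S'.inv (Mfd.fib.snd p)) (hinv p)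
    src_submersion := hsub
    tgt_submersion := by
      have h := hsub.comp (f := fun p => (Mfd.fib.mk (S.inv (Mfd.fib.fst p))
        (S'.inv (Mfd.fib.snd p)) (hinv p) : Mfd.fib φA φA' hA hA')) (by
          have hii : ∀ p : Mfd.fib φA φA' hA hA',
            (Mfd.fib.mk (S.inv (S.inv (Mfd.fib.fst p))) (S'.inv (S'.inv (Mfd.fib.snd p)))
              (hinv (Mfd.fib.mk _ _ (hinv p))) : Mfd.fib φA φA' hA hA') = p := fun p =>
              Mfd.fib.ext (S.inv_inv _) (S'.inv_inv _)
          exact .of_sections hinvsm (fun p =>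
            ⟨Mfd.fib.mk (S.inv (Mfd.fib.fst p)) (S'.inv (Mfd.fib.snd p)) (hinv p), hii p⟩) fun p => ⟨_, hinvsm, hii p, hii⟩)
      simpa only [Mfd.fib.fst_mk, Mfd.fib.snd_mk, S.src_inv, S'.src_inv] using h
    one_smooth := Mfd.fib.smooth_iff.2
        ⟨S.one_smooth.comp Mfd.fib.smooth_fst, S'.one_smooth.comp Mfd.fib.smooth_snd⟩
    inv_smooth := hinvsm
    mul_smooth n p q hp hq h := Mfd.fib.plot_iff.2
      ⟨S.mul_smooth n _ _ (Mfd.fib.smooth_fst.comp_plot hp) (Mfd.fib.smooth_fst.comp_plot hq)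
        fun x => congrArg Mfd.fib.fst (h x),
       S'.mul_smooth n _ _ (Mfd.fib.smooth_snd.comp_plot hp) (Mfd.fib.smooth_snd.comp_plot hq)
        fun x => congrArg Mfd.fib.snd (h x)⟩
    src_one m := Mfd.fib.ext (S.src_one _) (S'.src_one _)
    tgt_one m := Mfd.fib.ext (S.tgt_one _) (S'.tgt_one _)
    src_mul g f h := Mfd.fib.ext (S.src_mul _ _ _) (S'.src_mul _ _ _)
    tgt_mul g f h := Mfd.fib.ext (S.tgt_mul _ _ _) (S'.tgt_mul _ _ _)
    mul_assoc k g f h h' := Mfd.fib.ext (S.mul_assoc _ _ _ _ _) (S'.mul_assoc _ _ _ _ _)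
    mul_one f := Mfd.fib.ext (S.mul_one _) (S'.mul_one _)
    one_mul f := Mfd.fib.ext (S.one_mul _) (S'.one_mul _)
    src_inv f := Mfd.fib.ext (S.src_inv _) (S'.src_inv _)
    tgt_inv f := Mfd.fib.ext (S.tgt_inv _) (S'.tgt_inv _)
    inv_mul f := Mfd.fib.ext (S.inv_mul _) (S'.inv_mul _)
    mul_inv f := Mfd.fib.ext (S.mul_inv _) (S'.mul_inv _) }

end FibGroupoid

end

section

namespace Hom

variable {Γ Δ : Lie2Groupoid.{u}} {φ : Hom Γ Δ}

namespace IsMorita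

theorem surj₁ (hφ : φ.IsMorita) (x y : Γ.G₀) (g : Δ.G₁) (hs : φ.f₀ x = Δ.h₁.src g)
    (ht : φ.f₀ y = Δ.h₁.tgt g) : ∃ e, Γ.h₁.src e = x ∧ Γ.h₁.tgt e = y ∧ φ.f₁ e = g := by
  obtain ⟨e, he⟩ := hφ.sub₁.surjective
    (Mfd.fib.mk ((x, y) : Mfd.prod Γ.G₀ Γ.G₀) g (Prod.ext hs ht))
  have h1 := congrArg Mfd.fib.fst he
  exact ⟨e, congrArg Prod.fst h1, congrArg Prod.snd h1, congrArg Mfd.fib.snd he⟩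

theorem lift₁ (hφ : φ.IsMorita) (e : Γ.G₁) (v w : Γ.G₀.E) (η : Δ.G₁.E)
    (hs : Mfd.dmap φ.f₀ (Γ.h₁.src e) v = Mfd.dmap Δ.h₁.src (φ.f₁ e) η)
    (ht : Mfd.dmap φ.f₀ (Γ.h₁.tgt e) w = Mfd.dmap Δ.h₁.tgt (φ.f₁ e) η) :
    ∃ ξ, Mfd.dmap Γ.h₁.src e ξ = v ∧ Mfd.dmap Γ.h₁.tgt e ξ = w ∧ Mfd.dmap φ.f₁ e ξ = η := by
  obtain ⟨z, hz, hz'⟩ := Mfd.fib.tangent_lift (φ.toPb₁ hφ.sub₀ e) (v, w) η (by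
    rw [Mfd.dmap_pmap hφ.sub₀.smooth hφ.sub₀.smooth,
      Mfd.dmap_prodMk Δ.h₁.src_submersion.smooth Δ.h₁.tgt_submersion.smooth]
    exact Prod.ext hs ht)
  obtain ⟨ξ, hξ⟩ := hφ.sub₁.submersive e z
  have hsm := φ.smooth_toPb₁ hφ.sub₀
  rw [← hξ, ← Mfd.dmap_comp Mfd.fib.smooth_fst hsm] at hz
  rw [← hξ, ← Mfd.dmap_comp Mfd.fib.smooth_snd hsm] at hz'
  have h2 := (Mfd.dmap_prodMk Γ.h₁.src_submersion.smooth Γ.h₁.tgt_submersion.smooth e ξ).symm.trans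
    hz
  exact ⟨ξ, congrArg Prod.fst h2, congrArg Prod.snd h2, hz'⟩

theorem ext₂ (hφ : φ.IsMorita) {x y : Γ.G₂} (hl : Γ.v.src x = Γ.v.src y)
    (hu : Γ.v.tgt x = Γ.v.tgt y) (h : φ.f₂ x = φ.f₂ y) : x = y := by
  obtain ⟨g, -, hg, -⟩ := hφ.diffeo₂
  rw [← hg x, ← hg y]
  congr 1
  refine Mfd.fib.ext (Prod.ext hl hu) (Mfd.fib.ext (Prod.ext ?_ ?_) h)
  · exact (Γ.src_l x).symm.trans ((congrArg _ hl).trans (Γ.src_l y))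
  · exact (Γ.tgt_l x).symm.trans ((congrArg _ hl).trans (Γ.tgt_l y))

theorem fill₂ (hφ : φ.IsMorita) {X : Mfd.{u}} {a b : X → Γ.G₁} {c : X → Δ.G₂} (ha : Mfd.Smooth a)
    (hb : Mfd.Smooth b) (hc : Mfd.Smooth c) (hs : ∀ x, Γ.h₁.src (a x) = Γ.h₁.src (b x))
    (ht : ∀ x, Γ.h₁.tgt (a x) = Γ.h₁.tgt (b x)) (hl : ∀ x, φ.f₁ (a x) = Δ.v.src (c x))
    (hu : ∀ x, φ.f₁ (b x) = Δ.v.tgt (c x)) :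
    ∃ d : X → Γ.G₂, Mfd.Smooth d ∧ (∀ x, Γ.v.src (d x) = a x) ∧ (∀ x, Γ.v.tgt (d x) = b x) ∧
      ∀ x, φ.f₂ (d x) = c x := by
  obtain ⟨g, hg, -, hg'⟩ := hφ.diffeo₂
  have h0 : ∀ x, Mfd.pmap φ.f₀ φ.f₀
      ((Γ.h₁.src (a x), Γ.h₁.tgt (a x)) : Mfd.prod Γ.G₀ Γ.G₀) =
      (Δ.h₂.src (c x), Δ.h₂.tgt (c x)) := fun x => Prod.ext
        (by
          change φ.f₀ (Γ.h₁.src (a x)) = _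
          rw [← φ.functor_h₁.map_src, hl, Δ.src_l])
        (by
          change φ.f₀ (Γ.h₁.tgt (a x)) = _
          rw [← φ.functor_h₁.map_tgt, hl, Δ.tgt_l])
  let p : X → φ.pb₂ hφ.sub₀ := fun x => Mfd.fib.mk _ (c x) (h0 x)
  have hp : Mfd.Smooth p := Mfd.fib.smooth_iff.2
    ⟨(Γ.h₁.src_submersion.smooth.comp ha).prodMk (Γ.h₁.tgt_submersion.smooth.comp ha), hc⟩
  let q : X → φ.pb₂₁ hφ.sub₀ hφ.sub₁ := fun x =>
    Mfd.fib.mk ((a x, b x) : Mfd.prod Γ.G₁ Γ.G₁) (p x)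
      (Prod.ext (Mfd.fib.ext rfl (hl x)) (Mfd.fib.ext (Prod.ext (hs x).symm (ht x).symm) (hu x)))
  have hq : Mfd.Smooth q := Mfd.fib.smooth_iff.2 ⟨ha.prodMk hb, hp⟩
  refine ⟨fun x => g (q x), hg.comp hq, fun x => ?_, fun x => ?_, fun x => ?_⟩
  · exact congrArg (fun y : φ.pb₂₁ hφ.sub₀ hφ.sub₁ => (Mfd.fib.fst y).1) (hg' (q x))
  · exact congrArg (fun y : φ.pb₂₁ hφ.sub₀ hφ.sub₁ => (Mfd.fib.fst y).2) (hg' (q x))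
  · exact congrArg (fun y : φ.pb₂₁ hφ.sub₀ hφ.sub₁ => Mfd.fib.snd (Mfd.fib.snd y)) (hg' (q x))

theorem lift₂ (hφ : φ.IsMorita) (x : Γ.G₂) (a b : Γ.G₁.E) (η : Δ.G₂.E)
    (hs : Mfd.dmap Γ.h₁.src (Γ.v.src x) a = Mfd.dmap Γ.h₁.src (Γ.v.tgt x) b)
    (ht : Mfd.dmap Γ.h₁.tgt (Γ.v.src x) a = Mfd.dmap Γ.h₁.tgt (Γ.v.tgt x) b)
    (hl : Mfd.dmap φ.f₁ (Γ.v.src x) a = Mfd.dmap Δ.v.src (φ.f₂ x) η)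
    (hu : Mfd.dmap φ.f₁ (Γ.v.tgt x) b = Mfd.dmap Δ.v.tgt (φ.f₂ x) η) :
    ∃ ξ, Mfd.dmap Γ.v.src x ξ = a ∧ Mfd.dmap Γ.v.tgt x ξ = b ∧ Mfd.dmap φ.f₂ x ξ = η := by
  obtain ⟨g, hg, hg1, hg2⟩ := hφ.diffeo₂
  have hs₂ : Δ.h₂.src = fun x => Δ.h₁.src (Δ.v.src x) := funext fun x => (Δ.src_l x).symm
  have ht₂ : Δ.h₂.tgt = fun x => Δ.h₁.tgt (Δ.v.src x) := funext fun x => (Δ.tgt_l x).symm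
  obtain ⟨z, hz, hz'⟩ := Mfd.fib.tangent_lift (φ.toPb₂ hφ.sub₀ x)
    (Mfd.dmap Γ.h₁.src (Γ.v.src x) a, Mfd.dmap Γ.h₁.tgt (Γ.v.src x) a) η (by
      rw [Mfd.dmap_pmap hφ.sub₀.smooth hφ.sub₀.smooth,
        Mfd.dmap_prodMk Δ.h₂.src_submersion.smooth Δ.h₂.tgt_submersion.smooth]
      refine Prod.ext ?_ ?_
      · change Mfd.dmap φ.f₀ (Γ.h₂.src x) _ = Mfd.dmap Δ.h₂.src (φ.f₂ x) η
        rw [hs₂, Mfd.dmap_comp Δ.h₁.src_submersion.smooth Δ.v.src_submersion.smooth, ← hl,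
          φ.functor_v.map_src, ← Mfd.dmap_comp Δ.h₁.src_submersion.smooth φ.smooth₁, ← Γ.src_l,
          ← Mfd.dmap_comp φ.smooth₀ Γ.h₁.src_submersion.smooth]
        rw [funext φ.functor_h₁.map_src]
      · change Mfd.dmap φ.f₀ (Γ.h₂.tgt x) _ = Mfd.dmap Δ.h₂.tgt (φ.f₂ x) η
        rw [ht₂, Mfd.dmap_comp Δ.h₁.tgt_submersion.smooth Δ.v.src_submersion.smooth, ← hl,
          φ.functor_v.map_src, ← Mfd.dmap_comp Δ.h₁.tgt_submersion.smooth φ.smooth₁, ← Γ.tgt_l,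
          ← Mfd.dmap_comp φ.smooth₀ Γ.h₁.tgt_submersion.smooth]
        rw [funext φ.functor_h₁.map_tgt])
  have key : ∀ (e : Γ.G₁) (c : Γ.G₁.E), Mfd.dmap Mfd.fib.fst (φ.toPb₁ hφ.sub₀ e)
        (Mfd.dmap (φ.toPb₁ hφ.sub₀) e c) = (Mfd.dmap Γ.h₁.src e c, Mfd.dmap Γ.h₁.tgt e c) ∧
      Mfd.dmap Mfd.fib.snd (φ.toPb₁ hφ.sub₀ e) (Mfd.dmap (φ.toPb₁ hφ.sub₀) e c) =
        Mfd.dmap φ.f₁ e c := by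
    intro e c
    have hsm := φ.smooth_toPb₁ hφ.sub₀
    rw [← Mfd.dmap_comp Mfd.fib.smooth_fst hsm, ← Mfd.dmap_comp Mfd.fib.smooth_snd hsm]
    exact ⟨Mfd.dmap_prodMk Γ.h₁.src_submersion.smooth Γ.h₁.tgt_submersion.smooth e c, rfl⟩
  have eL : φ.pbL hφ.sub₀ (φ.toPb₂ hφ.sub₀ x) = φ.toPb₁ hφ.sub₀ (Γ.v.src x) :=
    (congrArg Prod.fst (Mfd.fib.cond (φ.toPb₂₁ hφ.sub₀ hφ.sub₁ x))).symm
  have eU : φ.pbU hφ.sub₀ (φ.toPb₂ hφ.sub₀ x) = φ.toPb₁ hφ.sub₀ (Γ.v.tgt x) :=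
    (congrArg Prod.snd (Mfd.fib.cond (φ.toPb₂₁ hφ.sub₀ hφ.sub₁ x))).symm
  have hL : Mfd.dmap (φ.toPb₁ hφ.sub₀) (Γ.v.src x) a =
      Mfd.dmap (φ.pbL hφ.sub₀) (φ.toPb₂ hφ.sub₀ x) z := by
    refine Mfd.fib.tangent_ext (φ.toPb₁ hφ.sub₀ (Γ.v.src x)) ?_ ?_
    · rw [(key _ _).1, ← eL, ← Mfd.dmap_comp Mfd.fib.smooth_fst (φ.smooth_pbL hφ.sub₀)]
      exact hz.symm
    · rw [(key _ _).2, ← eL, ← Mfd.dmap_comp Mfd.fib.smooth_snd (φ.smooth_pbL hφ.sub₀)]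
      refine hl.trans ?_
      rw [← hz']
      exact (Mfd.dmap_comp Δ.v.src_submersion.smooth Mfd.fib.smooth_snd (φ.toPb₂ hφ.sub₀ x) z).symm
  have hU : Mfd.dmap (φ.toPb₁ hφ.sub₀) (Γ.v.tgt x) b =
      Mfd.dmap (φ.pbU hφ.sub₀) (φ.toPb₂ hφ.sub₀ x) z := by
    refine Mfd.fib.tangent_ext (φ.toPb₁ hφ.sub₀ (Γ.v.tgt x)) ?_ ?_
    · rw [(key _ _).1, ← eU, ← Mfd.dmap_comp Mfd.fib.smooth_fst (φ.smooth_pbU hφ.sub₀), ← hs, ← ht]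
      exact hz.symm
    · rw [(key _ _).2, ← eU, ← Mfd.dmap_comp Mfd.fib.smooth_snd (φ.smooth_pbU hφ.sub₀)]
      refine hu.trans ?_
      rw [← hz']
      exact (Mfd.dmap_comp Δ.v.tgt_submersion.smooth Mfd.fib.smooth_snd (φ.toPb₂ hφ.sub₀ x) z).symm
  obtain ⟨y, hy, hy'⟩ := Mfd.fib.tangent_lift (φ.toPb₂₁ hφ.sub₀ hφ.sub₁ x) (a, b) z (by
    rw [Mfd.dmap_pmap hφ.sub₁.smooth hφ.sub₁.smooth,
      Mfd.dmap_prodMk (φ.smooth_pbL hφ.sub₀) (φ.smooth_pbU hφ.sub₀)]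
    exact Prod.ext hL hU)
  have hsm₂ := φ.smooth_toPb₂ hφ.sub₀
  have hsm : Mfd.Smooth (φ.toPb₂₁ hφ.sub₀ hφ.sub₁) := Mfd.fib.smooth_iff.2
    ⟨Γ.v.src_submersion.smooth.prodMk Γ.v.tgt_submersion.smooth, hsm₂⟩
  set ξ := Mfd.dmap g (φ.toPb₂₁ hφ.sub₀ hφ.sub₁ x) y with hξ
  have h1 : Mfd.dmap (φ.toPb₂₁ hφ.sub₀ hφ.sub₁) x ξ = y := by
    have h2 := Mfd.dmap_comp hsm hg (φ.toPb₂₁ hφ.sub₀ hφ.sub₁ x) y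
    rw [funext hg2, Mfd.dmap_id, hg1] at h2
    exact h2.symm
  rw [← h1, ← Mfd.dmap_comp Mfd.fib.smooth_fst hsm] at hy
  rw [← h1, ← Mfd.dmap_comp Mfd.fib.smooth_snd hsm] at hy'
  have h2 := (Mfd.dmap_prodMk Γ.v.src_submersion.smooth Γ.v.tgt_submersion.smooth x ξ).symm.trans hy
  have h3 : Mfd.dmap (φ.toPb₂ hφ.sub₀) x ξ = z := hy'
  rw [← h3, ← Mfd.dmap_comp Mfd.fib.smooth_snd hsm₂] at hz'
  exact ⟨ξ, congrArg Prod.fst h2, congrArg Prod.snd h2, hz'⟩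

theorem lifts₁ (hφ : φ.IsMorita) : Lifts Γ.h₁ Δ.h₁ φ.f₁ φ.f₀ := by
  intro e v η h
  obtain ⟨w, hw⟩ := hφ.sub₀.submersive (Γ.h₁.tgt e) (Mfd.dmap Δ.h₁.tgt (φ.f₁ e) η)
  obtain ⟨ξ, h1, -, h3⟩ := hφ.lift₁ e v w η h.symm hw
  exact ⟨ξ, h1, h3⟩

theorem liftsV (hφ : φ.IsMorita) : Lifts Γ.v Δ.v φ.f₂ φ.f₁ := by
  intro x a η h
  have es : ∀ (y : Γ.G₁) (c : Γ.G₁.E), Mfd.dmap φ.f₀ (Γ.h₁.src y) (Mfd.dmap Γ.h₁.src y c) =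
      Mfd.dmap Δ.h₁.src (φ.f₁ y) (Mfd.dmap φ.f₁ y c) := by
    intro y c
    rw [← Mfd.dmap_comp φ.smooth₀ Γ.h₁.src_submersion.smooth,
      ← Mfd.dmap_comp Δ.h₁.src_submersion.smooth φ.smooth₁, funext φ.functor_h₁.map_src]
  have et : ∀ (y : Γ.G₁) (c : Γ.G₁.E), Mfd.dmap φ.f₀ (Γ.h₁.tgt y) (Mfd.dmap Γ.h₁.tgt y c) =
      Mfd.dmap Δ.h₁.tgt (φ.f₁ y) (Mfd.dmap φ.f₁ y c) := by
    intro y c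
    rw [← Mfd.dmap_comp φ.smooth₀ Γ.h₁.tgt_submersion.smooth,
      ← Mfd.dmap_comp Δ.h₁.tgt_submersion.smooth φ.smooth₁, funext φ.functor_h₁.map_tgt]
  have ds : ∀ (y : Δ.G₂) (c : Δ.G₂.E), Mfd.dmap Δ.h₁.src (Δ.v.tgt y) (Mfd.dmap Δ.v.tgt y c) =
      Mfd.dmap Δ.h₁.src (Δ.v.src y) (Mfd.dmap Δ.v.src y c) := by
    intro y c
    rw [← Mfd.dmap_comp Δ.h₁.src_submersion.smooth Δ.v.src_submersion.smooth,
      ← Mfd.dmap_comp Δ.h₁.src_submersion.smooth Δ.v.tgt_submersion.smooth, funext Δ.src_l,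
      funext Δ.src_u]
  have dt : ∀ (y : Δ.G₂) (c : Δ.G₂.E), Mfd.dmap Δ.h₁.tgt (Δ.v.tgt y) (Mfd.dmap Δ.v.tgt y c) =
      Mfd.dmap Δ.h₁.tgt (Δ.v.src y) (Mfd.dmap Δ.v.src y c) := by
    intro y c
    rw [← Mfd.dmap_comp Δ.h₁.tgt_submersion.smooth Δ.v.src_submersion.smooth,
      ← Mfd.dmap_comp Δ.h₁.tgt_submersion.smooth Δ.v.tgt_submersion.smooth, funext Δ.tgt_l,
      funext Δ.tgt_u]
  have hsx : Γ.h₁.src (Γ.v.tgt x) = Γ.h₁.src (Γ.v.src x) := (Γ.src_u x).trans (Γ.src_l x).symm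
  have htx : Γ.h₁.tgt (Γ.v.tgt x) = Γ.h₁.tgt (Γ.v.src x) := (Γ.tgt_u x).trans (Γ.tgt_l x).symm
  obtain ⟨b, h1, h2, h3⟩ := hφ.lift₁ (Γ.v.tgt x) (Mfd.dmap Γ.h₁.src (Γ.v.src x) a)
    (Mfd.dmap Γ.h₁.tgt (Γ.v.src x) a) (Mfd.dmap Δ.v.tgt (φ.f₂ x) η)
    (by rw [hsx, es, ← h, ← φ.functor_v.map_src, ← φ.functor_v.map_tgt, ds])
    (by rw [htx, et, ← h, ← φ.functor_v.map_src, ← φ.functor_v.map_tgt, dt])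
  obtain ⟨ξ, k1, -, k3⟩ := hφ.lift₂ x a b η h1.symm h2.symm h.symm h3
  exact ⟨ξ, k1, k3⟩

theorem lifts₂ (hφ : φ.IsMorita) : Lifts Γ.h₂ Δ.h₂ φ.f₂ φ.f₀ := by
  intro x v η h
  have e1 : Γ.h₂.src = fun x => Γ.h₁.src (Γ.v.src x) := funext fun x => (Γ.src_l x).symm
  have e2 : Δ.h₂.src = fun x => Δ.h₁.src (Δ.v.src x) := funext fun x => (Δ.src_l x).symm
  rw [e1, e2, Mfd.dmap_comp Δ.h₁.src_submersion.smooth Δ.v.src_submersion.smooth,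
    φ.functor_v.map_src] at h
  obtain ⟨a, h1, h2⟩ := hφ.lifts₁ _ _ _ h
  obtain ⟨ξ, h3, h4⟩ := hφ.liftsV x a η h2.symm
  exact ⟨ξ, by rw [e1, Mfd.dmap_comp Γ.h₁.src_submersion.smooth Γ.v.src_submersion.smooth, h3, h1],
    h4⟩

theorem submersion₁ (hφ : φ.IsMorita) : Mfd.IsSurjSubmersion φ.f₁ := by
  refine ⟨φ.smooth₁, fun g => ?_, fun e η => ?_⟩
  · obtain ⟨x, hx⟩ := hφ.sub₀.surjective (Δ.h₁.src g)
    obtain ⟨y, hy⟩ := hφ.sub₀.surjective (Δ.h₁.tgt g)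
    obtain ⟨e, -, -, he⟩ := hφ.surj₁ x y g hx hy
    exact ⟨e, he⟩
  · obtain ⟨v, hv⟩ := hφ.sub₀.submersive (Γ.h₁.src e) (Mfd.dmap Δ.h₁.src (φ.f₁ e) η)
    obtain ⟨ξ, -, hξ⟩ := hφ.lifts₁ e v η hv.symm
    exact ⟨ξ, hξ⟩

theorem submersion₂ (hφ : φ.IsMorita) : Mfd.IsSurjSubmersion φ.f₂ := by
  refine ⟨φ.smooth₂, fun x => ?_, fun e η => ?_⟩
  · obtain ⟨a, ha⟩ := hφ.submersion₁.surjective (Δ.v.src x)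
    obtain ⟨b, hs, ht, hb⟩ := hφ.surj₁ (Γ.h₁.src a) (Γ.h₁.tgt a) (Δ.v.tgt x)
      (by rw [← φ.functor_h₁.map_src, ha, Δ.src_l, Δ.src_u])
      (by rw [← φ.functor_h₁.map_tgt, ha, Δ.tgt_l, Δ.tgt_u])
    obtain ⟨d, -, -, -, hd⟩ := hφ.fill₂ (X := Mfd.pt) (Mfd.smooth_const a) (Mfd.smooth_const b)
      (Mfd.smooth_const x) (fun _ => hs.symm) (fun _ => ht.symm) (fun _ => ha) (fun _ => hb)
    exact ⟨d PUnit.unit, hd _⟩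
  · obtain ⟨v, hv⟩ := hφ.submersion₁.submersive (Γ.v.src e) (Mfd.dmap Δ.v.src (φ.f₂ e) η)
    obtain ⟨ξ, -, hξ⟩ := hφ.liftsV e v η hv.symm
    exact ⟨ξ, hξ⟩

/-- A pointwise criterion. -/
theorem of_lift (h₀ : Mfd.IsSurjSubmersion φ.f₀)
    (hsurj : ∀ (x y : Γ.G₀) (g : Δ.G₁), φ.f₀ x = Δ.h₁.src g → φ.f₀ y = Δ.h₁.tgt g →
      ∃ e, Γ.h₁.src e = x ∧ Γ.h₁.tgt e = y ∧ φ.f₁ e = g)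
    (hlift : ∀ (e : Γ.G₁) (v w : Γ.G₀.E) (η : Δ.G₁.E),
      Mfd.dmap φ.f₀ (Γ.h₁.src e) v = Mfd.dmap Δ.h₁.src (φ.f₁ e) η →
      Mfd.dmap φ.f₀ (Γ.h₁.tgt e) w = Mfd.dmap Δ.h₁.tgt (φ.f₁ e) η →
      ∃ ξ, Mfd.dmap Γ.h₁.src e ξ = v ∧ Mfd.dmap Γ.h₁.tgt e ξ = w ∧ Mfd.dmap φ.f₁ e ξ = η)
    (hext : ∀ x y : Γ.G₂, Γ.v.src x = Γ.v.src y → Γ.v.tgt x = Γ.v.tgt y → φ.f₂ x = φ.f₂ y → x = y)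
    (hfill : ∀ (X : Mfd.{u}) (a b : X → Γ.G₁) (c : X → Δ.G₂), Mfd.Smooth a → Mfd.Smooth b →
      Mfd.Smooth c → (∀ x, Γ.h₁.src (a x) = Γ.h₁.src (b x)) →
      (∀ x, Γ.h₁.tgt (a x) = Γ.h₁.tgt (b x)) → (∀ x, φ.f₁ (a x) = Δ.v.src (c x)) →
      (∀ x, φ.f₁ (b x) = Δ.v.tgt (c x)) →
      ∃ d : X → Γ.G₂, Mfd.Smooth d ∧ (∀ x, Γ.v.src (d x) = a x) ∧ (∀ x, Γ.v.tgt (d x) = b x) ∧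
        ∀ x, φ.f₂ (d x) = c x) : φ.IsMorita := by
  have hsm := φ.smooth_toPb₁ h₀
  have sub₁ : Mfd.IsSurjSubmersion (φ.toPb₁ h₀) := by
    refine ⟨hsm, fun p => ?_, fun e z => ?_⟩
    · have hc := Mfd.fib.cond p
      obtain ⟨e, h1, h2, h3⟩ := hsurj (Mfd.fib.fst p).1 (Mfd.fib.fst p).2 (Mfd.fib.snd p)
        (congrArg Prod.fst hc) (congrArg Prod.snd hc)
      exact ⟨e, Mfd.fib.ext (Prod.ext h1 h2) h3⟩
    · have hc := Mfd.fib.tangent_cond (φ.toPb₁ h₀ e) z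
      rw [Mfd.dmap_pmap h₀.smooth h₀.smooth,
        Mfd.dmap_prodMk Δ.h₁.src_submersion.smooth Δ.h₁.tgt_submersion.smooth] at hc
      obtain ⟨ξ, h1, h2, h3⟩ := hlift e _ _ _ (congrArg Prod.fst hc) (congrArg Prod.snd hc)
      refine ⟨ξ, Mfd.fib.tangent_ext (φ.toPb₁ h₀ e) ?_ ?_⟩
      · rw [← Mfd.dmap_comp Mfd.fib.smooth_fst hsm]
        exact (Mfd.dmap_prodMk Γ.h₁.src_submersion.smooth Γ.h₁.tgt_submersion.smooth e ξ).trans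
          (Prod.ext h1 h2)
      · rw [← Mfd.dmap_comp Mfd.fib.smooth_snd hsm]
        exact h3
  have hc (y : φ.pb₂₁ h₀ sub₁) := Mfd.fib.cond y
  have hcl (y : φ.pb₂₁ h₀ sub₁) : φ.toPb₁ h₀ (Mfd.fib.fst y).1 = φ.pbL h₀ (Mfd.fib.snd y) :=
    congrArg Prod.fst (hc y)
  have hcu (y : φ.pb₂₁ h₀ sub₁) : φ.toPb₁ h₀ (Mfd.fib.fst y).2 = φ.pbU h₀ (Mfd.fib.snd y) :=
    congrArg Prod.snd (hc y)
  have hst (y : φ.pb₂₁ h₀ sub₁) : ((Γ.h₁.src (Mfd.fib.fst y).1, Γ.h₁.tgt (Mfd.fib.fst y).1) :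
      Mfd.prod Γ.G₀ Γ.G₀) = (Γ.h₁.src (Mfd.fib.fst y).2, Γ.h₁.tgt (Mfd.fib.fst y).2) :=
    (congrArg Mfd.fib.fst (hcl y)).trans (congrArg Mfd.fib.fst (hcu y)).symm
  obtain ⟨d, hd, h1, h2, h3⟩ := hfill (φ.pb₂₁ h₀ sub₁) (fun y => (Mfd.fib.fst y).1)
    (fun y => (Mfd.fib.fst y).2) (fun y => Mfd.fib.snd (Mfd.fib.snd y))
    (Mfd.Smooth.comp (N := Mfd.prod Γ.G₁ Γ.G₁) Mfd.smooth_fst Mfd.fib.smooth_fst)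
    (Mfd.Smooth.comp (N := Mfd.prod Γ.G₁ Γ.G₁) Mfd.smooth_snd Mfd.fib.smooth_fst)
    (Mfd.fib.smooth_snd.comp Mfd.fib.smooth_snd)
    (fun y => congrArg Prod.fst (hst y)) (fun y => congrArg Prod.snd (hst y))
    (fun y => congrArg Mfd.fib.snd (hcl y)) (fun y => congrArg Mfd.fib.snd (hcu y))
  refine ⟨h₀, sub₁, d, hd, fun x => hext _ _ (h1 _) (h2 _) (h3 _), fun y => ?_⟩
  refine Mfd.fib.ext (Prod.ext (h1 y) (h2 y)) (Mfd.fib.ext ?_ (h3 y))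
  have hf : ((Γ.h₁.src (Mfd.fib.fst y).1, Γ.h₁.tgt (Mfd.fib.fst y).1) :
      Mfd.prod Γ.G₀ Γ.G₀) = Mfd.fib.fst (Mfd.fib.snd y) := congrArg Mfd.fib.fst (hcl y)
  rw [← hf]
  refine Prod.ext ?_ ?_
  · exact (Γ.src_l _).symm.trans (congrArg Γ.h₁.src (h1 y))
  · exact (Γ.tgt_l _).symm.trans (congrArg Γ.h₁.tgt (h1 y))

end IsMorita

end Hom

end

section

section FibreProduct

variable {Γ E E' : Lie2Groupoid.{u}} (φ : Hom E Γ) (hφ : φ.IsMorita) (φ' : Hom E' Γ)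

/-- The fibre product `E ×_Γ E'` of Lie 2-groupoids over a Morita morphism `φ : E → Γ` and a morphism
`φ' : E' → Γ`, with all structure maps componentwise. -/
def fibreProduct : Lie2Groupoid.{u} where
  G₀ := Mfd.fib φ.f₀ φ'.f₀ hφ.sub₀ φ'.smooth₀
  G₁ := Mfd.fib φ.f₁ φ'.f₁ hφ.submersion₁ φ'.smooth₁
  G₂ := Mfd.fib φ.f₂ φ'.f₂ hφ.submersion₂ φ'.smooth₂
  h₁ := .fib φ.functor_h₁ φ'.functor_h₁ hφ.submersion₁ hφ.sub₀ φ'.smooth₁ φ'.smooth₀ hφ.lifts₁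
  v := .fib φ.functor_v φ'.functor_v hφ.submersion₂ hφ.submersion₁ φ'.smooth₂ φ'.smooth₁ hφ.liftsV
  h₂ := .fib φ.functor_h₂ φ'.functor_h₂ hφ.submersion₂ hφ.sub₀ φ'.smooth₂ φ'.smooth₀ hφ.lifts₂
  src_l x := Mfd.fib.ext (E.src_l _) (E'.src_l _)
  src_u x := Mfd.fib.ext (E.src_u _) (E'.src_u _)
  tgt_l x := Mfd.fib.ext (E.tgt_l _) (E'.tgt_l _)
  tgt_u x := Mfd.fib.ext (E.tgt_u _) (E'.tgt_u _)
  l_one x := Mfd.fib.ext (E.l_one _) (E'.l_one _)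
  u_one x := Mfd.fib.ext (E.u_one _) (E'.u_one _)
  l_mul y x h h' := Mfd.fib.ext (E.l_mul _ _ _ _) (E'.l_mul _ _ _ _)
  u_mul y x h h' := Mfd.fib.ext (E.u_mul _ _ _ _) (E'.u_mul _ _ _ _)
  one_one x := Mfd.fib.ext (E.one_one _) (E'.one_one _)
  one_mul g f h h' := Mfd.fib.ext (E.one_mul _ _ _ (congrArg Mfd.fib.fst h'))
    (E'.one_mul _ _ _ (congrArg Mfd.fib.snd h'))
  interchange y' y x' x hy hx h h' h'' k := Mfd.fib.ext
    (E.interchange _ _ _ _ _ _ _ _ _ (congrArg Mfd.fib.fst k))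
    (E'.interchange _ _ _ _ _ _ _ _ _ (congrArg Mfd.fib.snd k))

/-- The first projection of the fibre product. -/
def fibreProduct.fst : Hom (fibreProduct φ hφ φ') E where
  f₀ := Mfd.fib.fst
  f₁ := Mfd.fib.fst
  f₂ := Mfd.fib.fst
  smooth₀ := Mfd.fib.smooth_fst
  smooth₁ := Mfd.fib.smooth_fst
  smooth₂ := Mfd.fib.smooth_fst
  functor_h₁ := ⟨fun _ => rfl, fun _ => rfl, fun _ => rfl, fun _ _ _ _ => rfl⟩
  functor_v := ⟨fun _ => rfl, fun _ => rfl, fun _ => rfl, fun _ _ _ _ => rfl⟩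
  functor_h₂ := ⟨fun _ => rfl, fun _ => rfl, fun _ => rfl, fun _ _ _ _ => rfl⟩

/-- The second projection of the fibre product. -/
def fibreProduct.snd : Hom (fibreProduct φ hφ φ') E' where
  f₀ := Mfd.fib.snd
  f₁ := Mfd.fib.snd
  f₂ := Mfd.fib.snd
  smooth₀ := Mfd.fib.smooth_snd
  smooth₁ := Mfd.fib.smooth_snd
  smooth₂ := Mfd.fib.smooth_snd
  functor_h₁ := ⟨fun _ => rfl, fun _ => rfl, fun _ => rfl, fun _ _ _ _ => rfl⟩
  functor_v := ⟨fun _ => rfl, fun _ => rfl, fun _ => rfl, fun _ _ _ _ => rfl⟩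
  functor_h₂ := ⟨fun _ => rfl, fun _ => rfl, fun _ => rfl, fun _ _ _ _ => rfl⟩

/-- The morphism `E ×_Γ E' → Γ` given by the common value `φ(e) = φ'(e')`. -/
def fibreProduct.toBase : Hom (fibreProduct φ hφ φ') Γ := φ'.comp (fibreProduct.snd φ hφ φ')

theorem fibreProduct.toBase_eq :
    fibreProduct.toBase φ hφ φ' = φ.comp (fibreProduct.fst φ hφ φ') := by
  have h0 : (fibreProduct.toBase φ hφ φ').f₀ = (φ.comp (fibreProduct.fst φ hφ φ')).f₀ :=
    funext fun x => (Mfd.fib.cond (hf := hφ.sub₀) (hf' := φ'.smooth₀) x).symm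
  have h1 : (fibreProduct.toBase φ hφ φ').f₁ = (φ.comp (fibreProduct.fst φ hφ φ')).f₁ :=
    funext fun x => (Mfd.fib.cond (hf := hφ.submersion₁) (hf' := φ'.smooth₁) x).symm
  have h2 : (fibreProduct.toBase φ hφ φ').f₂ = (φ.comp (fibreProduct.fst φ hφ φ')).f₂ :=
    funext fun x => (Mfd.fib.cond (hf := hφ.submersion₂) (hf' := φ'.smooth₂) x).symm
  have : ∀ f g : Hom (fibreProduct φ hφ φ') Γ, f.f₀ = g.f₀ → f.f₁ = g.f₁ → f.f₂ = g.f₂ → f = g := by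
    rintro ⟨⟩ ⟨⟩ h h' h''
    dsimp only at h h' h''
    subst h h' h''
    rfl
  exact this _ _ h0 h1 h2

theorem fibreProduct.toBase_morita (hφ' : φ'.IsMorita) :
    (fibreProduct.toBase φ hφ φ').IsMorita := by
  refine .of_lift (hφ'.sub₀.comp (Mfd.fib.snd_surjSubmersion (hf := hφ.sub₀) (hf' := φ'.smooth₀))) ?_ ?_ ?_ ?_
  · intro x y g hx hy
    obtain ⟨e', h1', h2', h3'⟩ := hφ'.surj₁ (Mfd.fib.snd x) (Mfd.fib.snd y) g hx hy
    obtain ⟨e, h1, h2, h3⟩ := hφ.surj₁ (Mfd.fib.fst x) (Mfd.fib.fst y) g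
      ((Mfd.fib.cond x).trans hx) ((Mfd.fib.cond y).trans hy)
    exact ⟨Mfd.fib.mk (hf := hφ.submersion₁) (hf' := φ'.smooth₁) e e' (h3.trans h3'.symm), 
      Mfd.fib.ext (hf := hφ.sub₀) (hf' := φ'.smooth₀) h1 h1', Mfd.fib.ext (hf := hφ.sub₀) (hf' := φ'.smooth₀) h2 h2', h3'⟩
  · intro e v w η hv hw
    let P := fibreProduct φ hφ φ'
    let p : Hom P E := fibreProduct.fst φ hφ φ'
    let q : Hom P E' := fibreProduct.snd φ hφ φ'
    have hv' := hv
    have hw' := hw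
    have c0 : ∀ (x : P.G₀) (v : P.G₀.E), Mfd.dmap (fibreProduct.toBase φ hφ φ').f₀ x v =
        Mfd.dmap φ.f₀ (p.f₀ x) (Mfd.dmap p.f₀ x v) := by
      intro x v
      rw [← Mfd.dmap_comp φ.smooth₀ p.smooth₀, fibreProduct.toBase_eq]
      rfl
    have c0' : ∀ (x : P.G₀) (v : P.G₀.E), Mfd.dmap (fibreProduct.toBase φ hφ φ').f₀ x v =
        Mfd.dmap φ'.f₀ (q.f₀ x) (Mfd.dmap q.f₀ x v) := by
      intro x v
      rw [← Mfd.dmap_comp φ'.smooth₀ q.smooth₀]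
      rfl
    have c1' : (fibreProduct.toBase φ hφ φ').f₁ e = φ'.f₁ (q.f₁ e) := rfl
    have c1 : (fibreProduct.toBase φ hφ φ').f₁ e = φ.f₁ (p.f₁ e) :=
      (Mfd.fib.cond (hf := hφ.submersion₁) (hf' := φ'.smooth₁) e).symm
    have ext₀ : ∀ (x : P.G₀) (v w : P.G₀.E), Mfd.dmap p.f₀ x v = Mfd.dmap p.f₀ x w →
        Mfd.dmap q.f₀ x v = Mfd.dmap q.f₀ x w → v = w := fun x v w h h' =>
      Mfd.fib.tangent_ext (hf := hφ.sub₀) (hf' := φ'.smooth₀) x h h'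
    rw [c0, c1] at hv hw
    rw [c0', c1'] at hv' hw'
    obtain ⟨ξ, h1, h2, h3⟩ := hφ.lift₁ (p.f₁ e) _ _ η hv hw
    obtain ⟨ξ', h1', h2', h3'⟩ := hφ'.lift₁ (q.f₁ e) _ _ η hv' hw'
    obtain ⟨z, hz, hz'⟩ : ∃ z, Mfd.dmap p.f₁ e z = ξ ∧ Mfd.dmap q.f₁ e z = ξ' :=
      Mfd.fib.tangent_lift (hf := hφ.submersion₁) (hf' := φ'.smooth₁) e ξ ξ' (by
        refine Eq.trans ?_ (h3.trans h3'.symm)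
        rfl)
    refine ⟨z, ext₀ (P.h₁.src e) _ _ ?_ ?_, ext₀ (P.h₁.tgt e) _ _ ?_ ?_, ?_⟩
    · rw [← h1, ← Mfd.dmap_comp p.smooth₀ P.h₁.src_submersion.smooth, ← hz]
      exact Mfd.dmap_comp E.h₁.src_submersion.smooth p.smooth₁ e z
    · rw [← h1', ← Mfd.dmap_comp q.smooth₀ P.h₁.src_submersion.smooth, ← hz']
      exact Mfd.dmap_comp E'.h₁.src_submersion.smooth q.smooth₁ e z
    · rw [← h2, ← Mfd.dmap_comp p.smooth₀ P.h₁.tgt_submersion.smooth, ← hz]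
      exact Mfd.dmap_comp E.h₁.tgt_submersion.smooth p.smooth₁ e z
    · rw [← h2', ← Mfd.dmap_comp q.smooth₀ P.h₁.tgt_submersion.smooth, ← hz']
      exact Mfd.dmap_comp E'.h₁.tgt_submersion.smooth q.smooth₁ e z
    · rw [← h3', ← hz']
      exact Mfd.dmap_comp φ'.smooth₁ q.smooth₁ e z
  · intro x y hl hu h
    have h' := h
    rw [fibreProduct.toBase_eq] at h'
    exact Mfd.fib.ext (hf := hφ.submersion₂) (hf' := φ'.smooth₂)
      (hφ.ext₂ (congrArg (fibreProduct.fst φ hφ φ').f₁ hl) (congrArg (fibreProduct.fst φ hφ φ').f₁ hu) h')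
      (hφ'.ext₂ (congrArg (fibreProduct.snd φ hφ φ').f₁ hl) (congrArg (fibreProduct.snd φ hφ φ').f₁ hu) h)
  · intro X a b c ha hb hc hs ht hl hu
    obtain ⟨d, hd, d1, d2, d3⟩ := hφ.fill₂ ((fibreProduct.fst φ hφ φ').smooth₁.comp ha)
      ((fibreProduct.fst φ hφ φ').smooth₁.comp hb)
      hc (fun x => congrArg (fibreProduct.fst φ hφ φ').f₀ (hs x)) (fun x => congrArg (fibreProduct.fst φ hφ φ').f₀ (ht x))
      (fun x => (Mfd.fib.cond (hf := hφ.submersion₁) (hf' := φ'.smooth₁) (a x)).trans (hl x)) (fun x => (Mfd.fib.cond (hf := hφ.submersion₁) (hf' := φ'.smooth₁) (b x)).trans (hu x))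
    obtain ⟨d', hd', d1', d2', d3'⟩ := hφ'.fill₂ ((fibreProduct.snd φ hφ φ').smooth₁.comp ha)
      ((fibreProduct.snd φ hφ φ').smooth₁.comp hb) hc (fun x => congrArg (fibreProduct.snd φ hφ φ').f₀ (hs x))
      (fun x => congrArg (fibreProduct.snd φ hφ φ').f₀ (ht x)) hl hu
    exact ⟨fun x => Mfd.fib.mk (hf := hφ.submersion₂) (hf' := φ'.smooth₂) (d x) (d' x) ((d3 x).trans (d3' x).symm),
      Mfd.fib.smooth_iff.2 ⟨hd, hd'⟩, fun x => Mfd.fib.ext (hf := hφ.submersion₁) (hf' := φ'.smooth₁) (d1 x) (d1' x),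
      fun x => Mfd.fib.ext (hf := hφ.submersion₁) (hf' := φ'.smooth₁) (d2 x) (d2' x), d3'⟩

end FibreProduct

end

section

/-! ### Products -/

/-- The product of two Lie groupoids. -/
def LieGroupoidStr.prod {A M A' M' : Mfd.{u}} (S : LieGroupoidStr A M) (S' : LieGroupoidStr A' M') :
    LieGroupoidStr (Mfd.prod A A') (Mfd.prod M M') where
  src := Mfd.pmap S.src S'.src
  tgt := Mfd.pmap S.tgt S'.tgt
  one := Mfd.pmap S.one S'.one
  mul g f h := (S.mul g.1 f.1 (congrArg Prod.fst h), S'.mul g.2 f.2 (congrArg Prod.snd h))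
  inv := Mfd.pmap S.inv S'.inv
  src_submersion := S.src_submersion.pmap S'.src_submersion
  tgt_submersion := S.tgt_submersion.pmap S'.tgt_submersion
  one_smooth := S.one_smooth.pmap S'.one_smooth
  inv_smooth := S.inv_smooth.pmap S'.inv_smooth
  mul_smooth n p q hp hq h := Mfd.SmoothPlot.prodMk
    (S.mul_smooth n _ _ (Mfd.smooth_fst.comp_plot hp) (Mfd.smooth_fst.comp_plot hq)
      fun x => congrArg Prod.fst (h x))
    (S'.mul_smooth n _ _ (Mfd.smooth_snd.comp_plot hp) (Mfd.smooth_snd.comp_plot hq)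
      fun x => congrArg Prod.snd (h x))
  src_one m := Prod.ext (S.src_one _) (S'.src_one _)
  tgt_one m := Prod.ext (S.tgt_one _) (S'.tgt_one _)
  src_mul g f h := Prod.ext (S.src_mul _ _ _) (S'.src_mul _ _ _)
  tgt_mul g f h := Prod.ext (S.tgt_mul _ _ _) (S'.tgt_mul _ _ _)
  mul_assoc k g f h h' := Prod.ext (S.mul_assoc _ _ _ _ _) (S'.mul_assoc _ _ _ _ _)
  mul_one f := Prod.ext (S.mul_one _) (S'.mul_one _)
  one_mul f := Prod.ext (S.one_mul _) (S'.one_mul _)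
  src_inv f := Prod.ext (S.src_inv _) (S'.src_inv _)
  tgt_inv f := Prod.ext (S.tgt_inv _) (S'.tgt_inv _)
  inv_mul f := Prod.ext (S.inv_mul _) (S'.inv_mul _)
  mul_inv f := Prod.ext (S.mul_inv _) (S'.mul_inv _)

/-- The product of two Lie 2-groupoids. -/
def Lie2Groupoid.prod (Γ Γ' : Lie2Groupoid.{u}) : Lie2Groupoid.{u} where
  G₀ := Mfd.prod Γ.G₀ Γ'.G₀
  G₁ := Mfd.prod Γ.G₁ Γ'.G₁
  G₂ := Mfd.prod Γ.G₂ Γ'.G₂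
  h₁ := Γ.h₁.prod Γ'.h₁
  v := Γ.v.prod Γ'.v
  h₂ := Γ.h₂.prod Γ'.h₂
  src_l x := Prod.ext (Γ.src_l _) (Γ'.src_l _)
  src_u x := Prod.ext (Γ.src_u _) (Γ'.src_u _)
  tgt_l x := Prod.ext (Γ.tgt_l _) (Γ'.tgt_l _)
  tgt_u x := Prod.ext (Γ.tgt_u _) (Γ'.tgt_u _)
  l_one x := Prod.ext (Γ.l_one _) (Γ'.l_one _)
  u_one x := Prod.ext (Γ.u_one _) (Γ'.u_one _)
  l_mul y x h h' := Prod.ext (Γ.l_mul _ _ _ _) (Γ'.l_mul _ _ _ _)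
  u_mul y x h h' := Prod.ext (Γ.u_mul _ _ _ _) (Γ'.u_mul _ _ _ _)
  one_one x := Prod.ext (Γ.one_one _) (Γ'.one_one _)
  one_mul g f h h' := Prod.ext (Γ.one_mul _ _ _ (congrArg Prod.fst h'))
    (Γ'.one_mul _ _ _ (congrArg Prod.snd h'))
  interchange y' y x' x hy hx h h' h'' k := Prod.ext
    (Γ.interchange _ _ _ _ _ _ _ _ _ (congrArg Prod.fst k))
    (Γ'.interchange _ _ _ _ _ _ _ _ _ (congrArg Prod.snd k))

namespace Hom

/-- The first projection `Γ × Γ' → Γ`. -/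
def fst (Γ Γ' : Lie2Groupoid.{u}) : Hom (Γ.prod Γ') Γ where
  f₀ := Prod.fst
  f₁ := Prod.fst
  f₂ := Prod.fst
  smooth₀ := Mfd.smooth_fst
  smooth₁ := Mfd.smooth_fst
  smooth₂ := Mfd.smooth_fst
  functor_h₁ := ⟨fun _ => rfl, fun _ => rfl, fun _ => rfl, fun _ _ _ _ => rfl⟩
  functor_v := ⟨fun _ => rfl, fun _ => rfl, fun _ => rfl, fun _ _ _ _ => rfl⟩
  functor_h₂ := ⟨fun _ => rfl, fun _ => rfl, fun _ => rfl, fun _ _ _ _ => rfl⟩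

/-- The second projection `Γ × Γ' → Γ'`. -/
def snd (Γ Γ' : Lie2Groupoid.{u}) : Hom (Γ.prod Γ') Γ' where
  f₀ := Prod.snd
  f₁ := Prod.snd
  f₂ := Prod.snd
  smooth₀ := Mfd.smooth_snd
  smooth₁ := Mfd.smooth_snd
  smooth₂ := Mfd.smooth_snd
  functor_h₁ := ⟨fun _ => rfl, fun _ => rfl, fun _ => rfl, fun _ _ _ _ => rfl⟩
  functor_v := ⟨fun _ => rfl, fun _ => rfl, fun _ => rfl, fun _ _ _ _ => rfl⟩
  functor_h₂ := ⟨fun _ => rfl, fun _ => rfl, fun _ => rfl, fun _ _ _ _ => rfl⟩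

/-- The diagonal morphism `Γ → Γ × Γ`. -/
def diag (Γ : Lie2Groupoid.{u}) : Hom Γ (Γ.prod Γ) where
  f₀ x := (x, x)
  f₁ x := (x, x)
  f₂ x := (x, x)
  smooth₀ := Mfd.smooth_id.prodMk Mfd.smooth_id
  smooth₁ := Mfd.smooth_id.prodMk Mfd.smooth_id
  smooth₂ := Mfd.smooth_id.prodMk Mfd.smooth_id
  functor_h₁ := ⟨fun _ => rfl, fun _ => rfl, fun _ => rfl, fun _ _ _ _ => rfl⟩
  functor_v := ⟨fun _ => rfl, fun _ => rfl, fun _ => rfl, fun _ _ _ _ => rfl⟩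
  functor_h₂ := ⟨fun _ => rfl, fun _ => rfl, fun _ => rfl, fun _ _ _ _ => rfl⟩

end Hom

/-! ### Crossed modules and Lie 2-groups -/

/-- Crossed modules of Lie groups `ρ : G → H`, with a right action `x ↦ x ^ h` (written `act x h`) of
`H` on `G` by automorphisms. -/
structure CrossedModule : Type (u + 1) where
  /-- the group `G` -/
  G : Mfd.{u}
  /-- the group `H` -/
  H : Mfd.{u}
  [groupG : Group G]
  [groupH : Group H]
  [lieG : LieGroup G.I ∞ G]
  [lieH : LieGroup H.I ∞ H]
  /-- the homomorphism -/
  ρ : G →* H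
  /-- the right action -/
  act : G → H → G
  smooth_ρ : Mfd.Smooth ρ
  smooth_act : Mfd.Smooth (M := Mfd.prod G H) fun p => act p.1 p.2
  act_mul : ∀ x y h, act (x * y) h = act x h * act y h
  act_one : ∀ x, act x 1 = x
  act_act : ∀ x h k, act (act x h) k = act x (h * k)
  ρ_act : ∀ x h, ρ (act x h) = h⁻¹ * ρ x * h
  peiffer : ∀ x y, act x (ρ y) = y⁻¹ * x * y

namespace CrossedModule

attribute [instance] groupG groupH lieG lieH

variable (X Y : CrossedModule.{u})

theorem one_act (h : X.H) : X.act 1 h = 1 := by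
  have := X.act_mul 1 1 h
  rw [mul_one] at this
  exact (left_eq_mul.1 this)

theorem inv_act (x : X.G) (h : X.H) : X.act x⁻¹ h = (X.act x h)⁻¹ := by
  refine eq_inv_of_mul_eq_one_left ?_
  rw [← X.act_mul, inv_mul_cancel, X.one_act]

end CrossedModule

namespace Mfd

variable {M K : Mfd.{u}} [Group K] [LieGroup K.I ∞ K]

theorem Smooth.mul {f g : M → K} (hf : Smooth f) (hg : Smooth g) :
    Smooth fun x => f x * g x := ContMDiff.mul hf hg

theorem Smooth.inv {f : M → K} (hf : Smooth f) : Smooth fun x => (f x)⁻¹ := ContMDiff.inv hf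

theorem SmoothPlot.mul {n : ℕ} {f g : Euc n → K} (hf : SmoothPlot f) (hg : SmoothPlot g) :
    SmoothPlot fun x => f x * g x := ContMDiff.mul hf hg

theorem SmoothPlot.inv {n : ℕ} {f : Euc n → K} (hf : SmoothPlot f) :
    SmoothPlot fun x => (f x)⁻¹ := ContMDiff.inv hf

theorem isSurjSubmersion_pt (f : M → pt.{u}) (x : M) : IsSurjSubmersion f := by
  have hf : f = fun _ => f x := funext fun _ => Subsingleton.elim _ _
  exact ⟨hf ▸ smooth_const (f x), fun _ => ⟨x, Subsingleton.elim _ _⟩,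
    fun _ _ => ⟨0, Subsingleton.elim _ _⟩⟩

end Mfd

namespace CrossedModule

variable (X Y : CrossedModule.{u})

/-- A Lie group as a Lie groupoid over the point. -/
def groupStr (K : Mfd.{u}) [Group K] [LieGroup K.I ∞ K] : LieGroupoidStr K Mfd.pt.{u} where
  src _ := PUnit.unit
  tgt _ := PUnit.unit
  one _ := 1
  mul g f _ := g * f
  inv g := g⁻¹
  src_submersion := Mfd.isSurjSubmersion_pt _ 1
  tgt_submersion := Mfd.isSurjSubmersion_pt _ 1
  one_smooth := Mfd.smooth_const 1
  inv_smooth := Mfd.Smooth.inv Mfd.smooth_id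
  mul_smooth n p q hp hq _ := hp.mul hq
  src_one m := rfl
  tgt_one m := rfl
  src_mul g f h := rfl
  tgt_mul g f h := rfl
  mul_assoc k g f h h' := mul_assoc k g f
  mul_one f := mul_one f
  one_mul f := one_mul f
  src_inv f := rfl
  tgt_inv f := rfl
  inv_mul f := inv_mul_cancel f
  mul_inv f := mul_inv_cancel f

theorem smooth_fst : Mfd.Smooth (M := Mfd.prod X.G X.H) (N := X.G) Prod.fst := Mfd.smooth_fst
theorem smooth_snd : Mfd.Smooth (M := Mfd.prod X.G X.H) (N := X.H) Prod.snd := Mfd.smooth_snd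

/-- The vertical groupoid `G × H ⇉ H`: `l(x, γ) = γ`, `u(x, γ) = ρ(x)γ`, and
`(x', ρ(x)γ) (x, γ) = (x'x, γ)`. -/
def verticalStr : LieGroupoidStr (Mfd.prod X.G X.H) X.H where
  src p := p.2
  tgt p := X.ρ p.1 * p.2
  one γ := (1, γ)
  mul g f _ := (g.1 * f.1, f.2)
  inv p := (p.1⁻¹, X.ρ p.1 * p.2)
  src_submersion := .of_sections X.smooth_snd (fun γ => ⟨(1, γ), rfl⟩) fun p =>
    ⟨fun γ => (p.1, γ), (Mfd.smooth_const _).prodMk Mfd.smooth_id, rfl, fun _ => rfl⟩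
  tgt_submersion := .of_sections ((X.smooth_ρ.comp X.smooth_fst).mul X.smooth_snd)
    (fun γ => ⟨(1, γ), by simp⟩) fun p =>
    ⟨fun γ => (p.1, (X.ρ p.1)⁻¹ * γ),
      (Mfd.smooth_const _).prodMk ((Mfd.smooth_const _).mul Mfd.smooth_id), by simp, by simp⟩
  one_smooth := (Mfd.smooth_const _).prodMk Mfd.smooth_id
  inv_smooth := (Mfd.Smooth.inv X.smooth_fst).prodMk ((X.smooth_ρ.comp X.smooth_fst).mul X.smooth_snd)
  mul_smooth n p q hp hq h := ((X.smooth_fst.comp_plot hp).mul (X.smooth_fst.comp_plot hq)).prodMk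
    (X.smooth_snd.comp_plot hq)
  src_one m := rfl
  tgt_one m := by simp
  src_mul g f h := rfl
  tgt_mul g f h := by
    rw [map_mul, mul_assoc, ← h]
  mul_assoc k g f h h' := Prod.ext (mul_assoc _ _ _) rfl
  mul_one f := Prod.ext (mul_one _) rfl
  one_mul f := Prod.ext (one_mul _) rfl
  src_inv f := rfl
  tgt_inv f := by simp
  inv_mul f := Prod.ext (inv_mul_cancel _) rfl
  mul_inv f := Prod.ext (mul_inv_cancel _) rfl

/-- The horizontal groupoid `G × H ⇉ pt`, with composition
`(x', γ') * (x, γ) = (x' x^{γ'⁻¹}, γ'γ)`. -/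
def horizontalStr : LieGroupoidStr (Mfd.prod X.G X.H) Mfd.pt.{u} where
  src _ := PUnit.unit
  tgt _ := PUnit.unit
  one _ := (1, 1)
  mul g f _ := (g.1 * X.act f.1 g.2⁻¹, g.2 * f.2)
  inv p := (X.act p.1⁻¹ p.2, p.2⁻¹)
  src_submersion := Mfd.isSurjSubmersion_pt _ (1, 1)
  tgt_submersion := Mfd.isSurjSubmersion_pt _ (1, 1)
  one_smooth := Mfd.smooth_const _
  inv_smooth := Mfd.Smooth.prodMk (N := X.G) (P := X.H)
    (X.smooth_act.comp ((Mfd.Smooth.inv X.smooth_fst).prodMk X.smooth_snd))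
    (Mfd.Smooth.inv X.smooth_snd)
  mul_smooth n p q hp hq h := Mfd.SmoothPlot.prodMk (N := X.G) (P := X.H)
    ((X.smooth_fst.comp_plot hp).mul (X.smooth_act.comp_plot
      ((X.smooth_fst.comp_plot hq).prodMk (X.smooth_snd.comp_plot hp).inv)))
    ((X.smooth_snd.comp_plot hp).mul (X.smooth_snd.comp_plot hq))
  src_one m := rfl
  tgt_one m := rfl
  src_mul g f h := rfl
  tgt_mul g f h := rfl
  mul_assoc k g f h h' := Prod.ext
    (by simp only [X.act_mul, X.act_act, mul_inv_rev, mul_assoc]) (mul_assoc _ _ _)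
  mul_one f := Prod.ext (by simp [X.one_act]) (mul_one _)
  one_mul f := Prod.ext (by simp [X.act_one]) (one_mul _)
  src_inv f := rfl
  tgt_inv f := rfl
  inv_mul f := Prod.ext (by simp [X.inv_act]) (inv_mul_cancel _)
  mul_inv f := Prod.ext (by simp [X.act_act, X.act_one]) (mul_inv_cancel _)

/-- The Lie 2-group `[G → H]`, that is, the Lie 2-groupoid `G × H ⇉ H ⇉ pt` of a crossed module. -/
def toLie2 : Lie2Groupoid.{u} where
  G₀ := Mfd.pt
  G₁ := X.H
  G₂ := Mfd.prod X.G X.H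
  h₁ := groupStr X.H
  v := X.verticalStr
  h₂ := X.horizontalStr
  src_l x := rfl
  src_u x := rfl
  tgt_l x := rfl
  tgt_u x := rfl
  l_one x := rfl
  u_one x := by
    change X.ρ 1 * 1 = 1
    simp
  l_mul y x h h' := rfl
  u_mul y x h h' := by
    change X.ρ (y.1 * X.act x.1 y.2⁻¹) * (y.2 * x.2) = X.ρ y.1 * y.2 * (X.ρ x.1 * x.2)
    rw [map_mul, X.ρ_act]
    group
  one_one x := rfl
  one_mul g f h h' := by
    change ((1, g * f) : X.G × X.H) = (1 * X.act 1 g⁻¹, g * f)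
    rw [X.one_act, mul_one]
  interchange y' y x' x hy hx h h' h'' k := by
    have hy' : y'.2 = X.ρ y.1 * y.2 := hy
    change ((y'.1 * y.1 * X.act (x'.1 * x.1) y.2⁻¹, y.2 * x.2) : X.G × X.H) =
      (y'.1 * X.act x'.1 y'.2⁻¹ * (y.1 * X.act x.1 y.2⁻¹), y.2 * x.2)
    refine Prod.ext ?_ rfl
    have e : X.act x'.1 y'.2⁻¹ = y.1 * X.act x'.1 y.2⁻¹ * y.1⁻¹ := by
      rw [hy', mul_inv_rev, ← X.act_act, ← map_inv, X.peiffer, inv_inv]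
    dsimp only
    rw [e, X.act_mul]
    group

/-- The product crossed module `G × G' → H × H'`. -/
def prod : CrossedModule.{u} where
  G := Mfd.prod X.G Y.G
  H := Mfd.prod X.H Y.H
  groupG := inferInstanceAs (Group (X.G × Y.G))
  groupH := inferInstanceAs (Group (X.H × Y.H))
  lieG := inferInstanceAs (LieGroup (X.G.I.prod Y.G.I) ∞ (X.G × Y.G))
  lieH := inferInstanceAs (LieGroup (X.H.I.prod Y.H.I) ∞ (X.H × Y.H))
  ρ := X.ρ.prodMap Y.ρ
  act x h := (X.act x.1 h.1, Y.act x.2 h.2)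
  smooth_ρ := X.smooth_ρ.pmap Y.smooth_ρ
  smooth_act := by
    have a1 : Mfd.Smooth (M := Mfd.prod (Mfd.prod X.G Y.G) (Mfd.prod X.H Y.H))
        (N := Mfd.prod X.G Y.G) Prod.fst := Mfd.smooth_fst
    have a2 : Mfd.Smooth (M := Mfd.prod (Mfd.prod X.G Y.G) (Mfd.prod X.H Y.H))
        (N := Mfd.prod X.H Y.H) Prod.snd := Mfd.smooth_snd
    exact Mfd.Smooth.prodMk (N := X.G) (P := Y.G)
      (X.smooth_act.comp (((Mfd.smooth_fst (M := X.G) (N := Y.G)).comp a1).prodMk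
        ((Mfd.smooth_fst (M := X.H) (N := Y.H)).comp a2)))
      (Y.smooth_act.comp (((Mfd.smooth_snd (M := X.G) (N := Y.G)).comp a1).prodMk
        ((Mfd.smooth_snd (M := X.H) (N := Y.H)).comp a2)))
  act_mul x y h := Prod.ext (X.act_mul _ _ _) (Y.act_mul _ _ _)
  act_one x := Prod.ext (X.act_one _) (Y.act_one _)
  act_act x h k := Prod.ext (X.act_act _ _ _) (Y.act_act _ _ _)
  ρ_act x h := Prod.ext (X.ρ_act _ _) (Y.ρ_act _ _)
  peiffer x y := Prod.ext (X.peiffer _ _) (Y.peiffer _ _)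

/-- The projection `[G × G' → H × H'] → [G → H]`. -/
def prodFst : Hom (X.prod Y).toLie2 X.toLie2 where
  f₀ x := x
  f₁ := Prod.fst
  f₂ p := (p.1.1, p.2.1)
  smooth₀ := Mfd.smooth_id
  smooth₁ := Mfd.smooth_fst (M := X.H) (N := Y.H)
  smooth₂ := (Mfd.smooth_fst (M := X.G) (N := Y.G)).pmap (Mfd.smooth_fst (M := X.H) (N := Y.H))
  functor_h₁ := ⟨fun _ => rfl, fun _ => rfl, fun _ => rfl, fun _ _ _ _ => rfl⟩
  functor_v := ⟨fun _ => rfl, fun _ => rfl, fun _ => rfl, fun _ _ _ _ => rfl⟩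
  functor_h₂ := ⟨fun _ => rfl, fun _ => rfl, fun _ => rfl, fun _ _ _ _ => rfl⟩

/-- The projection `[G × G' → H × H'] → [G' → H']`. -/
def prodSnd : Hom (X.prod Y).toLie2 Y.toLie2 where
  f₀ x := x
  f₁ := Prod.snd
  f₂ p := (p.1.2, p.2.2)
  smooth₀ := Mfd.smooth_id
  smooth₁ := Mfd.smooth_snd (M := X.H) (N := Y.H)
  smooth₂ := (Mfd.smooth_snd (M := X.G) (N := Y.G)).pmap (Mfd.smooth_snd (M := X.H) (N := Y.H))
  functor_h₁ := ⟨fun _ => rfl, fun _ => rfl, fun _ => rfl, fun _ _ _ _ => rfl⟩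
  functor_v := ⟨fun _ => rfl, fun _ => rfl, fun _ => rfl, fun _ _ _ _ => rfl⟩
  functor_h₂ := ⟨fun _ => rfl, fun _ => rfl, fun _ => rfl, fun _ _ _ _ => rfl⟩

variable {X Y}

/-- The morphism `(f, f') : Γ → [G × G' → H × H']` with components `f : Γ → [G → H]` and
`f' : Γ → [G' → H']`. -/
def pairing {Γ : Lie2Groupoid.{u}} (f : Hom Γ X.toLie2) (f' : Hom Γ Y.toLie2) :
    Hom Γ (X.prod Y).toLie2 where
  f₀ := f.f₀
  f₁ x := (f.f₁ x, f'.f₁ x)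
  f₂ x := (((f.f₂ x).1, (f'.f₂ x).1), ((f.f₂ x).2, (f'.f₂ x).2))
  smooth₀ := f.smooth₀
  smooth₁ := f.smooth₁.prodMk f'.smooth₁
  smooth₂ := Mfd.Smooth.prodMk (N := Mfd.prod X.G Y.G) (P := Mfd.prod X.H Y.H)
    ((X.smooth_fst.comp f.smooth₂).prodMk (Y.smooth_fst.comp f'.smooth₂))
    ((X.smooth_snd.comp f.smooth₂).prodMk (Y.smooth_snd.comp f'.smooth₂))
  functor_h₁ := {
    map_src a := rfl
    map_tgt a := rfl
    map_one m := Prod.ext (f.functor_h₁.map_one m) (f'.functor_h₁.map_one m)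
    map_mul g k h h' := Prod.ext (f.functor_h₁.map_mul g k h rfl) (f'.functor_h₁.map_mul g k h rfl) }
  functor_v := {
    map_src a := Prod.ext (f.functor_v.map_src a) (f'.functor_v.map_src a)
    map_tgt a := Prod.ext (f.functor_v.map_tgt a) (f'.functor_v.map_tgt a)
    map_one m := by
      rw [f.functor_v.map_one, f'.functor_v.map_one]
      rfl
    map_mul g k h h' := by
      rw [f.functor_v.map_mul g k h (congrArg Prod.fst h'),
        f'.functor_v.map_mul g k h (congrArg Prod.snd h')]
      rfl }
  functor_h₂ := {
    map_src a := rfl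
    map_tgt a := rfl
    map_one m := by
      rw [f.functor_h₂.map_one, f'.functor_h₂.map_one]
      rfl
    map_mul g k h h' := by
      rw [f.functor_h₂.map_mul g k h rfl, f'.functor_h₂.map_mul g k h rfl]
      rfl }

end CrossedModule

end

section

/-! ### The geometric nerve -/

/-- The `q`-simplices of the geometric nerve of a Lie 2-groupoid: objects `A_i`, arrows
`f_{ij} : A_i → A_j` for `i < j` and 2-arrows `α_{ijk} : f_{jk} f_{ij} ⇒ f_{ik}` for `i < j < k`, such
that all tetrahedra commute. -/
@[ext]
structure Nerve (Γ : Lie2Groupoid.{u}) (q : ℕ) : Type u where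
  /-- the vertices -/
  obj : Fin (q + 1) → Γ.G₀
  /-- the edges -/
  arr : ∀ i j : Fin (q + 1), i < j → Γ.G₁
  /-- the triangles -/
  cell : ∀ i j k : Fin (q + 1), i < j → j < k → Γ.G₂
  src_arr : ∀ i j hij, Γ.h₁.src (arr i j hij) = obj i
  tgt_arr : ∀ i j hij, Γ.h₁.tgt (arr i j hij) = obj j
  src_cell : ∀ i j k hij hjk (h : Γ.h₁.src (arr j k hjk) = Γ.h₁.tgt (arr i j hij)),
    Γ.v.src (cell i j k hij hjk) = Γ.h₁.mul (arr j k hjk) (arr i j hij) h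
  tgt_cell : ∀ i j k hij hjk, Γ.v.tgt (cell i j k hij hjk) = arr i k (lt_trans hij hjk)
  tetrahedron : ∀ (i j k m : Fin (q + 1)) (hij : i < j) (hjk : j < k) (hkm : k < m)
    (h₁ : Γ.h₂.src (Γ.v.one (arr k m hkm)) = Γ.h₂.tgt (cell i j k hij hjk))
    (h₂ : Γ.v.src (cell i k m (lt_trans hij hjk) hkm) =
      Γ.v.tgt (Γ.h₂.mul (Γ.v.one (arr k m hkm)) (cell i j k hij hjk) h₁))
    (h₃ : Γ.h₂.src (cell j k m hjk hkm) = Γ.h₂.tgt (Γ.v.one (arr i j hij)))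
    (h₄ : Γ.v.src (cell i j m hij (lt_trans hjk hkm)) =
      Γ.v.tgt (Γ.h₂.mul (cell j k m hjk hkm) (Γ.v.one (arr i j hij)) h₃)),
    Γ.v.mul (cell i k m (lt_trans hij hjk) hkm)
        (Γ.h₂.mul (Γ.v.one (arr k m hkm)) (cell i j k hij hjk) h₁) h₂ =
      Γ.v.mul (cell i j m hij (lt_trans hjk hkm))
        (Γ.h₂.mul (cell j k m hjk hkm) (Γ.v.one (arr i j hij)) h₃) h₄

namespace Nerve

variable {Γ Δ Λ : Lie2Groupoid.{u}} {q r s : ℕ}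

/-- The smooth structure of `N_q Γ`, a submanifold of a product of copies of `Γ₀`, `Γ₁` and `Γ₂`: the
plots are the maps all of whose components are smooth. -/
instance diffeology (Γ : Lie2Groupoid.{u}) (q : ℕ) : DiffeologicalSpace (Nerve Γ q) where
  plots n := {P | (∀ i, Mfd.SmoothPlot fun x => (P x).obj i) ∧
    (∀ i j hij, Mfd.SmoothPlot fun x => (P x).arr i j hij) ∧
    ∀ i j k hij hjk, Mfd.SmoothPlot fun x => (P x).cell i j k hij hjk}
  constant_plots x := ⟨fun i => (Mfd.diffeology _).constant_plots (x.obj i),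
    fun i j hij => (Mfd.diffeology _).constant_plots (x.arr i j hij),
    fun i j k hij hjk => (Mfd.diffeology _).constant_plots (x.cell i j k hij hjk)⟩
  plot_reparam hp hf := ⟨fun i => (Mfd.diffeology _).plot_reparam (hp.1 i) hf,
    fun i j hij => (Mfd.diffeology _).plot_reparam (hp.2.1 i j hij) hf,
    fun i j k hij hjk => (Mfd.diffeology _).plot_reparam (hp.2.2 i j k hij hjk) hf⟩
  locality {n P} h := by
    refine ⟨fun i => ?_, fun i j hij => ?_, fun i j k hij hjk => ?_⟩
    · refine (Mfd.diffeology Γ.G₀).locality fun x => ?_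
      obtain ⟨u, hu, hx, hP⟩ := h x
      exact ⟨u, hu, hx, fun hf hf' => (hP hf hf').1 i⟩
    · refine (Mfd.diffeology Γ.G₁).locality fun x => ?_
      obtain ⟨u, hu, hx, hP⟩ := h x
      exact ⟨u, hu, hx, fun hf hf' => (hP hf hf').2.1 i j hij⟩
    · refine (Mfd.diffeology Γ.G₂).locality fun x => ?_
      obtain ⟨u, hu, hx, hP⟩ := h x
      exact ⟨u, hu, hx, fun hf hf' => (hP hf hf').2.2 i j k hij hjk⟩

/-- The simplicial operator `N_q Γ → N_r Γ` of a strictly increasing map. -/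
def restrict (θ : Fin (r + 1) → Fin (q + 1)) (hθ : StrictMono θ) (x : Nerve Γ q) : Nerve Γ r where
  obj i := x.obj (θ i)
  arr i j h := x.arr (θ i) (θ j) (hθ h)
  cell i j k h h' := x.cell (θ i) (θ j) (θ k) (hθ h) (hθ h')
  src_arr _ _ _ := x.src_arr _ _ _
  tgt_arr _ _ _ := x.tgt_arr _ _ _
  src_cell _ _ _ _ _ _ := x.src_cell _ _ _ _ _ _
  tgt_cell _ _ _ _ _ := x.tgt_cell _ _ _ _ _
  tetrahedron _ _ _ _ _ _ _ _ _ _ _ := x.tetrahedron _ _ _ _ _ _ _ _ _ _ _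

theorem dSmooth_restrict (θ : Fin (r + 1) → Fin (q + 1)) (hθ : StrictMono θ) :
    DSmooth (restrict (Γ := Γ) θ hθ) := fun _ _ hP =>
  ⟨fun _ => hP.1 _, fun _ _ _ => hP.2.1 _ _ _, fun _ _ _ _ _ => hP.2.2 _ _ _ _ _⟩

/-- The map of nerves induced by a morphism. -/
def map (f : Hom Γ Δ) (x : Nerve Γ q) : Nerve Δ q where
  obj i := f.f₀ (x.obj i)
  arr i j h := f.f₁ (x.arr i j h)
  cell i j k h h' := f.f₂ (x.cell i j k h h')
  src_arr i j h := by rw [f.functor_h₁.map_src, x.src_arr]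
  tgt_arr i j h := by rw [f.functor_h₁.map_tgt, x.tgt_arr]
  src_cell i j k hij hjk h := by
    have e : Γ.h₁.src (x.arr j k hjk) = Γ.h₁.tgt (x.arr i j hij) := by rw [x.src_arr, x.tgt_arr]
    rw [f.functor_v.map_src, x.src_cell i j k hij hjk e, f.functor_h₁.map_mul _ _ e h]
  tgt_cell i j k hij hjk := by rw [f.functor_v.map_tgt, x.tgt_cell]
  tetrahedron i j k m hij hjk hkm h₁ h₂ h₃ h₄ := by
    have sc : ∀ i j k hij hjk, Γ.h₂.src (x.cell i j k hij hjk) = x.obj i := by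
      intro i j k hij hjk
      rw [← Γ.src_u, x.tgt_cell, x.src_arr]
    have tc : ∀ i j k hij hjk, Γ.h₂.tgt (x.cell i j k hij hjk) = x.obj k := by
      intro i j k hij hjk
      rw [← Γ.tgt_u, x.tgt_cell, x.tgt_arr]
    have so : ∀ i j hij, Γ.h₂.src (Γ.v.one (x.arr i j hij)) = x.obj i := by
      intro i j hij
      rw [← Γ.src_l, Γ.v.src_one, x.src_arr]
    have ton : ∀ i j hij, Γ.h₂.tgt (Γ.v.one (x.arr i j hij)) = x.obj j := by
      intro i j hij
      rw [← Γ.tgt_l, Γ.v.src_one, x.tgt_arr]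
    have sa : ∀ i j k (hij : i < j) (hjk : j < k),
        Γ.h₁.src (x.arr j k hjk) = Γ.h₁.tgt (x.arr i j hij) := by
      intro i j k hij hjk
      rw [x.src_arr, x.tgt_arr]
    have e₁ : Γ.h₂.src (Γ.v.one (x.arr k m hkm)) = Γ.h₂.tgt (x.cell i j k hij hjk) := by
      rw [so, tc]
    have e₃ : Γ.h₂.src (x.cell j k m hjk hkm) = Γ.h₂.tgt (Γ.v.one (x.arr i j hij)) := by
      rw [ton, sc]
    have e₂ : Γ.v.src (x.cell i k m (lt_trans hij hjk) hkm) =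
        Γ.v.tgt (Γ.h₂.mul (Γ.v.one (x.arr k m hkm)) (x.cell i j k hij hjk) e₁) := by
      rw [Γ.u_mul _ _ e₁ (by rw [Γ.src_u, Γ.tgt_u, e₁]), x.src_cell _ _ _ _ _ (sa _ _ _ _ _)]
      exact Γ.h₁.mul_congr (Γ.v.tgt_one _).symm (x.tgt_cell _ _ _ _ _).symm _ _
    have e₄ : Γ.v.src (x.cell i j m hij (lt_trans hjk hkm)) =
        Γ.v.tgt (Γ.h₂.mul (x.cell j k m hjk hkm) (Γ.v.one (x.arr i j hij)) e₃) := by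
      rw [Γ.u_mul _ _ e₃ (by rw [Γ.src_u, Γ.tgt_u, e₃]), x.src_cell _ _ _ _ _ (sa _ _ _ _ _)]
      exact Γ.h₁.mul_congr (x.tgt_cell _ _ _ _ _).symm (Γ.v.tgt_one _).symm _ _
    have h := congrArg f.f₂ (x.tetrahedron i j k m hij hjk hkm e₁ e₂ e₃ e₄)
    have k₁ : Δ.h₂.src (f.f₂ (Γ.v.one (x.arr k m hkm))) = Δ.h₂.tgt (f.f₂ (x.cell i j k hij hjk)) := by
      rw [f.functor_h₂.map_src, f.functor_h₂.map_tgt, e₁]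
    have k₃ : Δ.h₂.src (f.f₂ (x.cell j k m hjk hkm)) =
        Δ.h₂.tgt (f.f₂ (Γ.v.one (x.arr i j hij))) := by
      rw [f.functor_h₂.map_src, f.functor_h₂.map_tgt, e₃]
    have k₂ := congrArg f.f₁ e₂
    rw [← f.functor_v.map_src, ← f.functor_v.map_tgt] at k₂
    have k₄ := congrArg f.f₁ e₄
    rw [← f.functor_v.map_src, ← f.functor_v.map_tgt] at k₄
    rw [f.functor_v.map_mul _ _ e₂ k₂, f.functor_v.map_mul _ _ e₄ k₄] at h
    refine Eq.trans (Δ.v.mul_congr rfl ?_ _ _) (h.trans (Δ.v.mul_congr rfl ?_ _ _))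
    · rw [f.functor_h₂.map_mul _ _ e₁ k₁]
      exact Δ.h₂.mul_congr (f.functor_v.map_one _).symm rfl _ _
    · rw [f.functor_h₂.map_mul _ _ e₃ k₃]
      exact Δ.h₂.mul_congr rfl (f.functor_v.map_one _) _ _

theorem dSmooth_map (f : Hom Γ Δ) : DSmooth (map (q := q) f) := fun _ _ hP =>
  ⟨fun _ => f.smooth₀.comp_plot (hP.1 _), fun _ _ _ => f.smooth₁.comp_plot (hP.2.1 _ _ _),
    fun _ _ _ _ _ => f.smooth₂.comp_plot (hP.2.2 _ _ _ _ _)⟩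

/-- The increasing map `{0, …, q} → {0, …, q + 1}` which omits the value `i`. -/
def skip (q i : ℕ) (j : Fin (q + 1)) : Fin (q + 2) :=
  ⟨if j.1 < i then j.1 else j.1 + 1, by have := j.2; split <;> omega⟩

theorem skip_strictMono (q i : ℕ) : StrictMono (skip q i) := by
  intro j k h
  have h' : j.1 < k.1 := h
  simp only [skip, Fin.mk_lt_mk]
  split <;> split <;> omega

theorem skip_of_lt {q i : ℕ} {j : Fin (q + 1)} (h : j.1 < i) : (skip q i j).1 = j.1 := if_pos h

theorem skip_of_le {q i : ℕ} {j : Fin (q + 1)} (h : i ≤ j.1) : (skip q i j).1 = j.1 + 1 :=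
  if_neg (not_lt.2 h)

/-- The `i`-th face map `d_i : N_{q+1} Γ → N_q Γ`, which omits the vertex `i` (`0 ≤ i ≤ q + 1`). -/
def face (Γ : Lie2Groupoid.{u}) (q i : ℕ) : Nerve Γ (q + 1) → Nerve Γ q :=
  restrict (skip q i) (skip_strictMono q i)

theorem dSmooth_face (q i : ℕ) : DSmooth (face Γ q i) := dSmooth_restrict _ _

/-- The inclusion of the first `b + 1` vertices. -/
def frontMap {b c q : ℕ} (h : b + c = q) (j : Fin (b + 1)) : Fin (q + 1) :=
  ⟨j.1, by have := j.2; omega⟩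

/-- The inclusion of the last `c + 1` vertices. -/
def backMap {b c q : ℕ} (h : b + c = q) (j : Fin (c + 1)) : Fin (q + 1) :=
  ⟨b + j.1, by have := j.2; omega⟩

theorem frontMap_strictMono {b c q : ℕ} (h : b + c = q) : StrictMono (frontMap h) := by
  intro j k hjk
  exact hjk

theorem backMap_strictMono {b c q : ℕ} (h : b + c = q) : StrictMono (backMap h) := by
  intro j k hjk
  have h' : j.1 < k.1 := hjk
  simp only [backMap, Fin.mk_lt_mk]
  omega

/-- The face spanned by the first `b + 1` vertices. -/
def front {b c q : ℕ} (h : b + c = q) : Nerve Γ q → Nerve Γ b :=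
  restrict (frontMap h) (frontMap_strictMono h)

/-- The face spanned by the last `c + 1` vertices. -/
def back {b c q : ℕ} (h : b + c = q) : Nerve Γ q → Nerve Γ c :=
  restrict (backMap h) (backMap_strictMono h)

theorem dSmooth_front {b c q : ℕ} (h : b + c = q) : DSmooth (front (Γ := Γ) h) :=
  dSmooth_restrict _ _

theorem dSmooth_back {b c q : ℕ} (h : b + c = q) : DSmooth (back (Γ := Γ) h) :=
  dSmooth_restrict _ _

theorem restrict_restrict (θ : Fin (r + 1) → Fin (q + 1)) (hθ : StrictMono θ)
    (η : Fin (s + 1) → Fin (r + 1)) (hη : StrictMono η) (θ' : Fin (s + 1) → Fin (q + 1))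
    (hθ' : StrictMono θ') (h : ∀ j, (θ (η j)).1 = (θ' j).1) :
    restrict (Γ := Γ) η hη ∘ restrict θ hθ = restrict θ' hθ' := by
  have e : θ' = fun j => θ (η j) := funext fun j => Fin.ext (h j).symm
  subst e
  rfl

end Nerve

end

section

/-! ### Cohomology -/

variable {Γ Δ Λ : Lie2Groupoid.{u}}

/-- The operator `∂ = (-1)^p ∑ (-1)^i d_i^* : Ω^p(N_q Γ) → Ω^p(N_{q+1} Γ)`. -/
def simpDiff (Γ : Lie2Groupoid.{u}) (p q : ℕ) :
    Form p (Nerve Γ q) →ₗ[ℝ] Form p (Nerve Γ (q + 1)) :=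
  ((-1 : ℝ) ^ p) • ∑ i ∈ Finset.range (q + 2), ((-1 : ℝ) ^ i) •
    Form.pullback p (Nerve.face Γ q i) (Nerve.dSmooth_face _ _)

/-- The total space `⊕_{p,q} Ω^p(N_q Γ)` of the double complex. -/
def Tot (Γ : Lie2Groupoid.{u}) : Type u :=
  DirectSum (ℕ × ℕ) fun pq => Form pq.1 (Nerve Γ pq.2)

instance : AddCommGroup (Tot Γ) :=
  inferInstanceAs (AddCommGroup (DirectSum (ℕ × ℕ) fun pq => Form pq.1 (Nerve Γ pq.2)))

instance : Module ℝ (Tot Γ) :=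
  inferInstanceAs (Module ℝ (DirectSum (ℕ × ℕ) fun pq => Form pq.1 (Nerve Γ pq.2)))

/-- The inclusion of `Ω^p(N_q Γ)`. -/
def Tot.of (Γ : Lie2Groupoid.{u}) (p q : ℕ) : Form p (Nerve Γ q) →ₗ[ℝ] Tot Γ :=
  DirectSum.lof ℝ (ℕ × ℕ) (fun pq => Form pq.1 (Nerve Γ pq.2)) (p, q)

/-- Linear maps out of the total space. -/
def Tot.desc {V : Type*} [AddCommGroup V] [Module ℝ V]
    (φ : ∀ p q, Form p (Nerve Γ q) →ₗ[ℝ] V) : Tot Γ →ₗ[ℝ] V :=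
  DirectSum.toModule ℝ (ℕ × ℕ) V fun pq => φ pq.1 pq.2

@[simp] theorem Tot.desc_of {V : Type*} [AddCommGroup V] [Module ℝ V]
    (φ : ∀ p q, Form p (Nerve Γ q) →ₗ[ℝ] V) (p q : ℕ) (α : Form p (Nerve Γ q)) :
    Tot.desc φ (Tot.of Γ p q α) = φ p q α :=
  DirectSum.toModule_lof ℝ (M := fun pq : ℕ × ℕ => Form pq.1 (Nerve Γ pq.2)) (p, q) α

theorem Tot.hom_ext {V : Type*} [AddCommGroup V] [Module ℝ V] {f g : Tot Γ →ₗ[ℝ] V}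
    (h : ∀ p q α, f (Tot.of Γ p q α) = g (Tot.of Γ p q α)) : f = g :=
  DirectSum.linearMap_ext ℝ fun pq => LinearMap.ext fun α => h pq.1 pq.2 α

/-- The total differential `d + ∂`. -/
def Tot.D (Γ : Lie2Groupoid.{u}) : Tot Γ →ₗ[ℝ] Tot Γ :=
  Tot.desc fun p q => Tot.of Γ (p + 1) q ∘ₗ Form.d p + Tot.of Γ p (q + 1) ∘ₗ simpDiff Γ p q

/-- The de Rham cohomology `H^•(Γ) = ⊕_n H^n(Γ)` of a Lie 2-groupoid. -/
def Cohomology (Γ : Lie2Groupoid.{u}) : Type u :=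
  (LinearMap.ker (Tot.D Γ)) ⧸ (LinearMap.range (Tot.D Γ)).submoduleOf (LinearMap.ker (Tot.D Γ))

instance : AddCommGroup (Cohomology Γ) := inferInstanceAs (AddCommGroup
  ((LinearMap.ker (Tot.D Γ)) ⧸ (LinearMap.range (Tot.D Γ)).submoduleOf (LinearMap.ker (Tot.D Γ))))

instance : Module ℝ (Cohomology Γ) := inferInstanceAs (Module ℝ
  ((LinearMap.ker (Tot.D Γ)) ⧸ (LinearMap.range (Tot.D Γ)).submoduleOf (LinearMap.ker (Tot.D Γ))))

/-- The map of total complexes induced by a morphism. -/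
def Tot.pullback (f : Hom Γ Δ) : Tot Δ →ₗ[ℝ] Tot Γ :=
  Tot.desc fun p q => Tot.of Γ p q ∘ₗ Form.pullback p (Nerve.map f) (Nerve.dSmooth_map f)

theorem Tot.D_pullback (f : Hom Γ Δ) (x : Tot Δ) :
    Tot.D Γ (Tot.pullback f x) = Tot.pullback f (Tot.D Δ x) := by
  suffices h : Tot.D Γ ∘ₗ Tot.pullback f = Tot.pullback f ∘ₗ Tot.D Δ from
    congrArg (fun L : Tot Δ →ₗ[ℝ] Tot Γ => L x) h
  refine Tot.hom_ext fun p q α => ?_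
  simp only [LinearMap.comp_apply, Tot.D, Tot.pullback, Tot.desc_of, LinearMap.add_apply, map_add]
  congr 2
  simp only [simpDiff, LinearMap.smul_apply, LinearMap.sum_apply, map_smul, map_sum]
  rfl

/-- The pullback in cohomology along a morphism. -/
def Hom.pullback (f : Hom Γ Δ) : Cohomology Δ →ₗ[ℝ] Cohomology Γ :=
  Submodule.mapQ _ _
    ((Tot.pullback f).restrict (p := LinearMap.ker (Tot.D Δ)) (q := LinearMap.ker (Tot.D Γ))
      fun x hx => by
        rw [LinearMap.mem_ker] at hx ⊢
        rw [Tot.D_pullback, hx, map_zero])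
    (by
      rintro ⟨x, hx⟩ ⟨y, hy⟩
      exact ⟨Tot.pullback f y, (Tot.D_pullback f y).trans (congrArg (Tot.pullback f) hy)⟩)

open Classical in
/-- The inverse of a bijective linear map (by convention zero if the map is not bijective). -/
def linearInverse {V W : Type*} [AddCommGroup V] [Module ℝ V] [AddCommGroup W] [Module ℝ W]
    (f : V →ₗ[ℝ] W) : W →ₗ[ℝ] V :=
  if h : Function.Bijective f then ((LinearEquiv.ofBijective f h).symm : W →ₗ[ℝ] V) else 0

/-- The pullback in cohomology along a generalized morphism: the composition of the maps `f^*` and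
of the inverses of the maps `φ^*`, where `φ` is a Morita morphism. -/
def GenMor.pullback : ∀ {Γ Δ : Lie2Groupoid.{u}}, GenMor Γ Δ → (Cohomology Δ →ₗ[ℝ] Cohomology Γ)
  | _, _, .refl _ => LinearMap.id
  | _, _, .fwd f F => f.pullback ∘ₗ GenMor.pullback F
  | _, _, .bwd φ _ F => linearInverse φ.pullback ∘ₗ GenMor.pullback F

/-! ### Cup and cross products -/

/-- The cup product `Ω^a(N_b Γ) × Ω^{a'}(N_{b'} Γ) → Ω^{a+a'}(N_{b+b'} Γ)`, that is
`(-1)^{b a'} ` times the exterior product of the pullbacks to the front `b`-face and the back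
`b'`-face. -/
def cupAt {a a' p b b' q : ℕ} (h : a + a' = p) (h' : b + b' = q) :
    Form a (Nerve Γ b) →ₗ[ℝ] Form a' (Nerve Γ b') →ₗ[ℝ] Form p (Nerve Γ q) :=
  ((-1 : ℝ) ^ (b * a')) • (Form.wedge h).compl₁₂
    (Form.pullback a (Nerve.front h') (Nerve.dSmooth_front _))
    (Form.pullback a' (Nerve.back h') (Nerve.dSmooth_back _))

/-- The cup product on the total complex. -/
def Tot.cup (Γ : Lie2Groupoid.{u}) : Tot Γ →ₗ[ℝ] Tot Γ →ₗ[ℝ] Tot Γ :=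
  Tot.desc fun a b => LinearMap.flip <| Tot.desc fun a' b' => LinearMap.flip <|
    (cupAt (Γ := Γ) (rfl : a + a' = a + a') (rfl : b + b' = b + b')).compr₂
      (Tot.of Γ (a + a') (b + b'))

theorem Tot.cup_of {a a' p b b' q : ℕ} (h : a + a' = p) (h' : b + b' = q)
    (α : Form a (Nerve Γ b)) (β : Form a' (Nerve Γ b')) :
    Tot.cup Γ (Tot.of Γ a b α) (Tot.of Γ a' b' β) = Tot.of Γ p q (cupAt h h' α β) := by
  subst h h'
  simp [Tot.cup]

theorem cupAt_apply {a a' p b b' q : ℕ} (h : a + a' = p) (h' : b + b' = q)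
    (α : Form a (Nerve Γ b)) (β : Form a' (Nerve Γ b')) :
    cupAt h h' α β = ((-1 : ℝ) ^ (b * a')) • Form.wedge h
      (Form.pullback a (Nerve.front h') (Nerve.dSmooth_front _) α)
      (Form.pullback a' (Nerve.back h') (Nerve.dSmooth_back _) β) := rfl

theorem d_cupAt {a a' p b b' q : ℕ} (h : a + a' = p) (h₁ : (a + 1) + a' = p + 1)
    (h₂ : a + (a' + 1) = p + 1) (h' : b + b' = q)
    (α : Form a (Nerve Γ b)) (β : Form a' (Nerve Γ b')) :
    Form.d p (cupAt h h' α β) = cupAt h₁ h' (Form.d a α) β +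
      ((-1 : ℝ) ^ (a + b)) • cupAt h₂ h' α (Form.d a' β) := by
  simp only [cupAt_apply, map_smul, Form.d_wedge h h₁ h₂, smul_add, smul_smul]
  have e : ((-1 : ℝ) ^ (b * a')) * (-1) ^ a = (-1) ^ (a + b) * (-1) ^ (b * (a' + 1)) := by
    have := neg_one_pow_mul_self' b
    rw [mul_add, mul_one, pow_add, pow_add]
    linear_combination (-((-1 : ℝ) ^ (b * a')) * (-1) ^ a) * this
  rw [e]
  rfl

theorem alternating_split (b c : ℕ) {V : Type*} [AddCommGroup V] [Module ℝ V] (X Y Z : ℕ → V)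
    (hX : ∀ i, i ≤ b → Z i = X i) (hY : ∀ j, Z (b + 1 + j) = Y (j + 1)) (h : X (b + 1) = Y 0) :
    ∑ i ∈ Finset.range (b + c + 2), ((-1 : ℝ) ^ i) • Z i =
      ∑ i ∈ Finset.range (b + 2), ((-1 : ℝ) ^ i) • X i +
        ((-1 : ℝ) ^ b) • ∑ j ∈ Finset.range (c + 2), ((-1 : ℝ) ^ j) • Y j := by
  have e : b + c + 2 = (b + 1) + (c + 1) := by ring
  rw [e, Finset.sum_range_add, Finset.sum_range_succ _ (b + 1), Finset.sum_range_succ' _ (c + 1), h,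
    smul_add, Finset.smul_sum]
  have e1 : ∑ i ∈ Finset.range (b + 1), ((-1 : ℝ) ^ i) • Z i =
      ∑ i ∈ Finset.range (b + 1), ((-1 : ℝ) ^ i) • X i :=
    Finset.sum_congr rfl fun i hi => by rw [hX i (Nat.lt_succ_iff.1 (Finset.mem_range.1 hi))]
  have e2 : ∑ j ∈ Finset.range (c + 1), ((-1 : ℝ) ^ (b + 1 + j)) • Z (b + 1 + j) =
      ∑ j ∈ Finset.range (c + 1), ((-1 : ℝ) ^ b) • ((-1 : ℝ) ^ (j + 1)) • Y (j + 1) :=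
    Finset.sum_congr rfl fun j _ => by
      rw [hY, smul_smul]
      congr 1
      ring
  rw [e1, e2, pow_zero, one_smul, pow_succ]
  module

section FaceIdentities

variable {b b' q : ℕ} (h' : b + b' = q) (h₁ : (b + 1) + b' = q + 1) (h₂ : b + (b' + 1) = q + 1)

theorem front_face {i : ℕ} (hi : i ≤ b) : Nerve.front (Γ := Γ) h' ∘ Nerve.face Γ q i =
    Nerve.face Γ b i ∘ Nerve.front h₁ := by
  refine (Nerve.restrict_restrict _ _ _ _ _
    ((Nerve.frontMap_strictMono h₁).comp (Nerve.skip_strictMono b i)) fun j => ?_).trans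
    (Nerve.restrict_restrict _ _ _ _ _ _ fun j => ?_).symm
  · rfl
  · rfl

theorem back_face {i : ℕ} (hi : i ≤ b) : Nerve.back (Γ := Γ) h' ∘ Nerve.face Γ q i =
    Nerve.back h₁ := by
  refine Nerve.restrict_restrict _ _ _ _ _ _ fun j => ?_
  refine (Nerve.skip_of_le ?_).trans ?_
  · change i ≤ b + j.1
    omega
  · change b + j.1 + 1 = b + 1 + j.1
    omega

theorem front_face' (i : ℕ) : Nerve.front (Γ := Γ) h' ∘ Nerve.face Γ q (b + 1 + i) =
    Nerve.front h₂ := by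
  refine Nerve.restrict_restrict _ _ _ _ _ _ fun j => ?_
  refine (Nerve.skip_of_lt ?_).trans rfl
  have := j.2
  change j.1 < b + 1 + i
  omega

theorem back_face' (i : ℕ) : Nerve.back (Γ := Γ) h' ∘ Nerve.face Γ q (b + 1 + i) =
    Nerve.face Γ b' (i + 1) ∘ Nerve.back h₂ := by
  refine (Nerve.restrict_restrict _ _ _ _ _
    ((Nerve.backMap_strictMono h₂).comp (Nerve.skip_strictMono b' (i + 1))) fun j => ?_).trans
    (Nerve.restrict_restrict _ _ _ _ _ _ fun j => ?_).symm
  swap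
  · rfl
  change _ = b + (Nerve.skip b' (i + 1) j).1
  rcases lt_or_ge j.1 (i + 1) with hj | hj
  · rw [Nerve.skip_of_lt hj]
    refine (Nerve.skip_of_lt ?_).trans rfl
    change b + j.1 < b + 1 + i
    omega
  · rw [Nerve.skip_of_le hj]
    refine (Nerve.skip_of_le ?_).trans rfl
    change b + 1 + i ≤ b + j.1
    omega

theorem face_front : Nerve.face Γ b (b + 1) ∘ Nerve.front h₁ = Nerve.front h₂ := by
  refine Nerve.restrict_restrict _ _ _ _ _ _ fun j => ?_
  exact Nerve.skip_of_lt j.2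

theorem face_back : Nerve.face Γ b' 0 ∘ Nerve.back h₂ = Nerve.back h₁ := by
  refine Nerve.restrict_restrict _ _ _ _ _ _ fun j => ?_
  change b + (Nerve.skip b' 0 j).1 = b + 1 + j.1
  rw [Nerve.skip_of_le (Nat.zero_le _)]
  omega

end FaceIdentities

/-- The pullback along a composition. -/
theorem pullback_pullback {r s t k : ℕ} (f : Nerve Γ s → Nerve Γ t) (hf : DSmooth f)
    (g : Nerve Γ r → Nerve Γ s) (hg : DSmooth g) (α : Form k (Nerve Γ t)) :
    Form.pullback k g hg (Form.pullback k f hf α) = Form.pullback k (f ∘ g) (hf.comp hg) α := rfl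

theorem simpDiff_cupAt {a a' p b b' q : ℕ} (h : a + a' = p) (h' : b + b' = q)
    (h₁ : (b + 1) + b' = q + 1) (h₂ : b + (b' + 1) = q + 1)
    (α : Form a (Nerve Γ b)) (β : Form a' (Nerve Γ b')) :
    simpDiff Γ p q (cupAt h h' α β) = cupAt h h₁ (simpDiff Γ a b α) β +
      ((-1 : ℝ) ^ (a + b)) • cupAt h h₂ α (simpDiff Γ a' b' β) := by
  let X : ℕ → Form p (Nerve Γ (q + 1)) := fun i => Form.wedge h
    (Form.pullback a (Nerve.front h₁) (Nerve.dSmooth_front _)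
      (Form.pullback a (Nerve.face Γ b i) (Nerve.dSmooth_face _ _) α))
    (Form.pullback a' (Nerve.back h₁) (Nerve.dSmooth_back _) β)
  let Y : ℕ → Form p (Nerve Γ (q + 1)) := fun j => Form.wedge h
    (Form.pullback a (Nerve.front h₂) (Nerve.dSmooth_front _) α)
    (Form.pullback a' (Nerve.back h₂) (Nerve.dSmooth_back _)
      (Form.pullback a' (Nerve.face Γ b' j) (Nerve.dSmooth_face _ _) β))
  let Z : ℕ → Form p (Nerve Γ (q + 1)) := fun i =>
    Form.pullback p (Nerve.face Γ q i) (Nerve.dSmooth_face _ _) (Form.wedge h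
      (Form.pullback a (Nerve.front h') (Nerve.dSmooth_front _) α)
      (Form.pullback a' (Nerve.back h') (Nerve.dSmooth_back _) β))
  have hX : ∀ i, i ≤ b → Z i = X i := by
    intro i hi
    simp only [Z, X]
    rw [Form.pullback_wedge, pullback_pullback, pullback_pullback, pullback_pullback,
      Form.pullback_congr _ _ (front_face h' h₁ hi), Form.pullback_congr _ _ (back_face h' h₁ hi)]
  have hY : ∀ j, Z (b + 1 + j) = Y (j + 1) := by
    intro i
    simp only [Z, Y]
    rw [Form.pullback_wedge, pullback_pullback, pullback_pullback, pullback_pullback,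
      Form.pullback_congr _ _ (front_face' h' h₂ i), Form.pullback_congr _ _ (back_face' h' h₂ i)]
  have hXY : X (b + 1) = Y 0 := by
    simp only [X, Y]
    rw [pullback_pullback, pullback_pullback, Form.pullback_congr _ _ (face_front h₁ h₂),
      Form.pullback_congr _ _ (face_back h₁ h₂)]
  have key := alternating_split b b' X Y Z hX hY hXY
  have eL : simpDiff Γ p q (cupAt h h' α β) = ((-1 : ℝ) ^ p) • ((-1 : ℝ) ^ (b * a')) •
      ∑ i ∈ Finset.range (b + b' + 2), ((-1 : ℝ) ^ i) • Z i := by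
    subst h'
    rw [cupAt_apply, map_smul, simpDiff, LinearMap.smul_apply, LinearMap.sum_apply, smul_comm]
    rfl
  have eX : cupAt h h₁ (simpDiff Γ a b α) β = ((-1 : ℝ) ^ ((b + 1) * a')) • ((-1 : ℝ) ^ a) •
      ∑ i ∈ Finset.range (b + 2), ((-1 : ℝ) ^ i) • X i := by
    rw [cupAt_apply, simpDiff, LinearMap.smul_apply, LinearMap.sum_apply]
    simp only [LinearMap.smul_apply, map_smul, map_sum, LinearMap.sum_apply]
    rfl
  have eY : cupAt h h₂ α (simpDiff Γ a' b' β) = ((-1 : ℝ) ^ (b * a')) • ((-1 : ℝ) ^ a') •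
      ∑ i ∈ Finset.range (b' + 2), ((-1 : ℝ) ^ i) • Y i := by
    rw [cupAt_apply, simpDiff, LinearMap.smul_apply, LinearMap.sum_apply]
    simp only [LinearMap.smul_apply, map_smul, map_sum]
    rfl
  have hp : (-1 : ℝ) ^ p = (-1) ^ a * (-1) ^ a' := by rw [← h, pow_add]
  rw [eL, eX, eY, key, hp]
  simp only [smul_add, smul_smul]
  congr 2 <;> ring

/-- The sign operator `(-1)^{p+q}` on `Ω^p(N_q Γ)`. -/
def Tot.sgn (Γ : Lie2Groupoid.{u}) : Tot Γ →ₗ[ℝ] Tot Γ :=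
  Tot.desc fun p q => ((-1 : ℝ) ^ (p + q)) • Tot.of Γ p q

theorem Tot.sgn_sgn (x : Tot Γ) : Tot.sgn Γ (Tot.sgn Γ x) = x := by
  suffices h : Tot.sgn Γ ∘ₗ Tot.sgn Γ = LinearMap.id from
    congrArg (fun L : Tot Γ →ₗ[ℝ] Tot Γ => L x) h
  refine Tot.hom_ext fun p q α => ?_
  simp only [LinearMap.comp_apply, Tot.sgn, Tot.desc_of, LinearMap.smul_apply, map_smul, smul_smul,
    neg_one_pow_mul_self', one_smul, LinearMap.id_apply]

theorem Tot.D_sgn (x : Tot Γ) : Tot.D Γ (Tot.sgn Γ x) = -Tot.sgn Γ (Tot.D Γ x) := by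
  suffices h : Tot.D Γ ∘ₗ Tot.sgn Γ = -(Tot.sgn Γ ∘ₗ Tot.D Γ) from
    congrArg (fun L : Tot Γ →ₗ[ℝ] Tot Γ => L x) h
  refine Tot.hom_ext fun p q α => ?_
  simp only [LinearMap.comp_apply, Tot.sgn, Tot.D, Tot.desc_of, LinearMap.smul_apply, map_smul,
    LinearMap.neg_apply, LinearMap.add_apply, map_add]
  have e1 : (-1 : ℝ) ^ (p + 1 + q) = -(-1) ^ (p + q) := by ring
  have e2 : (-1 : ℝ) ^ (p + (q + 1)) = -(-1) ^ (p + q) := by ring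
  rw [e1, e2]
  module

theorem Tot.D_cup (x y : Tot Γ) : Tot.D Γ (Tot.cup Γ x y) =
    Tot.cup Γ (Tot.D Γ x) y + Tot.cup Γ (Tot.sgn Γ x) (Tot.D Γ y) := by
  suffices h : (Tot.cup Γ).compr₂ (Tot.D Γ) = (Tot.cup Γ).comp (Tot.D Γ) +
      (Tot.cup Γ).compl₁₂ (Tot.sgn Γ) (Tot.D Γ) from
    congrArg (fun L : Tot Γ →ₗ[ℝ] Tot Γ →ₗ[ℝ] Tot Γ => L x y) h
  refine Tot.hom_ext fun a b α => Tot.hom_ext fun a' b' β => ?_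
  have h₁ : (a + 1) + a' = a + a' + 1 := by ring
  have h₂ : a + (a' + 1) = a + a' + 1 := by ring
  have k₁ : (b + 1) + b' = b + b' + 1 := by ring
  have k₂ : b + (b' + 1) = b + b' + 1 := by ring
  simp only [LinearMap.compr₂_apply, LinearMap.comp_apply, LinearMap.add_apply,
    LinearMap.compl₁₂_apply, Tot.sgn, Tot.D, Tot.desc_of, map_add, LinearMap.smul_apply, map_smul]
  rw [Tot.cup_of rfl rfl, Tot.cup_of h₁ rfl, Tot.cup_of h₂ rfl, Tot.cup_of rfl k₁,
    Tot.cup_of rfl k₂, Tot.desc_of]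
  simp only [LinearMap.comp_apply, LinearMap.add_apply]
  rw [d_cupAt rfl h₁ h₂ rfl, simpDiff_cupAt rfl rfl k₁ k₂]
  simp only [map_add, map_smul]
  module

theorem Tot.cup_cocycle {x y : Tot Γ} (hx : Tot.D Γ x = 0) (hy : Tot.D Γ y = 0) :
    Tot.D Γ (Tot.cup Γ x y) = 0 := by
  rw [Tot.D_cup, hx, hy, map_zero, map_zero, LinearMap.zero_apply, add_zero]

/-- The class of the cup product of two cocycles. -/
def cupCocycle (Γ : Lie2Groupoid.{u}) : LinearMap.ker (Tot.D Γ) →ₗ[ℝ]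
    LinearMap.ker (Tot.D Γ) →ₗ[ℝ] Cohomology Γ :=
  LinearMap.mk₂ ℝ (fun x y => Submodule.Quotient.mk
      ⟨Tot.cup Γ x.1 y.1, LinearMap.mem_ker.2 (Tot.cup_cocycle x.2 y.2)⟩)
    (fun x x' y => congrArg Submodule.Quotient.mk (Subtype.ext (LinearMap.map_add₂ _ _ _ _)))
    (fun c x y => congrArg Submodule.Quotient.mk (Subtype.ext (LinearMap.map_smul₂ _ _ _ _)))
    (fun x y y' => congrArg Submodule.Quotient.mk (Subtype.ext (map_add _ _ _)))
    (fun c x y => congrArg Submodule.Quotient.mk (Subtype.ext (map_smul _ _ _)))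

/-- The cup product `H^•(Γ) × H^•(Γ) → H^•(Γ)`. -/
def cup (Γ : Lie2Groupoid.{u}) : Cohomology Γ →ₗ[ℝ] Cohomology Γ →ₗ[ℝ] Cohomology Γ :=
  Submodule.liftQ _ (LinearMap.flip <| Submodule.liftQ _ (cupCocycle Γ).flip (by
    rintro ⟨y, hy⟩ ⟨z, hz⟩
    rw [LinearMap.mem_ker]
    refine LinearMap.ext fun x => ?_
    refine (Submodule.Quotient.mk_eq_zero _).2 ⟨Tot.cup Γ (Tot.sgn Γ x.1) z, ?_⟩
    have hx : Tot.D Γ x.1 = 0 := x.2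
    have hz' : Tot.D Γ z = y := hz
    rw [Tot.D_cup, Tot.D_sgn, hx, Tot.sgn_sgn, map_zero, neg_zero, map_zero, LinearMap.zero_apply,
      zero_add, hz']
    rfl)) (by
    rintro ⟨x, hx⟩ ⟨z, hz⟩
    rw [LinearMap.mem_ker]
    refine LinearMap.ext fun y => ?_
    induction y using Submodule.Quotient.induction_on with
    | _ y =>
    refine (Submodule.Quotient.mk_eq_zero _).2 ⟨Tot.cup Γ z y.1, ?_⟩
    have hy : Tot.D Γ y.1 = 0 := y.2
    have hz' : Tot.D Γ z = x := hz
    rw [Tot.D_cup, hy, map_zero, add_zero, hz']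
    rfl)

/-- The cross product `H^•(Γ) ⊗ H^•(Γ') → H^•(Λ)`, `a ⊗ b ↦ p^* a ∪ p'^* b`, for a Lie 2-groupoid `Λ`
with projections `p : Λ → Γ` and `p' : Λ → Γ'` which make it a product of `Γ` and `Γ'`. -/
def cross {Γ Γ' Λ : Lie2Groupoid.{u}} (p : Hom Λ Γ) (p' : Hom Λ Γ') :
    Cohomology Γ ⊗[ℝ] Cohomology Γ' →ₗ[ℝ] Cohomology Λ :=
  TensorProduct.lift ((cup Λ).compl₁₂ p.pullback p'.pullback)

/-! ### Principal 2-group bundles and their characteristic maps -/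

/-- Principal `[G → H]`-bundles over a Lie 2-groupoid `Γ`: generalized morphisms `Γ → [G → H]`. -/
abbrev PrincipalBundle (Γ : Lie2Groupoid.{u}) (X : CrossedModule.{u}) : Type (u + 1) :=
  GenMor Γ X.toLie2

/-- The characteristic homomorphism `H^•([G → H]) → H^•(Γ)` of a principal `[G → H]`-bundle. -/
def PrincipalBundle.charMap {X : CrossedModule.{u}} (B : PrincipalBundle Γ X) :
    Cohomology X.toLie2 →ₗ[ℝ] Cohomology Γ := GenMor.pullback B

/-- The pullback `F^*(B) = B ∘ F` of a principal bundle along a generalized morphism. -/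
def PrincipalBundle.pullback {X : CrossedModule.{u}} (F : GenMor Γ Δ) (B : PrincipalBundle Δ X) :
    PrincipalBundle Γ X := GenMor.comp B F

/-- The Whitney sum of the bundles `Γ ← E → [G → H]` and `Γ ← E' → [G' → H']`. It is the generalized
morphism `Γ ← E ×_Γ E' → [G × G' → H × H']`. -/
def whitneySum {X X' : CrossedModule.{u}} {E E' : Lie2Groupoid.{u}} (φ : Hom E Γ) (hφ : φ.IsMorita)
    (f : Hom E X.toLie2) (φ' : Hom E' Γ) (hφ' : φ'.IsMorita) (f' : Hom E' X'.toLie2) :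
    PrincipalBundle Γ (X.prod X') :=
  GenMor.span (fibreProduct.toBase φ hφ φ') (fibreProduct.toBase_morita φ hφ φ' hφ')
    (CrossedModule.pairing (f.comp (fibreProduct.fst φ hφ φ')) (f'.comp (fibreProduct.snd φ hφ φ')))

end

end

end TwoGroupBundle

open TwoGroupBundle

namespace TwoGroupBundle

set_option linter.unusedVariables false

noncomputable section

open Diffeology Filter Topology


/-! Everything rests on one construction for a Morita morphism φ : Γ → Δ: a left inverse of φ^* on
cochains, obtained by averaging over lifts of simplices from Δ to Γ. Lifting a simplex takes two
kinds of choices. Each vertex is lifted by a local section of Γ₀ → Δ₀, then each edge by a local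
section of Γ₁ → Δ₁[Γ₀]; both maps are surjective submersions. The triangles involve no choice, since
Γ₂ is a pullback of Δ₂, and the tetrahedra commute for the same reason (`Nerve.lift`). The sections
are smooth only locally, so partitions of unity on Δ₀ and on Δ₁[Γ₀] serve as probability weights,
with independent choices for all vertices and then for all edges. A form α on N_m Γ is sent to the
mean value A α of its pullbacks along all lifts (`Filler.transfer`).

Because the choices are independent and have total mass one, those outside a face are summed out
(`average_comp_injective`). Hence A commutes with faces, and so with ∂. Moreover A φ^* = 1, as every
lift lies over the given simplex. Conversely φ^* A is homotopic to 1 with respect to ∂: simplices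
whose first vertices are those of z and whose later vertices are random lifts interpolate between z
and a random lift of φ(z), and the prisms between consecutive stages telescope
(`prism_boundary_succ`).

The weights are not constant, so A need not commute with the de Rham differential d. A filtration by
simplicial degree repairs this. The prism operator, corrected to an operator K with K φ^* = 0,
satisfies DK + KD = 1 - φ^* A + N, where N = dK + Kd lowers the simplicial degree. Elements of the
total complex have finitely many components, so an induction (`exists_sub_mem_range`) shows that a
cochain x with Dx in the image of φ^* lies in that image up to a coboundary. Together with the
injectivity of φ^* on cochains this gives both halves of `Hom.IsMorita.bijective_pullback`.

The remaining claims are formal. Pullback along a zigzag is defined arrow by arrow, so naturality is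
compatibility with concatenation. For the Whitney sum, both sides are compared after pullback to E
×_Γ E', which is Morita over Γ. Since pullbacks are multiplicative, both become the cup product of
the pullbacks of a and b along the projections followed by f and f' (`charMap_whitneySum`). -/

/-! ### Partially smooth maps and germs of forms -/

section Germs

variable {X Y Z : Type u} [DiffeologicalSpace X] [DiffeologicalSpace Y] [DiffeologicalSpace Z]
  {k n p : ℕ}

/-- The map `ℓ : ℝⁿ → Y` is smooth on the subset `s`. -/
def PlotOn (s : Set (Euc n)) (ℓ : Euc n → Y) : Prop :=
  ∀ (k : ℕ) (f : Euc k → Euc n), ContDiff ℝ ∞ f → (∀ z, f z ∈ s) → IsPlot (ℓ ∘ f)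

/-- The map `ℓ : ℝⁿ → Y` is smooth near `x`. -/
def PlotNear (ℓ : Euc n → Y) (x : Euc n) : Prop := ∀ᶠ s in (𝓝 x).smallSets, PlotOn s ℓ

theorem PlotOn.mono {s t : Set (Euc n)} {ℓ : Euc n → Y} (h : PlotOn t ℓ) (hst : s ⊆ t) :
    PlotOn s ℓ := fun k f hf hs => h k f hf fun z => hst (hs z)

theorem PlotOn.plotNear {s : Set (Euc n)} {ℓ : Euc n → Y} (h : PlotOn s ℓ) {x : Euc n}
    (hs : s ∈ 𝓝 x) : PlotNear ℓ x :=
  eventually_smallSets.2 ⟨s, hs, fun _ ht => h.mono ht⟩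

theorem PlotNear.exists {ℓ : Euc n → Y} {x : Euc n} (h : PlotNear ℓ x) :
    ∃ s, IsOpen s ∧ x ∈ s ∧ PlotOn s ℓ := by
  obtain ⟨s, hs, h⟩ := eventually_smallSets.1 h
  obtain ⟨t, hts, ht, hx⟩ := mem_nhds_iff.1 hs
  exact ⟨t, ht, hx, h t hts⟩

theorem plotNear_of_isPlot {ℓ : Euc n → Y} (h : IsPlot ℓ) (x : Euc n) : PlotNear ℓ x :=
  PlotOn.plotNear (s := Set.univ) (fun _ _ hf _ => isPlot_reparam h hf) univ_mem

/-- Forms are evaluated on globally defined plots only. Precomposition with a cut-off, a smooth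
self-map of ℝⁿ with values in the good neighbourhood, yields a global plot with the same germ at
`x`. -/
theorem PlotNear.exists_shrink {ℓ : Euc n → Y} {x : Euc n} (h : PlotNear ℓ x) :
    ∃ f : Euc n → Euc n, ContDiff ℝ ∞ f ∧ (∀ᶠ y in 𝓝 x, f y = y) ∧ IsPlot (ℓ ∘ f) := by
  obtain ⟨s, hs, hx, h⟩ := h.exists
  obtain ⟨f, hf, hfs, hfx⟩ := Mfd.exists_shrink x hs hx
  exact ⟨f, hf, hfx, h n f hf hfs⟩

open Classical in
/-- The value at `x` of the pullback of a form along a map which is smooth near `x`. -/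
def Form.germ (α : Form p Y) (ℓ : Euc n → Y) (x : Euc n) : Euc n [⋀^Fin p]→L[ℝ] ℝ :=
  -- By `Form.germ_eq` the value depends only on the germ of `ℓ`, so the chosen cut-off is
  -- immaterial. In the averages below the default value 0 only occurs with weight zero.
  if h : PlotNear ℓ x then α.1 n ⟨ℓ ∘ h.exists_shrink.choose, h.exists_shrink.choose_spec.2.2⟩ x
  else 0

/-- A map which is the identity near `x` has the identity as derivative at `x`, so the compatibility
of a form with reparametrization says nothing happens there. -/
theorem Form.apply_shrink (α : Form p Y) {ℓ : Euc n → Y} (hℓ : IsPlot ℓ) {f : Euc n → Euc n}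
    (hf : ContDiff ℝ ∞ f) {x : Euc n} (hx : ∀ᶠ y in 𝓝 x, f y = y) :
    α.1 n ⟨ℓ ∘ f, isPlot_reparam hℓ hf⟩ x = α.1 n ⟨ℓ, hℓ⟩ x := by
  rw [congrFun (α.2.2 n n ⟨ℓ, hℓ⟩ f hf) x]
  have h1 : fderiv ℝ f x = ContinuousLinearMap.id ℝ _ := by
    have : f =ᶠ[𝓝 x] id := hx
    rw [this.fderiv_eq, fderiv_id]
  rw [pull, h1, hx.self_of_nhds]
  rfl

/-- Locality of forms: a cut-off with values in the open set where the two plots agree makes them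
equal, without changing either value at `x`. -/
theorem Form.apply_congr (α : Form p Y) {ℓ ℓ' : Euc n → Y} (hℓ : IsPlot ℓ) (hℓ' : IsPlot ℓ')
    {x : Euc n} (h : ∀ᶠ y in 𝓝 x, ℓ y = ℓ' y) : α.1 n ⟨ℓ, hℓ⟩ x = α.1 n ⟨ℓ', hℓ'⟩ x := by
  obtain ⟨s, hss, hs, hx⟩ := mem_nhds_iff.1 h
  obtain ⟨f, hf, hfs, hfx⟩ := Mfd.exists_shrink x hs hx
  rw [← α.apply_shrink hℓ hf hfx, ← α.apply_shrink hℓ' hf hfx]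
  exact congrArg (fun P => α.1 n P x) (Subtype.ext (funext fun y => hss (hfs y)))

theorem Form.germ_eq (α : Form p Y) {ℓ ℓ' : Euc n → Y} (hℓ' : IsPlot ℓ') {x : Euc n}
    (h : ∀ᶠ y in 𝓝 x, ℓ y = ℓ' y) : α.germ ℓ x = α.1 n ⟨ℓ', hℓ'⟩ x := by
  obtain ⟨s, hss, hs, hx⟩ := mem_nhds_iff.1 h
  have hn : PlotNear ℓ x := PlotOn.plotNear (s := s) (fun k f hf hfs => by
    have : ℓ ∘ f = ℓ' ∘ f := funext fun y => hss (hfs y)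
    rw [this]
    exact isPlot_reparam hℓ' hf) (hs.mem_nhds hx)
  rw [Form.germ, dif_pos hn]
  refine α.apply_congr _ _ ?_
  filter_upwards [h, hn.exists_shrink.choose_spec.2.1] with y hy hy'
  rw [Function.comp_apply, hy', hy]

theorem Form.germ_contDiffAt (α : Form p Y) {ℓ : Euc n → Y} {x : Euc n} (h : PlotNear ℓ x) :
    ContDiffAt ℝ ∞ (α.germ ℓ) x := by
  obtain ⟨f, hf, hfx, hp⟩ := h.exists_shrink
  refine ((α.contDiff n ⟨_, hp⟩).contDiffAt (x := x)).congr_of_eventuallyEq ?_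
  -- For every `y` close to `x` the cut-off is the identity near `y` too, so the single plot `ℓ ∘ f`
  -- computes the germs at all these points.
  filter_upwards [hfx.eventually_nhds] with y hy
  refine α.germ_eq hp ?_
  filter_upwards [hy] with z hz
  rw [Function.comp_apply, hz]

theorem Form.germ_reparam (α : Form p Y) {ℓ : Euc n → Y} {g : Euc k → Euc n} (hg : ContDiff ℝ ∞ g)
    {z : Euc k} (h : PlotNear ℓ (g z)) :
    α.germ (ℓ ∘ g) z = (α.germ ℓ (g z)).compContinuousLinearMap (fderiv ℝ g z) := by
  obtain ⟨f, hf, hfx, hp⟩ := h.exists_shrink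
  have e1 : α.germ ℓ (g z) = α.1 n ⟨_, hp⟩ (g z) := by
    refine α.germ_eq hp ?_
    filter_upwards [hfx] with y hy
    rw [Function.comp_apply, hy]
  have e2 : α.germ (ℓ ∘ g) z = α.1 k ⟨(ℓ ∘ f) ∘ g, isPlot_reparam hp hg⟩ z := by
    refine α.germ_eq (isPlot_reparam hp hg) ?_
    filter_upwards [hg.continuous.continuousAt.eventually hfx] with y hy
    rw [Function.comp_apply, Function.comp_apply, Function.comp_apply, hy]
  rw [e1, e2, congrFun (α.2.2 k n ⟨_, hp⟩ g hg) z]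
  rfl

theorem Form.germ_pullback (α : Form p Y) {ℓ : Euc n → X} {x : Euc n} (h : PlotNear ℓ x)
    {K : X → Y} (hK : DSmooth K) : (Form.pullback p K hK α).germ ℓ x = α.germ (K ∘ ℓ) x := by
  obtain ⟨f, hf, hfx, hp⟩ := h.exists_shrink
  have e : ∀ᶠ y in 𝓝 x, ℓ y = (ℓ ∘ f) y := by
    filter_upwards [hfx] with y hy
    rw [Function.comp_apply, hy]
  rw [Form.germ_eq _ hp e, Form.germ_eq α (hK n _ hp) (ℓ := K ∘ ℓ)]
  · rfl
  · filter_upwards [e] with y hy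
    exact congrArg K hy

/-- The plot chosen in `Form.germ` depends on `ℓ` and `x` alone, not on the form, so linearity in
the form is immediate. -/
theorem Form.germ_add (α η : Form p Y) (ℓ : Euc n → Y) (x : Euc n) :
    (α + η).germ ℓ x = α.germ ℓ x + η.germ ℓ x := by
  unfold Form.germ
  split
  · rfl
  · simp

theorem Form.germ_smul (c : ℝ) (α : Form p Y) (ℓ : Euc n → Y) (x : Euc n) :
    (c • α).germ ℓ x = c • α.germ ℓ x := by
  unfold Form.germ
  split
  · rfl
  · simp

end Germs

/-! ### Maps into manifolds that are smooth near a point. -/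

namespace Mfd

variable {M N P : Mfd.{u}} {n : ℕ}

theorem _root_.TwoGroupBundle.PlotNear.contMDiffAt {ℓ : Euc n → M} {x : Euc n}
    (h : PlotNear ℓ x) : ContMDiffAt 𝓘(ℝ, Euc n) M.I ∞ ℓ x := by
  obtain ⟨f, hf, hfx, hp⟩ := h.exists_shrink
  have h1 : SmoothPlot (ℓ ∘ f) := hp
  refine (ContMDiff.contMDiffAt h1).congr_of_eventuallyEq ?_
  filter_upwards [hfx] with y hy
  rw [Function.comp_apply, hy]

/-- After intersection with the preimage of `U`, every reparametrization stays where `f` is smooth;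
the values of `f` outside `U` play no role. This is how sections smooth on an open set only are
applied. -/
theorem _root_.TwoGroupBundle.PlotNear.comp_contMDiffOn {ℓ : Euc n → M} {x : Euc n}
    (h : PlotNear ℓ x) {f : M → N} {U : Set M} (hf : ContMDiffOn M.I N.I ∞ f U) (hU : IsOpen U)
    (hx : ℓ x ∈ U) : PlotNear (fun z => f (ℓ z)) x := by
  obtain ⟨s, hs, hxs, hp⟩ := h.exists
  refine PlotOn.plotNear (s := s ∩ ℓ ⁻¹' U) (fun k g hg hgs => ?_)
    (inter_mem (hs.mem_nhds hxs) (h.contMDiffAt.continuousAt (hU.mem_nhds hx)))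
  have h1 : SmoothPlot (ℓ ∘ g) := hp k g hg fun z => (hgs z).1
  exact hf.comp_contMDiff h1 fun z => (hgs z).2

/-- Both conditions hold on all sufficiently small sets, hence on common ones. Stating `PlotNear`
with small sets makes such finite conjunctions automatic. -/
theorem plotNear_fib {M' : Mfd.{u}} {f : M → N} {f' : M' → N} {hf : IsSurjSubmersion f}
    {hf' : Smooth f'} {ℓ : Euc n → fib f f' hf hf'} {x : Euc n}
    (h1 : PlotNear (fun z => fib.fst (ℓ z)) x) (h2 : PlotNear (fun z => fib.snd (ℓ z)) x) :
    PlotNear ℓ x :=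
  (Eventually.and h1 h2).mono fun s hs k g hg hgs =>
    fib.plot_iff.2 ⟨hs.1 k g hg hgs, hs.2 k g hg hgs⟩

instance prodDiffeology (M N : Mfd.{u}) : DiffeologicalSpace (prod M N) := diffeology (prod M N)

theorem plotNear_prod {ℓ : Euc n → M} {ℓ' : Euc n → N} {x : Euc n}
    (h1 : PlotNear ℓ x) (h2 : PlotNear ℓ' x) :
    PlotNear (Y := prod M N) (fun z => (ℓ z, ℓ' z)) x :=
  (Eventually.and h1 h2).mono fun s hs k g hg hgs =>
    SmoothPlot.prodMk (hs.1 k g hg hgs) (hs.2 k g hg hgs)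

/-! ### Random sections of submersions -/

/-- A family of local sections of a map `π : M → N`, extended to set-theoretic sections, together
with a subordinate partition of unity of `N`. -/
structure RandomSection {M N : Mfd.{u}} (π : M → N) where
  /-- the partition of unity -/
  weight : SmoothPartitionOfUnity N N.I N
  /-- the domains of smoothness of the sections -/
  dom : N → Set N
  /-- the sections -/
  sec : N → N → M
  isOpen_dom : ∀ i, IsOpen (dom i)
  tsupport_subset : ∀ i, tsupport (weight i) ⊆ dom i
  map_sec : ∀ i z, π (sec i z) = z
  sec_smooth : ∀ i, ContMDiffOn N.I M.I ∞ (sec i) (dom i)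

/-- In suitable coordinates a submersion is a projection (`exists_split`); freezing the fibre
coordinate at its value `q x` gives a smooth section near the image of `x`. -/
theorem IsSurjSubmersion.exists_local_section {π : M → N} (hπ : IsSurjSubmersion π) (y : N) :
    ∃ (U : Set N) (s : N → M), IsOpen U ∧ y ∈ U ∧ (∀ z, π (s z) = z) ∧
      ContMDiffOn N.I M.I ∞ s U := by
  classical
  obtain ⟨x, rfl⟩ := hπ.surjective y
  obtain ⟨q, τ, W, D, hW, hD, hxW, hq, hτ, h1, h2⟩ := exists_split hπ.smooth x (hπ.submersive x)
  have hc : Continuous fun z : N => (z, q x) := by fun_prop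
  refine ⟨(fun z => (z, q x)) ⁻¹' D,
    -- Outside the domain an arbitrary set-theoretic section is used. Then the section identity
    -- holds everywhere, and random lifts are defined for all choices, smooth or not.
    fun z => if (z, q x) ∈ D then τ (z, q x) else Function.surjInv hπ.surjective z,
    hD.preimage hc, (h1 x hxW).1, fun z => ?_, ?_⟩
  · by_cases h : (z, q x) ∈ D
    · simp only [if_pos h]
      exact (h2 _ h).2.1
    · simp only [if_neg h]
      exact Function.surjInv_eq hπ.surjective z
  · have h3 : ContMDiffOn N.I M.I ∞ (fun z => τ (z, q x)) ((fun z => (z, q x)) ⁻¹' D) :=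
      hτ.comp ((contMDiff_id.prodMk contMDiff_const).contMDiffOn) fun z hz => hz
    exact h3.congr fun z hz => if_pos hz

/-- One local section is chosen around each point of `N`, and the partition of unity is subordinate
to the cover by their domains, both indexed by the points of `N`. -/
theorem IsSurjSubmersion.nonempty_randomSection {π : M → N} (hπ : IsSurjSubmersion π) :
    Nonempty (RandomSection π) := by
  choose U s hU hy hs hsm using hπ.exists_local_section
  have : LocallyCompactSpace N := Manifold.locallyCompact_of_finiteDimensional N.I
  obtain ⟨ρ, hρ⟩ := SmoothPartitionOfUnity.exists_isSubordinate N.I (isClosed_univ (X := N)) U hU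
    fun z _ => Set.mem_iUnion.2 ⟨z, hy z⟩
  exact ⟨⟨ρ, U, s, hU, hρ, hs, hsm⟩⟩

end Mfd

/-! ### Averages over independent choices -/

section Average

variable {S T ι V W : Type*} [Fintype S] [Fintype T] [AddCommGroup V] [Module ℝ V]
  [AddCommGroup W] [Module ℝ W]

/-- Finitely supported weights of total mass one. -/
structure IsWeight (w : ι → ℝ) : Prop where
  finite : (Function.support w).Finite
  sum_eq_one : ∑ᶠ i, w i = 1

/-- The average of `G` over independent choices, with weights `w s`, of one index for each `s`. -/
def average (w : S → ι → ℝ) (G : (S → ι) → V) : V := ∑ᶠ c, (∏ s, w s (c s)) • G c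

theorem average_eq_sum {w : S → ι → ℝ} {I : S → Finset ι} [DecidableEq S]
    (hI : ∀ s i, w s i ≠ 0 → i ∈ I s) (G : (S → ι) → V) :
    average w G = ∑ c ∈ Fintype.piFinset I, (∏ s, w s (c s)) • G c := by
  refine finsum_eq_sum_of_support_subset _ fun c hc => ?_
  rw [Finset.mem_coe, Fintype.mem_piFinset]
  intro s
  refine hI s _ fun h => hc ?_
  dsimp only
  rw [Finset.prod_eq_zero (Finset.mem_univ s) h, zero_smul]

/-- Only choices of nonzero weight matter. With weights from a partition of unity, these are choices
whose sections are smooth at the point in question. -/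
theorem average_congr {w : S → ι → ℝ} {G G' : (S → ι) → V}
    (h : ∀ c, (∀ s, w s (c s) ≠ 0) → G c = G' c) : average w G = average w G' := by
  refine finsum_congr fun c => ?_
  by_cases hc : ∀ s, w s (c s) ≠ 0
  · rw [h c hc]
  · push Not at hc
    obtain ⟨s, hs⟩ := hc
    rw [Finset.prod_eq_zero (Finset.mem_univ s) hs, zero_smul, zero_smul]

theorem average_eq_sum_support [DecidableEq S] {w : S → ι → ℝ} (hw : ∀ s, IsWeight (w s))
    (G : (S → ι) → V) :
    average w G =
      ∑ c ∈ Fintype.piFinset fun s => (hw s).finite.toFinset, (∏ s, w s (c s)) • G c :=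
  average_eq_sum (fun s i hi => (hw s).finite.mem_toFinset.2 hi) G

theorem map_average {w : S → ι → ℝ} (hw : ∀ s, IsWeight (w s))
    (L : V →ₗ[ℝ] W) (G : (S → ι) → V) :
    L (average w G) = average w fun c => L (G c) := by
  classical
  rw [average_eq_sum_support hw, average_eq_sum_support hw, map_sum]
  simp only [map_smul]

theorem average_add {w : S → ι → ℝ} (hw : ∀ s, IsWeight (w s))
    (G G' : (S → ι) → V) :
    average w (fun c => G c + G' c) = average w G + average w G' := by
  classical
  simp only [average_eq_sum_support hw, smul_add, Finset.sum_add_distrib]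

/-- Marginalization: a quantity depending only on the choices at the indices `j t` ignores the other
ones, each of which sums to total mass one. This makes averages over lifts compatible with faces. -/
theorem average_comp_injective {w : S → ι → ℝ} (hw : ∀ s, IsWeight (w s))
    {j : T → S} (hj : Function.Injective j) (G : (T → ι) → V) :
    average w (fun c => G (c ∘ j)) = average (fun t => w (j t)) G := by
  classical
  set I : S → Finset ι := fun s => (hw s).finite.toFinset with hI
  have hsum : ∀ s, ∑ i ∈ I s, w s i = 1 := fun s => by
    rw [← (hw s).sum_eq_one, finsum_eq_sum _ (hw s).finite]
  rw [average_eq_sum_support hw, average_eq_sum_support fun t => hw (j t)]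
  have hmaps : ∀ c ∈ Fintype.piFinset I, c ∘ j ∈ Fintype.piFinset fun t => I (j t) := by
    intro c hc
    rw [Fintype.mem_piFinset] at hc ⊢
    exact fun t => hc (j t)
  -- The choices on `S` are grouped by their restriction `d` along `j`; on each group `G` is
  -- constant.
  rw [← Finset.sum_fiberwise_of_maps_to hmaps]
  refine Finset.sum_congr rfl fun d hd => ?_
  rw [Fintype.mem_piFinset] at hd
  have h1 : ∀ c ∈ (Fintype.piFinset I).filter fun c => c ∘ j = d,
      (∏ s, w s (c s)) • G (c ∘ j) = (∏ s, w s (c s)) • G d := fun c hc => by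
    rw [(Finset.mem_filter.1 hc).2]
  rw [Finset.sum_congr rfl h1, ← Finset.sum_smul]
  congr 1
  have h2 : ((Fintype.piFinset I).filter fun c => c ∘ j = d) =
      Fintype.piFinset fun s => (I s).filter fun i => ∀ t, j t = s → i = d t := by
    ext c
    simp only [Finset.mem_filter, Fintype.mem_piFinset]
    constructor
    · rintro ⟨h, rfl⟩ s
      exact ⟨h s, by rintro t rfl; rfl⟩
    · intro h
      exact ⟨fun s => (h s).1, funext fun t => (h (j t)).2 t rfl⟩
  rw [h2, ← Finset.prod_univ_sum]
  symm
  refine Fintype.prod_of_injective j hj _ _ (fun s hs => ?_) fun t => ?_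
  · rw [Finset.filter_true_of_mem, hsum]
    rintro i - t rfl
    exact (hs ⟨t, rfl⟩).elim
  · have : ((I (j t)).filter fun i => ∀ t', j t' = j t → i = d t') = {d t} := by
      ext i
      simp only [Finset.mem_filter, Finset.mem_singleton]
      constructor
      · rintro ⟨-, h⟩
        exact h t rfl
      · rintro rfl
        exact ⟨hd t, fun t' ht' => by rw [hj ht']⟩
    rw [this, Finset.sum_singleton]

theorem average_const {w : S → ι → ℝ} (hw : ∀ s, IsWeight (w s))
    (v : V) : average w (fun _ => v) = v := by
  -- With an empty index type `T`, all choices are summed out.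
  have h := average_comp_injective hw (j := (Empty.elim : Empty → S)) (fun x => x.elim)
    (fun _ => v)
  rw [h]
  simp [average, finsum_unique]

theorem SmoothPartitionOfUnity.isWeight {M : Mfd.{u}} (ρ : SmoothPartitionOfUnity ι M.I M)
    (x : M) : IsWeight fun i => ρ i x :=
  ⟨ρ.locallyFinite.point_finite x, ρ.sum_eq_one (Set.mem_univ x)⟩

/-- By local finiteness the average is, near `x`, a sum over one fixed finite set of choices with
smooth weights. The terms must be smooth at `x` for all points of the closed supports, because a
weight may vanish at `x` but not nearby. -/
theorem average_contDiffAt {M : Mfd.{u}} (ρ : SmoothPartitionOfUnity ι M.I M) {n : ℕ}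
    {F : Type*} [NormedAddCommGroup F] [NormedSpace ℝ F] {y : S → Euc n → M} {x : Euc n}
    (hy : ∀ s, ContMDiffAt 𝓘(ℝ, Euc n) M.I ∞ (y s) x) {G : (S → ι) → Euc n → F}
    (hG : ∀ c, (∀ s, y s x ∈ tsupport (ρ (c s))) → ContDiffAt ℝ ∞ (G c) x) :
    ContDiffAt ℝ ∞ (fun z => average (fun s i => ρ i (y s z)) fun c => G c z) x := by
  classical
  have h1 : ∀ᶠ z in 𝓝 x, ∀ s, ρ.finsupport (y s z) ⊆ ρ.fintsupport (y s x) :=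
    eventually_all.2 fun s =>
      (hy s).continuousAt.eventually (ρ.eventually_finsupport_subset (y s x))
  have h2 : ContDiffAt ℝ ∞ (fun z => ∑ c ∈ Fintype.piFinset fun s => ρ.fintsupport (y s x),
      (∏ s, ρ (c s) (y s z)) • G c z) x := by
    refine ContDiffAt.sum fun c hc => ContDiffAt.smul (contDiffAt_prod fun s _ => ?_) (hG c ?_)
    · rw [← contMDiffAt_iff_contDiffAt]
      exact (ρ (c s)).contMDiff.contMDiffAt.comp x (hy s)
    · intro s
      exact (ρ.mem_fintsupport_iff _ _).1 (Fintype.mem_piFinset.1 hc s)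
  refine h2.congr_of_eventuallyEq ?_
  filter_upwards [h1] with z hz
  exact average_eq_sum (fun s i hi => hz s ((ρ.mem_finsupport _).2 hi)) _

end Average

/-! ### Degenerate simplices -/

theorem LieGroupoidStr.mul_eq_left {A M : Mfd.{u}} (S : LieGroupoidStr A M) {g f : A}
    (h : S.src g = S.tgt f) (hf : f = S.one (S.src g)) : S.mul g f h = g :=
  (S.mul_congr rfl hf h (S.tgt_one _).symm).trans (S.mul_one g)

theorem LieGroupoidStr.mul_eq_right {A M : Mfd.{u}} (S : LieGroupoidStr A M) {g f : A}
    (h : S.src g = S.tgt f) (hg : g = S.one (S.tgt f)) : S.mul g f h = f :=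
  (S.mul_congr hg rfl h (S.src_one _)).trans (S.one_mul f)

namespace Nerve

variable {Γ Δ : Lie2Groupoid.{u}} {m n q r : ℕ}

/-- The edges of a simplex, extended by units to pairs `i ≤ j`. -/
def arrLe (y : Nerve Δ q) (i j : Fin (q + 1)) : Δ.G₁ :=
  if h : i < j then y.arr i j h else Δ.h₁.one (y.obj i)

/-- The triangles of a simplex, extended by units to triples `i ≤ j ≤ k`. -/
def cellLe (y : Nerve Δ q) (i j k : Fin (q + 1)) : Δ.G₂ :=
  if h : i < j ∧ j < k then y.cell i j k h.1 h.2 else Δ.v.one (y.arrLe i k)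

theorem arrLe_of_lt (y : Nerve Δ q) {i j : Fin (q + 1)} (h : i < j) :
    y.arrLe i j = y.arr i j h := dif_pos h

theorem arrLe_self (y : Nerve Δ q) (i : Fin (q + 1)) : y.arrLe i i = Δ.h₁.one (y.obj i) :=
  dif_neg (lt_irrefl i)

theorem cellLe_of_lt (y : Nerve Δ q) {i j k : Fin (q + 1)} (h : i < j) (h' : j < k) :
    y.cellLe i j k = y.cell i j k h h' := dif_pos ⟨h, h'⟩

theorem cellLe_of_not (y : Nerve Δ q) {i j k : Fin (q + 1)} (h : ¬(i < j ∧ j < k)) :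
    y.cellLe i j k = Δ.v.one (y.arrLe i k) := dif_neg h

theorem cellLe_left (y : Nerve Δ q) (i k : Fin (q + 1)) :
    y.cellLe i i k = Δ.v.one (y.arrLe i k) := dif_neg fun h => lt_irrefl i h.1

theorem cellLe_right (y : Nerve Δ q) (i k : Fin (q + 1)) :
    y.cellLe i k k = Δ.v.one (y.arrLe i k) := dif_neg fun h => lt_irrefl k h.2

theorem src_arrLe (y : Nerve Δ q) (i j : Fin (q + 1)) : Δ.h₁.src (y.arrLe i j) = y.obj i := by
  unfold arrLe
  split
  · exact y.src_arr _ _ _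
  · exact Δ.h₁.src_one _

theorem tgt_arrLe (y : Nerve Δ q) {i j : Fin (q + 1)} (h : i ≤ j) :
    Δ.h₁.tgt (y.arrLe i j) = y.obj j := by
  rcases h.eq_or_lt with rfl | h
  · rw [arrLe_self, Δ.h₁.tgt_one]
  · rw [arrLe_of_lt y h, y.tgt_arr]

theorem tgt_cellLe (y : Nerve Δ q) {i j k : Fin (q + 1)} (hij : i ≤ j) (hjk : j ≤ k) :
    Δ.v.tgt (y.cellLe i j k) = y.arrLe i k := by
  unfold cellLe
  split
  next h => rw [y.tgt_cell, arrLe_of_lt]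
  · exact Δ.v.tgt_one _

theorem src_cellLe (y : Nerve Δ q) {i j k : Fin (q + 1)} (hij : i ≤ j) (hjk : j ≤ k)
    (h : Δ.h₁.src (y.arrLe j k) = Δ.h₁.tgt (y.arrLe i j)) :
    Δ.v.src (y.cellLe i j k) = Δ.h₁.mul (y.arrLe j k) (y.arrLe i j) h := by
  rcases hij.eq_or_lt with rfl | hij'
  · rw [cellLe_left, Δ.v.src_one, Δ.h₁.mul_eq_left]
    rw [arrLe_self, src_arrLe]
  rcases hjk.eq_or_lt with rfl | hjk'
  · rw [cellLe_right, Δ.v.src_one, Δ.h₁.mul_eq_right]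
    rw [arrLe_self, tgt_arrLe y hij]
  · have h' : Δ.h₁.src (y.arr j k hjk') = Δ.h₁.tgt (y.arr i j hij') := by
      rw [y.src_arr, y.tgt_arr]
    rw [cellLe_of_lt y hij' hjk', y.src_cell _ _ _ _ _ h']
    exact Δ.h₁.mul_congr (arrLe_of_lt y hjk').symm (arrLe_of_lt y hij').symm _ _

theorem src₂_cellLe (y : Nerve Δ q) {i j k : Fin (q + 1)} (hij : i ≤ j) (hjk : j ≤ k) :
    Δ.h₂.src (y.cellLe i j k) = y.obj i := by
  rw [← Δ.src_u, tgt_cellLe y hij hjk, src_arrLe]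

theorem tgt₂_cellLe (y : Nerve Δ q) {i j k : Fin (q + 1)} (hij : i ≤ j) (hjk : j ≤ k) :
    Δ.h₂.tgt (y.cellLe i j k) = y.obj k := by
  rw [← Δ.tgt_u, tgt_cellLe y hij hjk, tgt_arrLe y (hij.trans hjk)]

/-- For distinct vertices this is the tetrahedron of `y`. If `i = j` or `k = l`, all factors but one
are units and both sides reduce to the same triangle; if `j = k`, the two sides agree factor by
factor. -/
theorem tetrahedronLe (y : Nerve Δ q) {i j k l : Fin (q + 1)} (hij : i ≤ j) (hjk : j ≤ k)
    (hkl : k ≤ l)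
    (h₁ : Δ.h₂.src (Δ.v.one (y.arrLe k l)) = Δ.h₂.tgt (y.cellLe i j k))
    (h₂ : Δ.v.src (y.cellLe i k l) =
      Δ.v.tgt (Δ.h₂.mul (Δ.v.one (y.arrLe k l)) (y.cellLe i j k) h₁))
    (h₃ : Δ.h₂.src (y.cellLe j k l) = Δ.h₂.tgt (Δ.v.one (y.arrLe i j)))
    (h₄ : Δ.v.src (y.cellLe i j l) =
      Δ.v.tgt (Δ.h₂.mul (y.cellLe j k l) (Δ.v.one (y.arrLe i j)) h₃)) :
    Δ.v.mul (y.cellLe i k l) (Δ.h₂.mul (Δ.v.one (y.arrLe k l)) (y.cellLe i j k) h₁) h₂ =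
      Δ.v.mul (y.cellLe i j l) (Δ.h₂.mul (y.cellLe j k l) (Δ.v.one (y.arrLe i j)) h₃) h₄ := by
  have hc : ∀ {a b c : Fin (q + 1)}, a ≤ b → b ≤ c →
      Δ.h₁.src (y.arrLe b c) = Δ.h₁.tgt (y.arrLe a b) := fun hab hbc => by
    rw [src_arrLe, tgt_arrLe y hab]
  have ho : ∀ {a b c : Fin (q + 1)}, a ≤ b → b ≤ c →
      Δ.h₂.src (Δ.v.one (y.arrLe b c)) = Δ.h₂.tgt (Δ.v.one (y.arrLe a b)) := fun hab hbc => by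
    rw [← Δ.src_l, ← Δ.tgt_l, Δ.v.src_one, Δ.v.src_one, hc hab hbc]
  -- A horizontal product of units is the unit on the composite edge, which is the source of the
  -- triangle on `a`, `b`, `c`.
  have hm : ∀ {a b c : Fin (q + 1)} (hab : a ≤ b) (hbc : b ≤ c),
      Δ.h₂.mul (Δ.v.one (y.arrLe b c)) (Δ.v.one (y.arrLe a b)) (ho hab hbc) =
        Δ.v.one (Δ.v.src (y.cellLe a b c)) := fun hab hbc => by
    rw [src_cellLe y hab hbc (hc hab hbc), Δ.one_mul]
  rcases hij.eq_or_lt with rfl | hij'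
  · rw [Δ.v.mul_eq_left, Δ.v.mul_eq_right, Δ.h₂.mul_eq_left]
    · rw [arrLe_self, Δ.one_one, src₂_cellLe y hjk hkl]
    · rw [← h₄, cellLe_left, Δ.v.src_one]
    · exact (Δ.h₂.mul_congr rfl (cellLe_left y _ _) _ (ho hjk hkl)).trans (hm hjk hkl)
  rcases hjk.eq_or_lt with rfl | hjk'
  · refine Δ.v.mul_congr rfl (Δ.h₂.mul_congr ?_ ?_ _ _) _ _
    · rw [cellLe_left]
    · rw [cellLe_right]
  rcases hkl.eq_or_lt with rfl | hkl'
  · rw [Δ.v.mul_eq_right, Δ.v.mul_eq_left, Δ.h₂.mul_eq_right]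
    · rw [arrLe_self, Δ.one_one, tgt₂_cellLe y hij hjk]
    · exact (Δ.h₂.mul_congr (cellLe_right y _ _) rfl _ (ho hij hjk)).trans (hm hij hjk)
    · rw [← h₂, cellLe_right, Δ.v.src_one]
  have e1 := arrLe_of_lt y hij'
  have e2 := arrLe_of_lt y hkl'
  have e3 := cellLe_of_lt y hij' hjk'
  have e4 := cellLe_of_lt y hjk' hkl'
  have e5 := cellLe_of_lt y (hij'.trans hjk') hkl'
  have e6 := cellLe_of_lt y hij' (hjk'.trans hkl')
  have k₁ := h₁
  have k₃ := h₃
  rw [e2, e3] at k₁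
  rw [e1, e4] at k₃
  have f₁ := Δ.h₂.mul_congr (congrArg Δ.v.one e2) e3 h₁ k₁
  have f₃ := Δ.h₂.mul_congr e4 (congrArg Δ.v.one e1) h₃ k₃
  have k₂ := h₂
  have k₄ := h₄
  rw [e5, f₁] at k₂
  rw [e6, f₃] at k₄
  exact (Δ.v.mul_congr e5 f₁ _ k₂).trans ((y.tetrahedron i j k l hij' hjk' hkl' k₁ k₂ k₃ k₄).trans
    (Δ.v.mul_congr e6 f₃ _ k₄).symm)

/-- The simplicial operator of a weakly increasing map. -/
def degen (θ : Fin (r + 1) → Fin (q + 1)) (hθ : Monotone θ) (y : Nerve Δ q) : Nerve Δ r where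
  obj i := y.obj (θ i)
  arr i j _ := y.arrLe (θ i) (θ j)
  cell i j k _ _ := y.cellLe (θ i) (θ j) (θ k)
  src_arr _ _ _ := y.src_arrLe _ _
  tgt_arr _ _ h := y.tgt_arrLe (hθ h.le)
  src_cell _ _ _ h h' _ := y.src_cellLe (hθ h.le) (hθ h'.le) _
  tgt_cell _ _ _ h h' := y.tgt_cellLe (hθ h.le) (hθ h'.le)
  tetrahedron _ _ _ _ h h' h'' _ _ _ _ := y.tetrahedronLe (hθ h.le) (hθ h'.le) (hθ h''.le) _ _ _ _

theorem degen_of_strictMono {θ : Fin (r + 1) → Fin (q + 1)} (hθ : StrictMono θ) (y : Nerve Δ q) :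
    degen θ hθ.monotone y = restrict θ hθ y := by
  refine Nerve.ext rfl ?_ ?_
  · funext i j h
    exact arrLe_of_lt y (hθ h)
  · funext i j k h h'
    exact cellLe_of_lt y (hθ h) (hθ h')

/-- A strictly increasing `θ` preserves and reflects strict inequalities, so units are inserted at
the same places on both sides. -/
theorem degen_restrict (θ : Fin (r + 1) → Fin (q + 1)) (hθ : StrictMono θ)
    (η : Fin (m + 1) → Fin (r + 1)) (hη : Monotone η) (y : Nerve Δ q) :
    degen η hη (restrict θ hθ y) = degen (θ ∘ η) (hθ.monotone.comp hη) y := by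
  have ha : ∀ i j, (restrict θ hθ y).arrLe i j = y.arrLe (θ i) (θ j) := by
    intro i j
    by_cases h : i < j
    · rw [arrLe_of_lt _ h, arrLe_of_lt _ (hθ h)]
      rfl
    · rw [arrLe, arrLe, dif_neg h, dif_neg (by rwa [hθ.lt_iff_lt])]
      rfl
  refine Nerve.ext rfl ?_ ?_
  · funext i j h
    exact ha _ _
  · funext i j k h h'
    change cellLe _ _ _ _ = cellLe _ _ _ _
    by_cases h : η i < η j ∧ η j < η k
    · rw [cellLe_of_lt _ h.1 h.2]
      exact (cellLe_of_lt y (hθ h.1) (hθ h.2)).symm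
    · rw [cellLe_of_not _ h, ha]
      refine (cellLe_of_not y ?_).symm
      simpa only [Function.comp_apply, hθ.lt_iff_lt] using h

theorem smoothPlot_arrLe {P : Euc n → Nerve Δ q} (hP : IsPlot P) (i j : Fin (q + 1)) :
    Mfd.SmoothPlot fun z => (P z).arrLe i j := by
  by_cases h : i < j
  · simp only [arrLe_of_lt _ h]
    exact hP.2.1 i j h
  · simp only [arrLe, dif_neg h]
    exact Δ.h₁.one_smooth.comp_plot (hP.1 i)

theorem dSmooth_degen (θ : Fin (r + 1) → Fin (q + 1)) (hθ : Monotone θ) :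
    DSmooth (degen (Δ := Δ) θ hθ) := by
  intro n P hP
  refine ⟨fun i => hP.1 _, fun i j _ => smoothPlot_arrLe hP _ _, fun i j k _ _ => ?_⟩
  change Mfd.SmoothPlot fun z => (P z).cellLe (θ i) (θ j) (θ k)
  by_cases h : θ i < θ j ∧ θ j < θ k
  · simp only [cellLe_of_lt _ h.1 h.2]
    exact hP.2.2 _ _ _ h.1 h.2
  · simp only [cellLe, dif_neg h]
    exact Δ.v.one_smooth.comp_plot (smoothPlot_arrLe hP _ _)

end Nerve

/-! ### Lifting simplices along Morita morphisms -/

section Lift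

variable {Γ Δ : Lie2Groupoid.{u}} {φ : Hom Γ Δ} {m n : ℕ}

/-- The 2-arrow of `Γ` with prescribed source, target and image in `Δ`. -/
def Hom.IsMorita.cellLift (hφ : φ.IsMorita) (a b : Γ.G₁) (c : Δ.G₂)
    (hs : Γ.h₁.src b = Γ.h₁.src a) (ht : Γ.h₁.tgt b = Γ.h₁.tgt a)
    (hl : φ.f₁ a = Δ.v.src c) (hu : φ.f₁ b = Δ.v.tgt c) : Γ.G₂ :=
  hφ.diffeo₂.choose
    (Mfd.fib.mk ((a, b) : Mfd.prod Γ.G₁ Γ.G₁)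
      (Mfd.fib.mk ((Γ.h₁.src a, Γ.h₁.tgt a) : Mfd.prod Γ.G₀ Γ.G₀) c
        (Prod.ext
          (((φ.functor_h₁.map_src a).symm.trans (congrArg Δ.h₁.src hl)).trans (Δ.src_l c))
          (((φ.functor_h₁.map_tgt a).symm.trans (congrArg Δ.h₁.tgt hl)).trans (Δ.tgt_l c))))
      (Prod.ext (Mfd.fib.ext rfl hl) (Mfd.fib.ext (Prod.ext hs ht) hu)))

section

variable (hφ : φ.IsMorita) {a b : Γ.G₁} {c : Δ.G₂} (hs : Γ.h₁.src b = Γ.h₁.src a)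
  (ht : Γ.h₁.tgt b = Γ.h₁.tgt a) (hl : φ.f₁ a = Δ.v.src c) (hu : φ.f₁ b = Δ.v.tgt c)

theorem Hom.IsMorita.src_cellLift : Γ.v.src (hφ.cellLift a b c hs ht hl hu) = a :=
  congrArg (fun y : φ.pb₂₁ hφ.sub₀ hφ.sub₁ => (Mfd.fib.fst y).1)
    (hφ.diffeo₂.choose_spec.2.2 _)

theorem Hom.IsMorita.tgt_cellLift : Γ.v.tgt (hφ.cellLift a b c hs ht hl hu) = b :=
  congrArg (fun y : φ.pb₂₁ hφ.sub₀ hφ.sub₁ => (Mfd.fib.fst y).2)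
    (hφ.diffeo₂.choose_spec.2.2 _)

theorem Hom.IsMorita.map_cellLift : φ.f₂ (hφ.cellLift a b c hs ht hl hu) = c :=
  congrArg (fun y : φ.pb₂₁ hφ.sub₀ hφ.sub₁ => Mfd.fib.snd (Mfd.fib.snd y))
    (hφ.diffeo₂.choose_spec.2.2 _)

end

theorem Hom.IsMorita.smoothPlot_cellLift (hφ : φ.IsMorita) {a b : Euc n → Γ.G₁} {c : Euc n → Δ.G₂}
    (ha : Mfd.SmoothPlot a) (hb : Mfd.SmoothPlot b) (hc : Mfd.SmoothPlot c)
    (hs : ∀ z, Γ.h₁.src (b z) = Γ.h₁.src (a z)) (ht : ∀ z, Γ.h₁.tgt (b z) = Γ.h₁.tgt (a z))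
    (hl : ∀ z, φ.f₁ (a z) = Δ.v.src (c z)) (hu : ∀ z, φ.f₁ (b z) = Δ.v.tgt (c z)) :
    Mfd.SmoothPlot fun z => hφ.cellLift (a z) (b z) (c z) (hs z) (ht z) (hl z) (hu z) :=
  hφ.diffeo₂.choose_spec.1.comp_plot (Mfd.fib.plot_iff.2 ⟨ha.prodMk hb, Mfd.fib.plot_iff.2
    ⟨(Γ.h₁.src_submersion.smooth.comp_plot ha).prodMk
      (Γ.h₁.tgt_submersion.smooth.comp_plot ha), hc⟩⟩)

/-- Lifts `x`, `e` of the vertices and of the edges of a simplex `y` of `Δ`. -/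
structure IsLift (φ : Hom Γ Δ) (y : Nerve Δ m) (x : Fin (m + 1) → Γ.G₀)
    (e : ∀ i j : Fin (m + 1), i < j → Γ.G₁) : Prop where
  map_obj : ∀ i, φ.f₀ (x i) = y.obj i
  src_arr : ∀ i j h, Γ.h₁.src (e i j h) = x i
  tgt_arr : ∀ i j h, Γ.h₁.tgt (e i j h) = x j
  map_arr : ∀ i j h, φ.f₁ (e i j h) = y.arr i j h

variable {y : Nerve Δ m} {x : Fin (m + 1) → Γ.G₀} {e : ∀ i j : Fin (m + 1), i < j → Γ.G₁}

theorem IsLift.composable (h : IsLift φ y x e) {i j k : Fin (m + 1)} (hij : i < j) (hjk : j < k) :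
    Γ.h₁.src (e j k hjk) = Γ.h₁.tgt (e i j hij) := by
  rw [h.src_arr, h.tgt_arr]

/-- The triangles of the lift of a simplex. -/
def IsLift.cell (hφ : φ.IsMorita) (h : IsLift φ y x e) (i j k : Fin (m + 1)) (hij : i < j)
    (hjk : j < k) : Γ.G₂ :=
  hφ.cellLift (Γ.h₁.mul (e j k hjk) (e i j hij) (h.composable hij hjk)) (e i k (hij.trans hjk))
    (y.cell i j k hij hjk)
    (by rw [Γ.h₁.src_mul, h.src_arr, h.src_arr])
    (by rw [Γ.h₁.tgt_mul, h.tgt_arr, h.tgt_arr])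
    (by
      have hc : Δ.h₁.src (φ.f₁ (e j k hjk)) = Δ.h₁.tgt (φ.f₁ (e i j hij)) := by
        rw [h.map_arr, h.map_arr, y.src_arr, y.tgt_arr]
      rw [φ.functor_h₁.map_mul _ _ (h.composable hij hjk) hc,
        y.src_cell _ _ _ _ _ (by rw [y.src_arr, y.tgt_arr])]
      exact Δ.h₁.mul_congr (h.map_arr _ _ _) (h.map_arr _ _ _) _ _)
    (by rw [h.map_arr, y.tgt_cell])

section

variable (hφ : φ.IsMorita) (h : IsLift φ y x e) (i j k : Fin (m + 1)) (hij : i < j) (hjk : j < k)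

theorem IsLift.src_cell : Γ.v.src (h.cell hφ i j k hij hjk) =
    Γ.h₁.mul (e j k hjk) (e i j hij) (h.composable hij hjk) := hφ.src_cellLift _ _ _ _

theorem IsLift.tgt_cell : Γ.v.tgt (h.cell hφ i j k hij hjk) = e i k (hij.trans hjk) :=
  hφ.tgt_cellLift _ _ _ _

theorem IsLift.map_cell : φ.f₂ (h.cell hφ i j k hij hjk) = y.cell i j k hij hjk :=
  hφ.map_cellLift _ _ _ _

end

/-- The lift of a simplex with prescribed vertices and edges. -/
def Nerve.lift (hφ : φ.IsMorita) (y : Nerve Δ m) (x : Fin (m + 1) → Γ.G₀)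
    (e : ∀ i j : Fin (m + 1), i < j → Γ.G₁) (h : IsLift φ y x e) : Nerve Γ m where
  obj := x
  arr := e
  cell := h.cell hφ
  src_arr := h.src_arr
  tgt_arr := h.tgt_arr
  src_cell i j k hij hjk _ := h.src_cell hφ i j k hij hjk
  tgt_cell := h.tgt_cell hφ
  tetrahedron i j k l hij hjk hkl h₁ h₂ h₃ h₄ := by
    have hsrc := h.src_cell hφ
    have htgt := h.tgt_cell hφ
    have hmap := h.map_cell hφ
    have hone : ∀ i j hij, φ.f₂ (Γ.v.one (e i j hij)) = Δ.v.one (y.arr i j hij) :=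
      fun i j hij => by rw [φ.functor_v.map_one, h.map_arr]
    -- A 2-arrow of Γ is determined by its source, its target and its image in Δ. The sources agree
    -- by associativity, both targets are the edge from `i` to `l`, and the images agree by the
    -- tetrahedron of `y`.
    refine hφ.ext₂ ?_ ?_ ?_
    · have c₁ : Γ.h₁.src (Γ.v.src (Γ.v.one (e k l hkl))) =
          Γ.h₁.tgt (Γ.v.src (h.cell hφ i j k hij hjk)) := by rw [Γ.src_l, Γ.tgt_l, h₁]
      have c₃ : Γ.h₁.src (Γ.v.src (h.cell hφ j k l hjk hkl)) =
          Γ.h₁.tgt (Γ.v.src (Γ.v.one (e i j hij))) := by rw [Γ.src_l, Γ.tgt_l, h₃]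
      rw [Γ.v.src_mul, Γ.v.src_mul, Γ.l_mul _ _ h₁ c₁, Γ.l_mul _ _ h₃ c₃]
      refine (Γ.h₁.mul_congr (Γ.v.src_one _) (hsrc _ _ _ _ _) _ ?_).trans
        ((Γ.h₁.mul_assoc _ _ _ (h.composable hjk hkl) (h.composable hij hjk)).symm.trans
          (Γ.h₁.mul_congr (hsrc _ _ _ _ _) (Γ.v.src_one _) _ _).symm)
      rw [Γ.h₁.tgt_mul, h.composable hjk hkl]
    · rw [Γ.v.tgt_mul, Γ.v.tgt_mul, htgt, htgt]
    · have k₁ : Δ.h₂.src (φ.f₂ (Γ.v.one (e k l hkl))) =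
          Δ.h₂.tgt (φ.f₂ (h.cell hφ i j k hij hjk)) := by
        rw [φ.functor_h₂.map_src, φ.functor_h₂.map_tgt, h₁]
      have k₃ : Δ.h₂.src (φ.f₂ (h.cell hφ j k l hjk hkl)) =
          Δ.h₂.tgt (φ.f₂ (Γ.v.one (e i j hij))) := by
        rw [φ.functor_h₂.map_src, φ.functor_h₂.map_tgt, h₃]
      have k₂ := congrArg φ.f₁ h₂
      rw [← φ.functor_v.map_src, ← φ.functor_v.map_tgt] at k₂
      have k₄ := congrArg φ.f₁ h₄
      rw [← φ.functor_v.map_src, ← φ.functor_v.map_tgt] at k₄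
      have g₁ := (φ.functor_h₂.map_mul _ _ h₁ k₁).trans
        (Δ.h₂.mul_congr (hone _ _ _) (hmap _ _ _ _ _) k₁ (by rw [← hone, ← hmap, k₁]))
      have g₃ := (φ.functor_h₂.map_mul _ _ h₃ k₃).trans
        (Δ.h₂.mul_congr (hmap _ _ _ _ _) (hone _ _ _) k₃ (by rw [← hone, ← hmap, k₃]))
      rw [φ.functor_v.map_mul _ _ h₂ k₂, φ.functor_v.map_mul _ _ h₄ k₄]
      have l₂ := k₂
      have l₄ := k₄
      rw [hmap, g₁] at l₂
      rw [hmap, g₃] at l₄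
      exact (Δ.v.mul_congr (hmap _ _ _ _ _) g₁ _ l₂).trans
        ((y.tetrahedron i j k l hij hjk hkl _ l₂ _ l₄).trans
          (Δ.v.mul_congr (hmap _ _ _ _ _) g₃ _ l₄).symm)

theorem Nerve.map_lift (hφ : φ.IsMorita) (h : IsLift φ y x e) :
    Nerve.map φ (Nerve.lift hφ y x e h) = y := by
  refine Nerve.ext (funext h.map_obj) ?_ ?_
  · funext i j hij
    exact h.map_arr i j hij
  · funext i j k hij hjk
    exact h.map_cell hφ _ _ _ _ _

theorem Nerve.isLift_map (z : Nerve Γ m) : IsLift φ (Nerve.map φ z) z.obj z.arr :=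
  ⟨fun _ => rfl, z.src_arr, z.tgt_arr, fun _ _ _ => rfl⟩

/-- Uniqueness of lifted triangles: once the vertices and the edges are those of `z`, so is
everything else. -/
theorem Nerve.lift_map (hφ : φ.IsMorita) (z : Nerve Γ m)
    (h : IsLift φ (Nerve.map φ z) z.obj z.arr) :
    Nerve.lift hφ (Nerve.map φ z) z.obj z.arr h = z := by
  refine Nerve.ext rfl rfl ?_
  funext i j k hij hjk
  refine hφ.ext₂ ?_ ?_ (h.map_cell hφ _ _ _ _ _)
  · rw [z.src_cell _ _ _ _ _ (h.composable hij hjk)]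
    exact h.src_cell hφ _ _ _ _ _
  · rw [z.tgt_cell]
    exact h.tgt_cell hφ _ _ _ _ _

theorem Nerve.lift_congr (hφ : φ.IsMorita) {y' : Nerve Δ m} {x' : Fin (m + 1) → Γ.G₀}
    {e' : ∀ i j : Fin (m + 1), i < j → Γ.G₁} (h : IsLift φ y x e) (h' : IsLift φ y' x' e')
    (hy : y = y') (hx : x = x') (he : e = e') :
    Nerve.lift hφ y x e h = Nerve.lift hφ y' x' e' h' := by
  subst hy hx he
  rfl

theorem Nerve.isPlot_lift (hφ : φ.IsMorita) {y : Euc n → Nerve Δ m}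
    {x : Euc n → Fin (m + 1) → Γ.G₀} {e : Euc n → ∀ i j : Fin (m + 1), i < j → Γ.G₁}
    (h : ∀ z, IsLift φ (y z) (x z) (e z)) (hy : IsPlot y)
    (hx : ∀ i, Mfd.SmoothPlot fun z => x z i)
    (he : ∀ i j hij, Mfd.SmoothPlot fun z => e z i j hij) :
    IsPlot fun z => Nerve.lift hφ (y z) (x z) (e z) (h z) :=
  ⟨hx, he, fun i j k hij hjk => by
    change Mfd.SmoothPlot fun z => (h z).cell hφ i j k hij hjk
    unfold IsLift.cell
    exact hφ.smoothPlot_cellLift (Γ.h₁.mul_smooth _ _ _ (he _ _ _) (he _ _ _) _) (he _ _ _)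
      (hy.2.2 _ _ _ _ _) _ _ _ _⟩

end Lift

/-! ### Averages over random lifts -/

section Transfer

variable {Γ Δ : Lie2Groupoid.{u}} {φ : Hom Γ Δ} {X Y : Type u} [DiffeologicalSpace X]
  [DiffeologicalSpace Y] {m n p r : ℕ}

/-- A smooth family `base`, parametrized by `X`, of `m`-simplices of `Δ`, together with operations
which modify lifts of their vertices and edges to `Γ`. -/
structure Filler (φ : Hom Γ Δ) (X : Type u) [DiffeologicalSpace X] (m : ℕ) where
  /-- the simplices to be lifted -/
  base : X → Nerve Δ m
  /-- the modification of the vertices -/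
  obj : Fin (m + 1) → X → Γ.G₀ → Γ.G₀
  /-- the modification of the edges -/
  arr : ∀ i j : Fin (m + 1), i < j → X → Γ.G₁ → Γ.G₁
  base_smooth : DSmooth base
  obj_smooth : ∀ {n : ℕ} {P : Euc n → X} {x : Euc n → Γ.G₀} (i), IsPlot P → Mfd.SmoothPlot x →
    Mfd.SmoothPlot fun z => obj i (P z) (x z)
  arr_smooth : ∀ {n : ℕ} {P : Euc n → X} {x : Euc n → Γ.G₁} (i j h), IsPlot P →
    Mfd.SmoothPlot x → Mfd.SmoothPlot fun z => arr i j h (P z) (x z)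
  map_obj : ∀ i t x, φ.f₀ x = (base t).obj i → φ.f₀ (obj i t x) = (base t).obj i
  -- The ends of an edge are lifted, and modified, before the edge itself. A modification of edges
  -- must keep these ends and the image in Δ, so that its result is again a lift of the base.
  src_arr : ∀ i j h t x e, Γ.h₁.src e = obj i t x → φ.f₁ e = (base t).arr i j h →
    Γ.h₁.src (arr i j h t e) = obj i t x
  tgt_arr : ∀ i j h t x e, Γ.h₁.tgt e = obj j t x → φ.f₁ e = (base t).arr i j h →
    Γ.h₁.tgt (arr i j h t e) = obj j t x
  map_arr : ∀ i j h t e, φ.f₁ e = (base t).arr i j h →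
    φ.f₁ (arr i j h t e) = (base t).arr i j h

/-- The edges of the standard simplex. -/
abbrev Edge (m : ℕ) : Type := {e : Fin (m + 1) × Fin (m + 1) // e.1 < e.2}

/-- The map of edges induced by a strictly increasing map. -/
def Edge.map {θ : Fin (r + 1) → Fin (m + 1)} (hθ : StrictMono θ) (e : Edge r) : Edge m :=
  ⟨(θ e.1.1, θ e.1.2), hθ e.2⟩

theorem Edge.map_injective {θ : Fin (r + 1) → Fin (m + 1)} (hθ : StrictMono θ) :
    Function.Injective (Edge.map hθ) := by
  rintro ⟨⟨a, b⟩, h⟩ ⟨⟨a', b'⟩, h'⟩ hab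
  simp only [Edge.map, Subtype.mk.injEq, Prod.mk.injEq] at hab
  have h1 := hθ.injective hab.1
  have h2 := hθ.injective hab.2
  subst h1 h2
  rfl

namespace Filler

/-- The family parametrized by `Y` obtained from a smooth map `Y → X`. -/
def reparam (L : Filler φ X m) (g : Y → X) (hg : DSmooth g) : Filler φ Y m where
  base t := L.base (g t)
  obj i t := L.obj i (g t)
  arr i j h t := L.arr i j h (g t)
  base_smooth := L.base_smooth.comp hg
  obj_smooth i hP hx := L.obj_smooth i (hg _ _ hP) hx
  arr_smooth i j h hP hx := L.arr_smooth i j h (hg _ _ hP) hx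
  map_obj i t := L.map_obj i (g t)
  src_arr i j h t := L.src_arr i j h (g t)
  tgt_arr i j h t := L.tgt_arr i j h (g t)
  map_arr i j h t := L.map_arr i j h (g t)

/-- The restriction to a face. -/
def restrict (L : Filler φ X m) (θ : Fin (r + 1) → Fin (m + 1)) (hθ : StrictMono θ) :
    Filler φ X r where
  base t := (L.base t).restrict θ hθ
  obj i := L.obj (θ i)
  arr i j h := L.arr (θ i) (θ j) (hθ h)
  base_smooth := (Nerve.dSmooth_restrict θ hθ).comp L.base_smooth
  obj_smooth i := L.obj_smooth (θ i)
  arr_smooth i j h := L.arr_smooth (θ i) (θ j) (hθ h)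
  map_obj i := L.map_obj (θ i)
  src_arr i j h := L.src_arr (θ i) (θ j) (hθ h)
  tgt_arr i j h := L.tgt_arr (θ i) (θ j) (hθ h)
  map_arr i j h := L.map_arr (θ i) (θ j) (hθ h)

variable (hφ : φ.IsMorita) (R₀ : Mfd.RandomSection φ.f₀)
  (R₁ : Mfd.RandomSection (φ.toPb₁ hφ.sub₀)) (L : Filler φ X m) (c : Fin (m + 1) → Δ.G₀)
  (d : Edge m → φ.pb₁ hφ.sub₀)

/-- The vertices of a random lift. -/
def vert (t : X) (i : Fin (m + 1)) : Γ.G₀ := L.obj i t (R₀.sec (c i) ((L.base t).obj i))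

theorem map_vert (t : X) (i : Fin (m + 1)) : φ.f₀ (L.vert R₀ c t i) = (L.base t).obj i :=
  L.map_obj i t _ (R₀.map_sec _ _)

/-- The position of an edge of a random lift. -/
def edgeBase (t : X) (e : Edge m) : φ.pb₁ hφ.sub₀ :=
  Mfd.fib.mk ((L.vert R₀ c t e.1.1, L.vert R₀ c t e.1.2) : Mfd.prod Γ.G₀ Γ.G₀)
    ((L.base t).arr e.1.1 e.1.2 e.2)
    (Prod.ext ((L.map_vert R₀ c t _).trans ((L.base t).src_arr _ _ _).symm)
      ((L.map_vert R₀ c t _).trans ((L.base t).tgt_arr _ _ _).symm))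

/-- The edges of a random lift. -/
def edge (t : X) (i j : Fin (m + 1)) (h : i < j) : Γ.G₁ :=
  L.arr i j h t (R₁.sec (d ⟨(i, j), h⟩) (L.edgeBase hφ R₀ c t ⟨(i, j), h⟩))

theorem isLift (t : X) : IsLift φ (L.base t) (L.vert R₀ c t) (L.edge hφ R₀ R₁ c d t) := by
  have h1 : ∀ e : Edge m, φ.toPb₁ hφ.sub₀ (R₁.sec (d e) (L.edgeBase hφ R₀ c t e)) =
      L.edgeBase hφ R₀ c t e := fun e => R₁.map_sec _ _
  have h2 : ∀ e : Edge m, φ.f₁ (R₁.sec (d e) (L.edgeBase hφ R₀ c t e)) =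
      (L.base t).arr e.1.1 e.1.2 e.2 := fun e => congrArg Mfd.fib.snd (h1 e)
  have h3 : ∀ e : Edge m, Γ.h₁.src (R₁.sec (d e) (L.edgeBase hφ R₀ c t e)) =
      L.vert R₀ c t e.1.1 := fun e => congrArg (fun y : φ.pb₁ hφ.sub₀ => (Mfd.fib.fst y).1) (h1 e)
  have h4 : ∀ e : Edge m, Γ.h₁.tgt (R₁.sec (d e) (L.edgeBase hφ R₀ c t e)) =
      L.vert R₀ c t e.1.2 := fun e => congrArg (fun y : φ.pb₁ hφ.sub₀ => (Mfd.fib.fst y).2) (h1 e)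
  exact ⟨L.map_vert R₀ c t, fun i j h => L.src_arr i j h t _ _ (h3 ⟨(i, j), h⟩) (h2 ⟨(i, j), h⟩),
    fun i j h => L.tgt_arr i j h t _ _ (h4 ⟨(i, j), h⟩) (h2 ⟨(i, j), h⟩),
    fun i j h => L.map_arr i j h t _ (h2 ⟨(i, j), h⟩)⟩

/-- A random lift. -/
def lift (t : X) : Nerve Γ m := Nerve.lift hφ (L.base t) (L.vert R₀ c t) _ (L.isLift hφ R₀ R₁ c d t)

/-! ### Smoothness of random lifts near a point. -/

section Smooth

variable {P : Euc n → X} {x : Euc n} {R₀ c}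

theorem smoothPlot_base_obj {L : Filler φ X m} (hP : IsPlot P) (i : Fin (m + 1)) :
    Mfd.SmoothPlot fun z => (L.base (P z)).obj i := (L.base_smooth n P hP).1 i

theorem plotNear_vert {L : Filler φ X m} (hP : IsPlot P)
    (hc : ∀ i, (L.base (P x)).obj i ∈ R₀.dom (c i)) (i : Fin (m + 1)) :
    PlotNear (fun z => L.vert R₀ c (P z) i) x := by
  have h1 : PlotNear (fun z => (L.base (P z)).obj i) x :=
    plotNear_of_isPlot (Y := Δ.G₀) (smoothPlot_base_obj hP i) x
  exact (h1.comp_contMDiffOn (R₀.sec_smooth (c i)) (R₀.isOpen_dom (c i)) (hc i)).mono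
    fun s hs k f hf hfs => L.obj_smooth i (isPlot_reparam hP hf) (hs k f hf hfs)

theorem plotNear_edgeBase {L : Filler φ X m} (hP : IsPlot P)
    (hc : ∀ i, (L.base (P x)).obj i ∈ R₀.dom (c i)) (e : Edge m) :
    PlotNear (fun z => L.edgeBase hφ R₀ c (P z) e) x :=
  Mfd.plotNear_fib (Mfd.plotNear_prod (plotNear_vert hP hc _) (plotNear_vert hP hc _))
    (plotNear_of_isPlot (Y := Δ.G₁) ((L.base_smooth n P hP).2.1 e.1.1 e.1.2 e.2) x)

variable {R₁ d}

/-- If every chosen section is smooth around the point where it is applied, then the vertices and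
then the edges vary smoothly. The triangles follow, being smooth functions of the edges and the
base. -/
theorem plotNear_lift {L : Filler φ X m} (hP : IsPlot P)
    (hc : ∀ i, (L.base (P x)).obj i ∈ R₀.dom (c i))
    (hd : ∀ e, L.edgeBase hφ R₀ c (P x) e ∈ R₁.dom (d e)) :
    PlotNear (L.lift hφ R₀ R₁ c d ∘ P) x := by
  have h1 := fun i => plotNear_vert hP hc i
  have h2 : ∀ e : Edge m, PlotNear (fun z => L.edge hφ R₀ R₁ c d (P z) e.1.1 e.1.2 e.2) x :=
    fun e => ((plotNear_edgeBase hφ hP hc e).comp_contMDiffOn (R₁.sec_smooth (d e))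
      (R₁.isOpen_dom (d e)) (hd e)).mono
      fun s hs k f hf hfs => L.arr_smooth _ _ _ (isPlot_reparam hP hf) (hs k f hf hfs)
  filter_upwards [eventually_all.2 h1, eventually_all.2 h2] with s hs1 hs2 k f hf hfs
  exact Nerve.isPlot_lift hφ (fun z => L.isLift hφ R₀ R₁ c d (P (f z)))
    (L.base_smooth k _ (isPlot_reparam hP hf)) (fun i => hs1 i k f hf hfs)
    fun i j h => hs2 ⟨(i, j), h⟩ k f hf hfs

end Smooth

/-! ### The mean value of a form over random lifts. -/

theorem _root_.TwoGroupBundle.Mfd.RandomSection.mem_dom {M N : Mfd.{u}} {π : M → N}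
    (R : Mfd.RandomSection π) {i y : N} (h : R.weight i y ≠ 0) : y ∈ R.dom i :=
  R.tsupport_subset i (subset_tsupport _ h)

/-- The average of a form over all random lifts. -/
def transferAt (α : Form p (Nerve Γ m)) (n : ℕ) (P : Euc n → X) (x : Euc n) :
    Euc n [⋀^Fin p]→L[ℝ] ℝ :=
  average (fun i k => R₀.weight k ((L.base (P x)).obj i)) fun c =>
    -- The average over edges is nested inside that over vertices: the position of an edge in Δ₁[Γ₀]
    -- involves its lifted ends, so the inner weights depend on `c`.
    average (fun e k => R₁.weight k (L.edgeBase hφ R₀ c (P x) e)) fun d =>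
      α.germ (L.lift hφ R₀ R₁ c d ∘ P) x

/-- Closed supports of the weights lie in the domains of smoothness of the sections, which is what
`average_contDiffAt` requires at both levels. -/
theorem transferAt_contDiff (α : Form p (Nerve Γ m)) {P : Euc n → X} (hP : IsPlot P) :
    ContDiff ℝ ∞ (L.transferAt hφ R₀ R₁ α n P) := by
  refine contDiff_iff_contDiffAt.2 fun x => ?_
  refine average_contDiffAt R₀.weight
    (fun i => ContMDiff.contMDiffAt (smoothPlot_base_obj hP i)) fun c hc => ?_
  have hc' : ∀ i, (L.base (P x)).obj i ∈ R₀.dom (c i) := fun i => R₀.tsupport_subset _ (hc i)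
  refine average_contDiffAt R₁.weight
    (fun e => (plotNear_edgeBase hφ hP hc' e).contMDiffAt) fun d hd => ?_
  exact α.germ_contDiffAt (plotNear_lift hφ hP hc' fun e => R₁.tsupport_subset _ (hd e))

theorem transferAt_reparam (α : Form p (Nerve Γ m)) {k : ℕ} {P : Euc n → X} (hP : IsPlot P)
    {g : Euc k → Euc n} (hg : ContDiff ℝ ∞ g) :
    L.transferAt hφ R₀ R₁ α k (P ∘ g) = pull g (L.transferAt hφ R₀ R₁ α n P) := by
  funext z
  have hw₀ := fun i => SmoothPartitionOfUnity.isWeight R₀.weight ((L.base (P (g z))).obj i)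
  have hw₁ := fun c e => SmoothPartitionOfUnity.isWeight R₁.weight
    (L.edgeBase hφ R₀ c (P (g z)) e)
  -- Pullback by the derivative of `g` is linear on alternating forms, so it passes through both
  -- averages. The weights on the two sides are the same, being evaluated at the same point `P (g
  -- z)`.
  let Λ : (Euc n [⋀^Fin p]→L[ℝ] ℝ) →ₗ[ℝ] Euc k [⋀^Fin p]→L[ℝ] ℝ :=
    { toFun := fun β => β.compContinuousLinearMap (fderiv ℝ g z)
      map_add' := fun _ _ => rfl
      map_smul' := fun _ _ => rfl }
  refine Eq.trans ?_ ((map_average hw₀ Λ _).trans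
    (average_congr fun c _ => map_average (hw₁ c) Λ _)).symm
  refine average_congr fun c hc => average_congr fun d hd => ?_
  exact α.germ_reparam (ℓ := L.lift hφ R₀ R₁ c d ∘ P) hg
    (plotNear_lift hφ hP (fun i => R₀.mem_dom (hc i)) fun e => R₁.mem_dom (hd e))

/-- The average of a form over all random lifts. -/
def transfer (p : ℕ) : Form p (Nerve Γ m) →ₗ[ℝ] Form p X where
  toFun α := ⟨fun n P => L.transferAt hφ R₀ R₁ α n P.1,
    fun n P => L.transferAt_contDiff hφ R₀ R₁ α P.2,
    fun k n P g hg => L.transferAt_reparam hφ R₀ R₁ α P.2 hg⟩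
  map_add' α β := by
    refine Form.ext fun n P x => ?_
    have hw₀ := fun i => SmoothPartitionOfUnity.isWeight R₀.weight ((L.base (P.1 x)).obj i)
    have hw₁ := fun c e => SmoothPartitionOfUnity.isWeight R₁.weight
      (L.edgeBase hφ R₀ c (P.1 x) e)
    change L.transferAt hφ R₀ R₁ (α + β) n P.1 x =
      L.transferAt hφ R₀ R₁ α n P.1 x + L.transferAt hφ R₀ R₁ β n P.1 x
    refine Eq.trans ?_ (average_add hw₀ _ _)
    refine average_congr fun c _ => Eq.trans ?_ (average_add (hw₁ c) _ _)
    exact average_congr fun d _ => α.germ_add β _ _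
  map_smul' a α := by
    refine Form.ext fun n P x => ?_
    have hw₀ := fun i => SmoothPartitionOfUnity.isWeight R₀.weight ((L.base (P.1 x)).obj i)
    have hw₁ := fun c e => SmoothPartitionOfUnity.isWeight R₁.weight
      (L.edgeBase hφ R₀ c (P.1 x) e)
    let Λ : (Euc n [⋀^Fin p]→L[ℝ] ℝ) →ₗ[ℝ] Euc n [⋀^Fin p]→L[ℝ] ℝ := a • LinearMap.id
    change L.transferAt hφ R₀ R₁ (a • α) n P.1 x = Λ (L.transferAt hφ R₀ R₁ α n P.1 x)
    refine Eq.trans ?_ (map_average hw₀ Λ _).symm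
    refine average_congr fun c _ => Eq.trans ?_ (map_average (hw₁ c) Λ _).symm
    exact average_congr fun d _ => α.germ_smul a _ _

theorem transfer_reparam (g : Y → X) (hg : DSmooth g) (α : Form p (Nerve Γ m)) :
    (L.reparam g hg).transfer hφ R₀ R₁ p α =
      Form.pullback p g hg (L.transfer hφ R₀ R₁ p α) := rfl

/-- A face of a random lift involves only the choices at its own vertices and edges. The others are
summed out, for edges and for vertices separately. -/
theorem transfer_restrict (θ : Fin (r + 1) → Fin (m + 1)) (hθ : StrictMono θ)
    (α : Form p (Nerve Γ r)) :
    L.transfer hφ R₀ R₁ p (Form.pullback p (Nerve.restrict θ hθ) (Nerve.dSmooth_restrict θ hθ) α) =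
      (L.restrict θ hθ).transfer hφ R₀ R₁ p α := by
  refine Form.ext fun n P x => ?_
  have hw₀ := fun i => SmoothPartitionOfUnity.isWeight R₀.weight ((L.base (P.1 x)).obj i)
  have hw₁ := fun c e => SmoothPartitionOfUnity.isWeight R₁.weight
    (L.edgeBase hφ R₀ c (P.1 x) e)
  refine (average_congr fun c hc => (average_congr fun d hd => α.germ_pullback
    (plotNear_lift hφ P.2 (fun i => R₀.mem_dom (hc i)) fun e => R₁.mem_dom (hd e))
    (Nerve.dSmooth_restrict θ hθ)).trans ?_).trans
    (average_comp_injective hw₀ hθ.injective fun c' =>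
      average (fun e k => R₁.weight k ((L.restrict θ hθ).edgeBase hφ R₀ c' (P.1 x) e)) fun d' =>
        α.germ ((L.restrict θ hθ).lift hφ R₀ R₁ c' d' ∘ P.1) x)
  -- With the vertices fixed, the edges outside the face are summed out.
  exact average_comp_injective (hw₁ c) (Edge.map_injective hθ) fun d' =>
    α.germ ((L.restrict θ hθ).lift hφ R₀ R₁ (c ∘ θ) d' ∘ P.1) x

/-- If the image of the lift under `K` does not depend on the random choices, a constant is being
averaged. This covers both the projection to Δ and lifts in which everything is prescribed. -/
theorem transfer_of_lift_eq {K : Nerve Γ m → Y} (hK : DSmooth K) {k : X → Y} (hk : DSmooth k)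
    (h : ∀ c d t, K (L.lift hφ R₀ R₁ c d t) = k t) (α : Form p Y) :
    L.transfer hφ R₀ R₁ p (Form.pullback p K hK α) = Form.pullback p k hk α := by
  refine Form.ext fun n P x => ?_
  have hw₀ := fun i => SmoothPartitionOfUnity.isWeight R₀.weight ((L.base (P.1 x)).obj i)
  have hw₁ := fun c e => SmoothPartitionOfUnity.isWeight R₁.weight
    (L.edgeBase hφ R₀ c (P.1 x) e)
  refine (average_congr fun c hc => ?_).trans (average_const hw₀ _)
  refine (average_congr fun d hd => ?_).trans (average_const (hw₁ c) _)
  refine (α.germ_pullback (plotNear_lift hφ P.2 (fun i => R₀.mem_dom (hc i))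
    fun e => R₁.mem_dom (hd e)) hK).trans ?_
  exact α.germ_eq (hk n _ P.2) (Eventually.of_forall fun z => h c d (P.1 z))

theorem transfer_map (α : Form p (Nerve Δ m)) :
    L.transfer hφ R₀ R₁ p (Form.pullback p (Nerve.map φ) (Nerve.dSmooth_map φ) α) =
      Form.pullback p L.base L.base_smooth α :=
  L.transfer_of_lift_eq hφ R₀ R₁ _ L.base_smooth (fun c d t => Nerve.map_lift hφ _) α

end Filler

end Transfer

/-! ### The homotopy inverse of the pullback along a Morita morphism -/

section Prism

variable {Γ Δ : Lie2Groupoid.{u}} {φ : Hom Γ Δ} {X : Type u} [DiffeologicalSpace X] {m q r p : ℕ}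

theorem Filler.ext_data {L L' : Filler φ X m} (h : L.base = L'.base) (h' : L.obj = L'.obj)
    (h'' : L.arr = L'.arr) : L = L' := by
  cases L
  cases L'
  dsimp only at h h' h''
  subst h h' h''
  rfl

/-- The problem of lifting all simplices of `Δ`. -/
def Filler.free (φ : Hom Γ Δ) (m : ℕ) : Filler φ (Nerve Δ m) m where
  base y := y
  obj _ _ x := x
  arr _ _ _ _ e := e
  base_smooth := dSmooth_id
  obj_smooth _ _ hx := hx
  arr_smooth _ _ _ _ hx := hx
  map_obj _ _ _ h := h
  src_arr _ _ _ _ _ _ h _ := h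
  tgt_arr _ _ _ _ _ _ h _ := h
  map_arr _ _ _ _ _ h := h

/-! ### Lifts with some vertices prescribed and the others random. -/

/-- A weakly increasing map which is strictly increasing on the vertices which are not marked. -/
structure IsPattern (θ : Fin (m + 1) → Fin (q + 1)) (B : Fin (m + 1) → Bool) : Prop where
  monotone : Monotone θ
  lt : ∀ i j, i < j → ¬(B i ∨ B j) → θ i < θ j

/-- The problem of lifting a degenerate simplex in the image of `Γ`, where the lifts of the vertices
which are not marked are prescribed. -/
def Filler.mixed (φ : Hom Γ Δ) {θ : Fin (m + 1) → Fin (q + 1)} {B : Fin (m + 1) → Bool}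
    (hθ : IsPattern θ B) : Filler φ (Nerve Γ q) m where
  base z := (Nerve.map φ z).degen θ hθ.monotone
  obj i z x := if B i then x else z.obj (θ i)
  -- Between two unmarked vertices `θ` is strict, so `z` has an edge there and it is prescribed. An
  -- edge with a marked end stays random.
  arr i j h z e := if hB : B i ∨ B j then e else z.arr (θ i) (θ j) (hθ.lt i j h hB)
  base_smooth := (Nerve.dSmooth_degen _ _).comp (Nerve.dSmooth_map φ)
  obj_smooth i hP hx := by
    split
    · exact hx
    · exact hP.1 _
  arr_smooth i j h hP hx := by
    split
    · exact hx
    · exact hP.2.1 _ _ _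
  map_obj i z x h := by
    split
    · exact h
    · rfl
  src_arr i j h z x e he he' := by
    split
    · exact he
    next hB =>
      rw [if_neg fun hi => hB (Or.inl hi)]
      exact z.src_arr _ _ _
  tgt_arr i j h z x e he he' := by
    split
    · exact he
    next hB =>
      rw [if_neg fun hi => hB (Or.inr hi)]
      exact z.tgt_arr _ _ _
  map_arr i j h z e he := by
    split
    · exact he
    next hB => exact ((Nerve.map φ z).arrLe_of_lt (hθ.lt i j h hB)).symm

theorem Filler.mixed_obj_neg (φ : Hom Γ Δ) {θ : Fin (m + 1) → Fin (q + 1)}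
    {B : Fin (m + 1) → Bool} (hθ : IsPattern θ B) {i : Fin (m + 1)} (hi : ¬B i) (z : Nerve Γ q)
    (x : Γ.G₀) : (Filler.mixed φ hθ).obj i z x = z.obj (θ i) := if_neg hi

theorem Filler.mixed_obj_pos (φ : Hom Γ Δ) {θ : Fin (m + 1) → Fin (q + 1)}
    {B : Fin (m + 1) → Bool} (hθ : IsPattern θ B) {i : Fin (m + 1)} (hi : B i) (z : Nerve Γ q)
    (x : Γ.G₀) : (Filler.mixed φ hθ).obj i z x = x := if_pos hi

theorem Filler.mixed_arr_neg (φ : Hom Γ Δ) {θ : Fin (m + 1) → Fin (q + 1)}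
    {B : Fin (m + 1) → Bool} (hθ : IsPattern θ B) {i j : Fin (m + 1)} (h : i < j)
    (hB : ¬(B i ∨ B j)) (z : Nerve Γ q) (e : Γ.G₁) :
    (Filler.mixed φ hθ).arr i j h z e = z.arr (θ i) (θ j) (hθ.lt i j h hB) := dif_neg hB

theorem Filler.mixed_arr_pos (φ : Hom Γ Δ) {θ : Fin (m + 1) → Fin (q + 1)}
    {B : Fin (m + 1) → Bool} (hθ : IsPattern θ B) {i j : Fin (m + 1)} (h : i < j)
    (hB : B i ∨ B j) (z : Nerve Γ q) (e : Γ.G₁) :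
    (Filler.mixed φ hθ).arr i j h z e = e := dif_pos hB

theorem IsPattern.comp_strictMono {θ : Fin (m + 1) → Fin (q + 1)} {B : Fin (m + 1) → Bool}
    (h : IsPattern θ B) {η : Fin (r + 1) → Fin (m + 1)} (hη : StrictMono η) :
    IsPattern (θ ∘ η) (B ∘ η) :=
  ⟨h.monotone.comp hη.monotone, fun i j hij => h.lt _ _ (hη hij)⟩

theorem IsPattern.strictMono_comp {θ : Fin (m + 1) → Fin (q + 1)} {B : Fin (m + 1) → Bool}
    (h : IsPattern θ B) {η : Fin (q + 1) → Fin (r + 1)} (hη : StrictMono η) :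
    IsPattern (η ∘ θ) B :=
  ⟨hη.monotone.comp h.monotone, fun i j hij hB => hη (h.lt i j hij hB)⟩

variable (hφ : φ.IsMorita) (R₀ : Mfd.RandomSection φ.f₀)
  (R₁ : Mfd.RandomSection (φ.toPb₁ hφ.sub₀))

/-- The average over random lifts of simplices of `Δ`. -/
def randomLift (p q : ℕ) : Form p (Nerve Γ q) →ₗ[ℝ] Form p (Nerve Δ q) :=
  (Filler.free φ q).transfer hφ R₀ R₁ p

open Classical in
/-- The average over random lifts of degenerate simplices with prescribed lifts of the vertices which
are not marked. -/
def patternLift (p : ℕ) (θ : Fin (m + 1) → Fin (q + 1)) (B : Fin (m + 1) → Bool) :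
    Form p (Nerve Γ m) →ₗ[ℝ] Form p (Nerve Γ q) :=
  -- The value 0 off patterns is never used. It makes the operator depend on `θ` and `B` alone, so
  -- that combinatorial identities between these can be substituted.
  if h : IsPattern θ B then (Filler.mixed φ h).transfer hφ R₀ R₁ p else 0

theorem randomLift_pullback (α : Form p (Nerve Δ q)) :
    randomLift hφ R₀ R₁ p q (Form.pullback p (Nerve.map φ) (Nerve.dSmooth_map φ) α) = α :=
  (Filler.free φ q).transfer_map hφ R₀ R₁ α

/-- Averaging over lifts of a simplex and then keeping a face amounts to averaging over lifts of
that face; hence A commutes with ∂. -/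
theorem randomLift_restrict (θ : Fin (r + 1) → Fin (q + 1)) (hθ : StrictMono θ)
    (α : Form p (Nerve Γ r)) :
    randomLift hφ R₀ R₁ p q
        (Form.pullback p (Nerve.restrict θ hθ) (Nerve.dSmooth_restrict θ hθ) α) =
      Form.pullback p (Nerve.restrict θ hθ) (Nerve.dSmooth_restrict θ hθ)
        (randomLift hφ R₀ R₁ p r α) :=
  ((Filler.free φ q).transfer_restrict hφ R₀ R₁ θ hθ α).trans
    ((Filler.free φ r).transfer_reparam hφ R₀ R₁ _ (Nerve.dSmooth_restrict θ hθ) α)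

theorem patternLift_eq {θ : Fin (m + 1) → Fin (q + 1)} {B : Fin (m + 1) → Bool}
    (h : IsPattern θ B) :
    patternLift hφ R₀ R₁ p θ B = (Filler.mixed φ h).transfer hφ R₀ R₁ p := dif_pos h

theorem patternLift_restrict {θ : Fin (m + 1) → Fin (q + 1)} {B : Fin (m + 1) → Bool}
    (h : IsPattern θ B) {η : Fin (r + 1) → Fin (m + 1)} (hη : StrictMono η)
    (α : Form p (Nerve Γ r)) :
    patternLift hφ R₀ R₁ p θ B
        (Form.pullback p (Nerve.restrict η hη) (Nerve.dSmooth_restrict η hη) α) =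
      patternLift hφ R₀ R₁ p (θ ∘ η) (B ∘ η) α := by
  rw [patternLift_eq hφ R₀ R₁ h, patternLift_eq hφ R₀ R₁ (h.comp_strictMono hη)]
  exact (Filler.mixed φ h).transfer_restrict hφ R₀ R₁ η hη α

/-- Pullback along a face of the parameter simplex only changes which vertices of it are repeated.
-/
theorem restrict_patternLift {θ : Fin (m + 1) → Fin (q + 1)} {B : Fin (m + 1) → Bool}
    (h : IsPattern θ B) {η : Fin (q + 1) → Fin (r + 1)} (hη : StrictMono η)
    (α : Form p (Nerve Γ m)) :
    Form.pullback p (Nerve.restrict η hη) (Nerve.dSmooth_restrict η hη)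
        (patternLift hφ R₀ R₁ p θ B α) =
      patternLift hφ R₀ R₁ p (η ∘ θ) B α := by
  rw [patternLift_eq hφ R₀ R₁ h, patternLift_eq hφ R₀ R₁ (h.strictMono_comp hη),
    ← Filler.transfer_reparam]
  congr 2
  -- The prescribed vertices and edges coincide by definition; only the degenerate base simplices
  -- have to be compared.
  refine Filler.ext_data ?_ rfl rfl
  funext z
  exact Nerve.degen_restrict η hη θ h.monotone (Nerve.map φ z)

/-- Without marked vertices nothing is random, and the lift is the given simplex of Γ itself. -/
theorem patternLift_unmarked (α : Form p (Nerve Γ q)) :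
    patternLift hφ R₀ R₁ p id (fun _ => false) α = α := by
  have h : IsPattern (id : Fin (q + 1) → Fin (q + 1)) fun _ => false :=
    ⟨monotone_id, fun i j hij _ => hij⟩
  rw [patternLift_eq hφ R₀ R₁ h]
  refine (Filler.mixed φ h).transfer_of_lift_eq hφ R₀ R₁ (K := id) dSmooth_id (k := id) dSmooth_id
    (fun c d t => ?_) α
  refine Eq.trans ?_ (Nerve.lift_map hφ t (Nerve.isLift_map t))
  refine Nerve.lift_congr hφ _ _ ?_ ?_ ?_
  · exact (Nerve.degen_of_strictMono strictMono_id _)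
  · funext i
    exact Filler.mixed_obj_neg φ h Bool.false_ne_true t _
  · funext i j hij
    exact Filler.mixed_arr_neg φ h hij (not_or.2 ⟨Bool.false_ne_true, Bool.false_ne_true⟩) t _

/-- When all vertices are marked nothing is prescribed, so the lifts are random lifts of the image
simplex in Δ. -/
theorem patternLift_marked (α : Form p (Nerve Γ q)) :
    patternLift hφ R₀ R₁ p id (fun _ => true) α =
      Form.pullback p (Nerve.map φ) (Nerve.dSmooth_map φ) (randomLift hφ R₀ R₁ p q α) := by
  have h : IsPattern (id : Fin (q + 1) → Fin (q + 1)) fun _ => true :=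
    ⟨monotone_id, fun i j hij _ => hij⟩
  rw [patternLift_eq hφ R₀ R₁ h]
  refine Eq.trans ?_ ((Filler.free φ q).transfer_reparam hφ R₀ R₁ _ (Nerve.dSmooth_map φ) α)
  congr 2
  refine Filler.ext_data ?_ ?_ ?_
  · funext z
    exact (Nerve.degen_of_strictMono strictMono_id _)
  · funext i z x
    exact Filler.mixed_obj_pos φ h rfl z x
  · funext i j hij z e
    exact Filler.mixed_arr_pos φ h hij (Or.inl rfl) z e

/-! ### Combinatorics of prisms and the simplicial homotopy. -/

/-- The weakly increasing map `{0, …, q + 1} → {0, …, q}` which takes the value `i` twice. -/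
def repeatAt (q i : ℕ) (j : Fin (q + 2)) : Fin (q + 1) :=
  -- The truncation by `q` only keeps the value admissible for `i > q`; it is inactive for `i ≤ q`.
  ⟨min (if j.1 ≤ i then j.1 else j.1 - 1) q, by omega⟩

theorem repeatAt_val {q i : ℕ} (hi : i ≤ q) (j : Fin (q + 2)) :
    (repeatAt q i j).1 = if j.1 ≤ i then j.1 else j.1 - 1 := by
  have := j.2
  simp only [repeatAt]
  split <;> omega

/-- The marking of the vertices after the first `i` ones. -/
def markFrom {q : ℕ} (i : ℕ) (j : Fin (q + 1)) : Bool := decide (i ≤ j.1)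

/-- The unmarked vertices are those up to `i`, where the map does not change values. The value `i`
is repeated at `i + 1`, which is marked: the prism joins the prescribed vertex to a random lift of
its image. -/
theorem isPattern_repeatAt {q i : ℕ} (hi : i ≤ q) :
    IsPattern (repeatAt q i) (markFrom (i + 1)) := by
  constructor
  · intro a b hab
    have h' : a.1 ≤ b.1 := hab
    rw [Fin.le_def, repeatAt_val hi, repeatAt_val hi]
    split <;> split <;> omega
  · intro a b hab hB
    have h' : a.1 < b.1 := hab
    simp only [markFrom, decide_eq_true_eq, not_or, not_le] at hB
    rw [Fin.lt_def, repeatAt_val hi, repeatAt_val hi, if_pos (by omega), if_pos (by omega)]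
    exact h'

theorem skip_val (q i : ℕ) (j : Fin (q + 1)) :
    (Nerve.skip q i j).1 = if j.1 < i then j.1 else j.1 + 1 := rfl

/-- The alternating sum identity for prisms. -/
theorem prism_sum {V : Type*} [AddCommGroup V] [Module ℝ V] (F G : ℕ → ℕ → V) (E : ℕ → V) (r : ℕ)
    (hlt : ∀ i j, j ≤ i → i ≤ r → F (i + 1) j = G j i)
    (hgt : ∀ i j, i < j → j ≤ r + 1 → F i (j + 1) = G j i)
    (h0 : ∀ i, i ≤ r + 1 → F i i = E i) (h1 : ∀ i, i ≤ r + 1 → F i (i + 1) = E (i + 1)) :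
    ∑ i ∈ Finset.range (r + 2), ((-1 : ℝ) ^ i) • ∑ j ∈ Finset.range (r + 3),
        ((-1 : ℝ) ^ j) • F i j +
      ∑ i ∈ Finset.range (r + 1), ((-1 : ℝ) ^ i) • ∑ j ∈ Finset.range (r + 2),
        ((-1 : ℝ) ^ j) • G j i = E 0 - E (r + 2) := by
  -- Off-diagonal parts of row `i` of the first double sum: `a i` collects the terms with `j < i`,
  -- and `b i` those with `j ≥ i + 2`.
  let a : ℕ → V := fun i => ((-1 : ℝ) ^ i) • ∑ j ∈ Finset.range i, ((-1 : ℝ) ^ j) • F i j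
  let b : ℕ → V := fun i => ((-1 : ℝ) ^ i) • ∑ j ∈ Finset.range (r + 1 - i),
    ((-1 : ℝ) ^ (i + 2 + j)) • F i (i + 2 + j)
  -- The two middle terms `j = i` and `j = i + 1` of row `i` have opposite signs and leave a
  -- difference that telescopes over `i`.
  have hF : ∀ i ∈ Finset.range (r + 2), ((-1 : ℝ) ^ i) • ∑ j ∈ Finset.range (r + 3),
      ((-1 : ℝ) ^ j) • F i j = (E i - E (i + 1)) + (a i + b i) := by
    intro i hi
    have hi' : i ≤ r + 1 := Nat.lt_succ_iff.1 (Finset.mem_range.1 hi)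
    have e : r + 3 = (i + 2) + (r + 1 - i) := by omega
    rw [e, Finset.sum_range_add, Finset.sum_range_succ _ (i + 1), Finset.sum_range_succ _ i,
      h0 i hi', h1 i hi']
    have hs := neg_one_pow_mul_self' i
    simp only [a, b, smul_add, smul_smul, pow_succ]
    rw [← mul_assoc, hs]
    module
  -- The second double sum matches the off-diagonal terms with the opposite sign; those below the
  -- diagonal are shifted by one row.
  have hG : ∀ i ∈ Finset.range (r + 1), ((-1 : ℝ) ^ i) • ∑ j ∈ Finset.range (r + 2),
      ((-1 : ℝ) ^ j) • G j i = -(a (i + 1) + b i) := by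
    intro i hi
    have hi' : i ≤ r := Nat.lt_succ_iff.1 (Finset.mem_range.1 hi)
    have e : r + 2 = (i + 1) + (r + 1 - i) := by omega
    rw [e, Finset.sum_range_add]
    have e1 : ∑ j ∈ Finset.range (i + 1), ((-1 : ℝ) ^ j) • G j i =
        ∑ j ∈ Finset.range (i + 1), ((-1 : ℝ) ^ j) • F (i + 1) j :=
      Finset.sum_congr rfl fun j hj => by
        rw [hlt i j (Nat.lt_succ_iff.1 (Finset.mem_range.1 hj)) hi']
    have e2 : ∑ j ∈ Finset.range (r + 1 - i), ((-1 : ℝ) ^ (i + 1 + j)) • G (i + 1 + j) i =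
        -∑ j ∈ Finset.range (r + 1 - i), ((-1 : ℝ) ^ (i + 2 + j)) • F i (i + 2 + j) := by
      rw [← Finset.sum_neg_distrib]
      refine Finset.sum_congr rfl fun j hj => ?_
      have hj' := Finset.mem_range.1 hj
      have e3 : i + 2 + j = i + 1 + j + 1 := by ring
      rw [e3, hgt i (i + 1 + j) (by omega) (by omega), pow_succ]
      module
    rw [e1, e2]
    simp only [a, b, pow_succ]
    module
  rw [Finset.sum_congr rfl hF, Finset.sum_congr rfl hG, Finset.sum_add_distrib,
    Finset.sum_range_sub', Finset.sum_neg_distrib, Finset.sum_add_distrib, Finset.sum_add_distrib,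
    Finset.sum_range_succ' a (r + 1), Finset.sum_range_succ b (r + 1)]
  -- The two unmatched terms are empty sums, so the off-diagonal parts cancel completely.
  have ha : a 0 = 0 := by simp [a]
  have hb : b (r + 1) = 0 := by simp [b]
  rw [ha, hb]
  abel

/-- The prism operator `Ω^p(N_{q+1} Γ) → Ω^p(N_q Γ)`. -/
def prism (p q : ℕ) : Form p (Nerve Γ (q + 1)) →ₗ[ℝ] Form p (Nerve Γ q) :=
  ∑ i ∈ Finset.range (q + 1), ((-1 : ℝ) ^ i) •
    patternLift hφ R₀ R₁ p (repeatAt q i) (markFrom (i + 1))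

theorem patternLift_face {i : ℕ} (hi : i ≤ q) (j : ℕ) (α : Form p (Nerve Γ q)) :
    patternLift hφ R₀ R₁ p (repeatAt q i) (markFrom (i + 1))
        (Form.pullback p (Nerve.face Γ q j) (Nerve.dSmooth_face _ _) α) =
      patternLift hφ R₀ R₁ p (repeatAt q i ∘ Nerve.skip q j)
        (markFrom (i + 1) ∘ Nerve.skip q j) α :=
  patternLift_restrict hφ R₀ R₁ (isPattern_repeatAt hi) (Nerve.skip_strictMono q j) α

theorem face_patternLift {i : ℕ} (hi : i ≤ q) (j : ℕ) (α : Form p (Nerve Γ (q + 1))) :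
    Form.pullback p (Nerve.face Γ q j) (Nerve.dSmooth_face _ _)
        (patternLift hφ R₀ R₁ p (repeatAt q i) (markFrom (i + 1)) α) =
      patternLift hφ R₀ R₁ p (Nerve.skip q j ∘ repeatAt q i) (markFrom (i + 1)) α :=
  restrict_patternLift hφ R₀ R₁ (isPattern_repeatAt hi) (Nerve.skip_strictMono q j) α

/-- Omitting either copy of the repeated vertex undoes the repetition. The two cases differ in the
marking: without the unmarked copy, the random vertices start at `i`; without the marked copy, at `i
+ 1`. -/
theorem repeatAt_skip_self {i : ℕ} (hi : i ≤ q) : repeatAt q i ∘ Nerve.skip q i = id := by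
  funext k
  apply Fin.ext
  simp only [Function.comp_apply, repeatAt_val hi, skip_val, id]
  split_ifs <;> omega

theorem repeatAt_skip_succ {i : ℕ} (hi : i ≤ q) : repeatAt q i ∘ Nerve.skip q (i + 1) = id := by
  funext k
  apply Fin.ext
  simp only [Function.comp_apply, repeatAt_val hi, skip_val, id]
  split_ifs <;> omega

theorem markFrom_skip_self (i : ℕ) : markFrom (i + 1) ∘ Nerve.skip q i = markFrom i := by
  funext k
  refine decide_eq_decide.2 ?_
  rw [skip_val]
  split_ifs <;> omega

theorem markFrom_skip_of_lt {i j : ℕ} (h : i < j) :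
    markFrom (i + 1) ∘ Nerve.skip q j = markFrom (i + 1) := by
  funext k
  refine decide_eq_decide.2 ?_
  rw [skip_val]
  split_ifs <;> omega

theorem markFrom_skip_of_le {i j : ℕ} (h : j ≤ i) :
    markFrom (i + 1) ∘ Nerve.skip q j = markFrom i := by
  funext k
  refine decide_eq_decide.2 ?_
  rw [skip_val]
  split_ifs <;> omega

/-- One of the two simplicial identities between faces and degeneracies: a face at or before the
repetition can be taken first, which shifts the place of the repetition by one. -/
theorem repeatAt_skip_of_le {i j : ℕ} (h : j ≤ i) (hi : i ≤ q) :
    repeatAt (q + 1) (i + 1) ∘ Nerve.skip (q + 1) j = Nerve.skip q j ∘ repeatAt q i := by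
  funext k
  apply Fin.ext
  have := k.2
  simp only [Function.comp_apply, repeatAt_val (Nat.succ_le_succ hi), repeatAt_val hi, skip_val]
  split_ifs <;> omega

theorem repeatAt_skip_of_lt {i j : ℕ} (h : i < j) (hi : j ≤ q + 1) :
    repeatAt (q + 1) i ∘ Nerve.skip (q + 1) (j + 1) = Nerve.skip q j ∘ repeatAt q i := by
  funext k
  apply Fin.ext
  have := k.2
  simp only [Function.comp_apply, repeatAt_val (show i ≤ q + 1 by omega),
    repeatAt_val (show i ≤ q by omega), skip_val]
  split_ifs <;> omega

theorem prism_boundary_aux (q : ℕ) (α : Form p (Nerve Γ q)) :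
    prism hφ R₀ R₁ p q (∑ j ∈ Finset.range (q + 2), ((-1 : ℝ) ^ j) •
        Form.pullback p (Nerve.face Γ q j) (Nerve.dSmooth_face _ _) α) =
      ∑ i ∈ Finset.range (q + 1), ((-1 : ℝ) ^ i) • ∑ j ∈ Finset.range (q + 2), ((-1 : ℝ) ^ j) •
        patternLift hφ R₀ R₁ p (repeatAt q i ∘ Nerve.skip q j)
          (markFrom (i + 1) ∘ Nerve.skip q j) α := by
  rw [prism, LinearMap.sum_apply]
  refine Finset.sum_congr rfl fun i hi => ?_
  rw [LinearMap.smul_apply, map_sum]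
  congr 1
  refine Finset.sum_congr rfl fun j _ => ?_
  rw [map_smul, patternLift_face hφ R₀ R₁ (Nat.lt_succ_iff.1 (Finset.mem_range.1 hi))]

theorem patternLift_markFrom_zero (α : Form p (Nerve Γ q)) :
    patternLift hφ R₀ R₁ p id (markFrom 0) α =
      Form.pullback p (Nerve.map φ) (Nerve.dSmooth_map φ) (randomLift hφ R₀ R₁ p q α) := by
  rw [← patternLift_marked]
  congr 2

theorem patternLift_markFrom_last (α : Form p (Nerve Γ q)) :
    patternLift hφ R₀ R₁ p id (markFrom (q + 1)) α = α := by
  have : (markFrom (q + 1) : Fin (q + 1) → Bool) = fun _ => false := by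
    funext k
    have := k.2
    simp only [markFrom, decide_eq_false_iff_not]
    omega
  rw [this, patternLift_unmarked]

/-- In degree zero the prism is a single edge from the given vertex to a random lift of its image.
Its faces are these two ends, and there is no second prism term. -/
theorem prism_boundary_zero (α : Form p (Nerve Γ 0)) :
    prism hφ R₀ R₁ p 0 (∑ j ∈ Finset.range 2, ((-1 : ℝ) ^ j) •
        Form.pullback p (Nerve.face Γ 0 j) (Nerve.dSmooth_face _ _) α) =
      Form.pullback p (Nerve.map φ) (Nerve.dSmooth_map φ) (randomLift hφ R₀ R₁ p 0 α) - α := by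
  rw [prism_boundary_aux, Finset.sum_range_one, Finset.sum_range_succ, Finset.sum_range_one,
    repeatAt_skip_self le_rfl, repeatAt_skip_succ le_rfl, markFrom_skip_self,
    markFrom_skip_of_lt (Nat.lt_succ_self 0), patternLift_markFrom_zero]
  rw [patternLift_markFrom_last]
  module

/-- At stage `i` the vertices from `i` on are random. The inner faces of the prisms cancel and the
stages telescope from stage 0, where everything is random, to the last stage, where nothing is. -/
theorem prism_boundary_succ (r : ℕ) (α : Form p (Nerve Γ (r + 1))) :
    prism hφ R₀ R₁ p (r + 1) (∑ j ∈ Finset.range (r + 3), ((-1 : ℝ) ^ j) •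
        Form.pullback p (Nerve.face Γ (r + 1) j) (Nerve.dSmooth_face _ _) α) +
      ∑ j ∈ Finset.range (r + 2), ((-1 : ℝ) ^ j) •
        Form.pullback p (Nerve.face Γ r j) (Nerve.dSmooth_face _ _) (prism hφ R₀ R₁ p r α) =
      Form.pullback p (Nerve.map φ) (Nerve.dSmooth_map φ) (randomLift hφ R₀ R₁ p (r + 1) α) -
        α := by
  have key := prism_sum
    (fun i j => patternLift hφ R₀ R₁ p (repeatAt (r + 1) i ∘ Nerve.skip (r + 1) j)
      (markFrom (i + 1) ∘ Nerve.skip (r + 1) j) α)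
    (fun j i => patternLift hφ R₀ R₁ p (Nerve.skip r j ∘ repeatAt r i) (markFrom (i + 1)) α)
    (fun i => patternLift hφ R₀ R₁ p id (markFrom i) α) r
    (fun i j hj hi => by
      rw [repeatAt_skip_of_le hj hi, markFrom_skip_of_le (by omega)])
    (fun i j hi hj => by
      rw [repeatAt_skip_of_lt hi hj, markFrom_skip_of_lt (by omega)])
    (fun i hi => by
      rw [repeatAt_skip_self hi, markFrom_skip_self])
    (fun i hi => by
      rw [repeatAt_skip_succ hi, markFrom_skip_of_lt (Nat.lt_succ_self i)])
  rw [← patternLift_markFrom_zero]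
  refine Eq.trans (congrArg₂ (· + ·) (prism_boundary_aux hφ R₀ R₁ (r + 1) α) ?_)
    (key.trans (congrArg₂ (· - ·) rfl (patternLift_markFrom_last hφ R₀ R₁ α)))
  have e : ∀ j, Form.pullback p (Nerve.face Γ r j) (Nerve.dSmooth_face _ _)
      (prism hφ R₀ R₁ p r α) = ∑ i ∈ Finset.range (r + 1), ((-1 : ℝ) ^ i) •
        patternLift hφ R₀ R₁ p (Nerve.skip r j ∘ repeatAt r i) (markFrom (i + 1)) α := by
    intro j
    rw [prism, LinearMap.sum_apply, map_sum]
    refine Finset.sum_congr rfl fun i hi => ?_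
    rw [LinearMap.smul_apply, map_smul,
      face_patternLift hφ R₀ R₁ (Nat.lt_succ_iff.1 (Finset.mem_range.1 hi))]
  simp only [e, Finset.smul_sum]
  rw [Finset.sum_comm]
  refine Finset.sum_congr rfl fun i _ => Finset.sum_congr rfl fun j _ => ?_
  rw [smul_comm]

end Prism

/-! ### Morita morphisms induce isomorphisms in cohomology -/

section Filtered

variable {V W : Type*} [AddCommGroup V] [Module ℝ V] [AddCommGroup W] [Module ℝ W]

/-- A contraction of the first part of a differential `δ + ∂` onto the image of `f`, up to an operator
which lowers a filtration, gives representatives in the image of `f`. -/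
theorem exists_sub_mem_range {D : V →ₗ[ℝ] V} {D' : W →ₗ[ℝ] W} {f : W →ₗ[ℝ] V} {A : V →ₗ[ℝ] W}
    {K N : V →ₗ[ℝ] V} {F : ℕ → Submodule ℝ V} (hF : F 0 = ⊥)
    (hN : ∀ k, ∀ x ∈ F (k + 1), N x ∈ F k) (hD : ∀ x, D (D x) = 0) (hf : ∀ y, D (f y) = f (D' y))
    (hKf : ∀ y, K (f y) = 0) (hK : ∀ x, D (K x) + K (D x) = x - f (A x) + N x) (k : ℕ) :
    ∀ x ∈ F k, D x ∈ LinearMap.range f → ∃ z, x - D z ∈ LinearMap.range f := by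
  induction k with
  | zero =>
    intro x hx _
    rw [hF, Submodule.mem_bot] at hx
    exact ⟨0, 0, by simp [hx]⟩
  | succ k ih =>
    rintro x hx ⟨b, hb⟩
    -- As `D x` lies in the image of `f`, where `K` vanishes, the term `K (D x)` disappears.
    have h1 : D (K x) = x - f (A x) + N x := by
      rw [← hK x, ← hb, hKf, add_zero]
    -- The identity `D (D (K x)) = 0` shows that the error `N x` satisfies the same hypothesis as
    -- `x`, one step lower in the filtration.
    have h2 : D (N x) = f (D' (A x) - b) := by
      have := hD (K x)
      rw [h1, map_add, map_sub, hf, ← hb] at this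
      rw [map_sub, ← sub_eq_zero, ← this]
      abel
    -- Up to the coboundary of `K x`, the element `x` is `f (A x) - N x`; the induction hypothesis
    -- disposes of the second term.
    obtain ⟨z, c, hc⟩ := ih (-N x) (neg_mem (hN k x hx)) ⟨-(D' (A x) - b), by
      rw [map_neg, map_neg, h2]⟩
    refine ⟨K x + z, A x + c, ?_⟩
    rw [map_add, map_add, hc, h1]
    abel

end Filtered

/-! ### The total complex, its two differentials and its filtration. -/

section MoritaInvariance

variable {Γ Δ : Lie2Groupoid.{u}}

/-- The de Rham differential on the total complex. -/
def Tot.dR (Γ : Lie2Groupoid.{u}) : Tot Γ →ₗ[ℝ] Tot Γ :=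
  Tot.desc fun p q => Tot.of Γ (p + 1) q ∘ₗ Form.d p

/-- The simplicial differential on the total complex. -/
def Tot.simplicial (Γ : Lie2Groupoid.{u}) : Tot Γ →ₗ[ℝ] Tot Γ :=
  Tot.desc fun p q => Tot.of Γ p (q + 1) ∘ₗ simpDiff Γ p q

theorem Tot.D_eq (x : Tot Γ) : Tot.D Γ x = Tot.dR Γ x + Tot.simplicial Γ x := by
  suffices h : Tot.D Γ = Tot.dR Γ + Tot.simplicial Γ from
    congrArg (fun L : Tot Γ →ₗ[ℝ] Tot Γ => L x) h
  refine Tot.hom_ext fun p q α => ?_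
  simp only [Tot.D, Tot.dR, Tot.simplicial, LinearMap.add_apply, Tot.desc_of]

theorem Tot.simplicial_pullback (f : Hom Γ Δ) (x : Tot Δ) :
    Tot.simplicial Γ (Tot.pullback f x) = Tot.pullback f (Tot.simplicial Δ x) := by
  suffices h : Tot.simplicial Γ ∘ₗ Tot.pullback f = Tot.pullback f ∘ₗ Tot.simplicial Δ from
    congrArg (fun L : Tot Δ →ₗ[ℝ] Tot Γ => L x) h
  refine Tot.hom_ext fun p q α => ?_
  simp only [LinearMap.comp_apply, Tot.simplicial, Tot.pullback, Tot.desc_of]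
  congr 1
  simp only [simpDiff, LinearMap.smul_apply, LinearMap.sum_apply, map_smul, map_sum]
  rfl

theorem Form.d_d {Y : Type u} [DiffeologicalSpace Y] {p : ℕ} (α : Form p Y) :
    Form.d (p + 1) (Form.d p α) = 0 := by
  refine Form.ext fun n P x => ?_
  exact extDeriv_extDeriv_apply (r := ∞) (Form.contDiff α n P).contDiffAt (by
    rw [minSmoothness_of_isRCLikeNormedField]
    exact WithTop.coe_le_coe.2 (le_top (a := (2 : ℕ∞))))

/-- The alternating sum over pairs of faces vanishes. -/
theorem alternating_sum_sum {V : Type*} [AddCommGroup V] [Module ℝ V] (q : ℕ) (G : ℕ → ℕ → V)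
    (hG : ∀ i j, j ≤ i → G (i + 1) j = G j i) :
    ∑ i ∈ Finset.range (q + 1), ((-1 : ℝ) ^ i) • ∑ j ∈ Finset.range q, ((-1 : ℝ) ^ j) • G i j =
      0 := by
  simp only [Finset.smul_sum, smul_smul]
  rw [← Finset.sum_product']
  -- Pairs with `j < i` are exchanged with pairs with `i ≤ j` by sending `(i, j)` to `(j, i - 1)`.
  -- The terms agree and the signs are opposite.
  refine Finset.sum_involution
    (fun x _ => if x.2 < x.1 then (x.2, x.1 - 1) else (x.2 + 1, x.1)) ?_ ?_ ?_ ?_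
  · rintro ⟨i, j⟩ hx
    dsimp only
    split
    next h =>
      obtain ⟨i, rfl⟩ : ∃ k, i = k + 1 := ⟨i - 1, by omega⟩
      rw [Nat.add_sub_cancel, hG i j (by omega), pow_succ]
      module
    next h =>
      rw [hG j i (by omega), pow_succ]
      module
  · rintro ⟨i, j⟩ hx _
    dsimp only
    split <;> simp only [ne_eq, Prod.mk.injEq] <;> omega
  · rintro ⟨i, j⟩ hx
    simp only [Finset.mem_product, Finset.mem_range] at hx ⊢
    split <;> omega
  · rintro ⟨i, j⟩ hx
    dsimp only
    split
    next h =>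
      rw [if_neg (by omega), Nat.sub_add_cancel (by omega)]
    next h =>
      rw [if_pos (by omega), Nat.add_sub_cancel]

theorem Nerve.face_face {q i j : ℕ} (h : j ≤ i) :
    Nerve.face Γ q j ∘ Nerve.face Γ (q + 1) (i + 1) = Nerve.face Γ q i ∘ Nerve.face Γ (q + 1) j := by
  refine (Nerve.restrict_restrict _ _ _ _ _ ((Nerve.skip_strictMono (q + 1) j).comp
    (Nerve.skip_strictMono q i)) fun k => ?_).trans
    (Nerve.restrict_restrict (Nerve.skip (q + 1) j) (Nerve.skip_strictMono _ _) (Nerve.skip q i)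
      (Nerve.skip_strictMono _ _) _ _ fun k => rfl).symm
  simp only [Function.comp_apply, skip_val]
  split_ifs <;> omega

theorem simpDiff_simpDiff (p q : ℕ) (α : Form p (Nerve Γ q)) :
    simpDiff Γ p (q + 1) (simpDiff Γ p q α) = 0 := by
  have key := alternating_sum_sum (q + 2) (fun i j => Form.pullback p (Nerve.face Γ (q + 1) i)
    (Nerve.dSmooth_face _ _) (Form.pullback p (Nerve.face Γ q j) (Nerve.dSmooth_face _ _) α))
    fun i j h => by
      rw [pullback_pullback, pullback_pullback]
      exact Form.pullback_congr _ _ (Nerve.face_face h) α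
  rw [simpDiff, simpDiff, LinearMap.smul_apply, LinearMap.smul_apply, map_smul]
  have h : (∑ i ∈ Finset.range (q + 1 + 2), ((-1 : ℝ) ^ i) • Form.pullback p
      (Nerve.face Γ (q + 1) i) (Nerve.dSmooth_face _ _)) ((∑ i ∈ Finset.range (q + 2),
        ((-1 : ℝ) ^ i) • Form.pullback p (Nerve.face Γ q i) (Nerve.dSmooth_face _ _)) α) = 0 := by
    rw [← key, LinearMap.sum_apply]
    refine Finset.sum_congr rfl fun i _ => ?_
    simp only [LinearMap.smul_apply, LinearMap.sum_apply, map_sum, map_smul]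
    rw [Finset.smul_sum]
    exact Finset.sum_congr rfl fun j _ => smul_comm _ _ _
  rw [h, smul_zero, smul_zero]

theorem Tot.D_D (x : Tot Γ) : Tot.D Γ (Tot.D Γ x) = 0 := by
  suffices h : Tot.D Γ ∘ₗ Tot.D Γ = 0 from congrArg (fun L : Tot Γ →ₗ[ℝ] Tot Γ => L x) h
  refine Tot.hom_ext fun p q α => ?_
  -- The factor (-1)^p in ∂ makes it anticommute with d, which itself commutes with pullbacks along
  -- faces.
  have h : simpDiff Γ (p + 1) q (Form.d p α) = -Form.d p (simpDiff Γ p q α) := by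
    simp only [simpDiff, LinearMap.smul_apply, LinearMap.sum_apply, map_smul, map_sum,
      Form.d_pullback, pow_succ]
    module
  simp only [LinearMap.comp_apply, Tot.D, Tot.desc_of, LinearMap.add_apply, map_add, Form.d_d,
    simpDiff_simpDiff, h, map_neg, map_zero, LinearMap.zero_apply]
  abel

/-- The filtration of the total complex by the simplicial degree. -/
def Tot.filt (Γ : Lie2Groupoid.{u}) (k : ℕ) : Submodule ℝ (Tot Γ) :=
  Submodule.span ℝ {x | ∃ p q α, q < k ∧ x = Tot.of Γ p q α}

theorem Tot.of_mem_filt {p q k : ℕ} (h : q < k) (α : Form p (Nerve Γ q)) :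
    Tot.of Γ p q α ∈ Tot.filt Γ k := Submodule.subset_span ⟨p, q, α, h, rfl⟩

theorem Tot.filt_mono {k l : ℕ} (h : k ≤ l) : Tot.filt Γ k ≤ Tot.filt Γ l := by
  refine Submodule.span_mono ?_
  rintro _ ⟨p, q, α, hq, rfl⟩
  exact ⟨p, q, α, hq.trans_le h, rfl⟩

theorem Tot.filt_zero : Tot.filt Γ 0 = ⊥ := by
  rw [Tot.filt, Submodule.span_eq_bot]
  rintro _ ⟨p, q, α, hq, rfl⟩
  exact absurd hq (Nat.not_lt_zero q)

theorem Tot.map_filt {L : Tot Γ →ₗ[ℝ] Tot Γ} {k l : ℕ}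
    (h : ∀ p q α, q < k → L (Tot.of Γ p q α) ∈ Tot.filt Γ l) {x : Tot Γ} (hx : x ∈ Tot.filt Γ k) :
    L x ∈ Tot.filt Γ l := by
  have : Tot.filt Γ k ≤ (Tot.filt Γ l).comap L := by
    refine Submodule.span_le.2 ?_
    rintro _ ⟨p, q, α, hq, rfl⟩
    exact h p q α hq
  exact this hx

/-- An element of a direct sum has finitely many components. So the filtration is exhaustive, and
the induction on the filtration step reaches every cochain. -/
theorem Tot.exists_mem_filt (x : Tot Γ) : ∃ k, x ∈ Tot.filt Γ k := by
  refine DirectSum.induction_on (motive := fun x : Tot Γ => ∃ k, x ∈ Tot.filt Γ k) x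
    ⟨0, zero_mem _⟩ (fun pq α => ⟨pq.2 + 1, Tot.of_mem_filt (Nat.lt_succ_self _) α⟩) ?_
  rintro x y ⟨k, hk⟩ ⟨l, hl⟩
  exact ⟨max k l, add_mem (Tot.filt_mono (le_max_left _ _) hk) (Tot.filt_mono (le_max_right _ _) hl)⟩

theorem Tot.dR_filt {k : ℕ} {x : Tot Γ} (hx : x ∈ Tot.filt Γ k) : Tot.dR Γ x ∈ Tot.filt Γ k :=
  Tot.map_filt (fun p q α hq => by
    rw [Tot.dR, Tot.desc_of]
    exact Tot.of_mem_filt hq _) hx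

/-! ### Random lifts and prisms on the total complex, and Morita invariance. -/

variable {φ : Hom Γ Δ} (hφ : φ.IsMorita) (R₀ : Mfd.RandomSection φ.f₀)
  (R₁ : Mfd.RandomSection (φ.toPb₁ hφ.sub₀))

/-- The average over random lifts on the total complex. -/
def Tot.randomLift : Tot Γ →ₗ[ℝ] Tot Δ :=
  Tot.desc fun p q => Tot.of Δ p q ∘ₗ TwoGroupBundle.randomLift hφ R₀ R₁ p q

/-- The prism operator with values in the total complex. -/
def Tot.prismAt (p : ℕ) : ∀ q, Form p (Nerve Γ q) →ₗ[ℝ] Tot Γ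
  | 0 => 0
  -- The sign (-1)^p cancels the one in ∂, and the extra minus turns φ^* A - 1 into 1 - φ^* A.
  | q + 1 => Tot.of Γ p q ∘ₗ (-((-1 : ℝ) ^ p) • prism hφ R₀ R₁ p q)

/-- The prism operator on the total complex. -/
def Tot.prism : Tot Γ →ₗ[ℝ] Tot Γ := Tot.desc (Tot.prismAt hφ R₀ R₁)

theorem Tot.randomLift_pullback (y : Tot Δ) :
    Tot.randomLift hφ R₀ R₁ (Tot.pullback φ y) = y := by
  suffices h : Tot.randomLift hφ R₀ R₁ ∘ₗ Tot.pullback φ = LinearMap.id from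
    congrArg (fun L : Tot Δ →ₗ[ℝ] Tot Δ => L y) h
  refine Tot.hom_ext fun p q α => ?_
  simp only [LinearMap.comp_apply, Tot.randomLift, Tot.pullback, Tot.desc_of,
    TwoGroupBundle.randomLift_pullback, LinearMap.id_apply]

theorem Tot.simplicial_randomLift (x : Tot Γ) :
    Tot.simplicial Δ (Tot.randomLift hφ R₀ R₁ x) =
      Tot.randomLift hφ R₀ R₁ (Tot.simplicial Γ x) := by
  suffices h : Tot.simplicial Δ ∘ₗ Tot.randomLift hφ R₀ R₁ =
      Tot.randomLift hφ R₀ R₁ ∘ₗ Tot.simplicial Γ from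
    congrArg (fun L : Tot Γ →ₗ[ℝ] Tot Δ => L x) h
  refine Tot.hom_ext fun p q α => ?_
  simp only [LinearMap.comp_apply, Tot.simplicial, Tot.randomLift, Tot.desc_of]
  congr 1
  simp only [simpDiff, LinearMap.smul_apply, LinearMap.sum_apply, map_smul, map_sum]
  congr 1
  refine Finset.sum_congr rfl fun i _ => ?_
  congr 1
  exact (randomLift_restrict hφ R₀ R₁ _ (Nerve.skip_strictMono q i) α).symm

theorem Tot.simplicial_prism (x : Tot Γ) :
    Tot.simplicial Γ (Tot.prism hφ R₀ R₁ x) + Tot.prism hφ R₀ R₁ (Tot.simplicial Γ x) =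
      x - Tot.pullback φ (Tot.randomLift hφ R₀ R₁ x) := by
  suffices h : Tot.simplicial Γ ∘ₗ Tot.prism hφ R₀ R₁ + Tot.prism hφ R₀ R₁ ∘ₗ Tot.simplicial Γ =
      LinearMap.id - Tot.pullback φ ∘ₗ Tot.randomLift hφ R₀ R₁ from
    congrArg (fun L : Tot Γ →ₗ[ℝ] Tot Γ => L x) h
  refine Tot.hom_ext fun p q α => ?_
  have hs := neg_one_pow_mul_self' p
  simp only [LinearMap.comp_apply, LinearMap.add_apply, LinearMap.sub_apply, LinearMap.id_apply,
    Tot.simplicial, Tot.prism, Tot.pullback, Tot.randomLift, Tot.desc_of]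
  cases q with
  | zero =>
    have h := prism_boundary_zero hφ R₀ R₁ α
    simp only [Tot.prismAt, LinearMap.zero_apply, map_zero, zero_add, LinearMap.comp_apply,
      LinearMap.smul_apply, simpDiff, map_smul, smul_smul, LinearMap.sum_apply]
    rw [mul_neg, hs, ← map_smul, ← map_sub]
    congr 1
    rw [← neg_sub, ← h, neg_one_smul]
  | succ r =>
    have h := prism_boundary_succ hφ R₀ R₁ r α
    simp only [Tot.prismAt, LinearMap.comp_apply, Tot.desc_of,
      LinearMap.smul_apply, simpDiff, map_smul, smul_smul, LinearMap.sum_apply]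
    rw [neg_mul, mul_neg, hs, ← map_smul, ← map_smul, ← map_sub, ← map_add]
    congr 1
    rw [← neg_sub, ← h, neg_one_smul, neg_one_smul, neg_add_rev]

theorem Tot.prism_filt {k : ℕ} {x : Tot Γ} (hx : x ∈ Tot.filt Γ (k + 1)) :
    Tot.prism hφ R₀ R₁ x ∈ Tot.filt Γ k :=
  Tot.map_filt (fun p q α hq => by
    rw [Tot.prism, Tot.desc_of]
    cases q with
    | zero => exact zero_mem _
    | succ q => exact Tot.of_mem_filt (Nat.lt_of_succ_lt_succ hq) _) hx

theorem Tot.pullback_randomLift_filt {k : ℕ} {x : Tot Γ} (hx : x ∈ Tot.filt Γ k) :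
    Tot.pullback φ (Tot.randomLift hφ R₀ R₁ x) ∈ Tot.filt Γ k :=
  Tot.map_filt (L := Tot.pullback φ ∘ₗ Tot.randomLift hφ R₀ R₁) (fun p q α hq => by
    simp only [LinearMap.comp_apply, Tot.pullback, Tot.randomLift, Tot.desc_of]
    exact Tot.of_mem_filt hq _) hx


/-- This relative form, with a hypothesis on `Tot.D Γ x` in place of a cocycle condition, yields
surjectivity and injectivity in cohomology at once. -/
theorem Tot.exists_sub_D_mem_range (hφ : φ.IsMorita) (x : Tot Γ)
    (hx : Tot.D Γ x ∈ LinearMap.range (Tot.pullback φ)) :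
    ∃ z, x - Tot.D Γ z ∈ LinearMap.range (Tot.pullback φ) := by
  obtain ⟨R₀⟩ := hφ.sub₀.nonempty_randomSection
  obtain ⟨R₁⟩ := hφ.sub₁.nonempty_randomSection
  let A := Tot.randomLift hφ R₀ R₁
  let P := Tot.prism hφ R₀ R₁
  -- Subtracting its composite with φ^* A makes the prism operator vanish on the image of φ^*,
  -- because A φ^* = 1.
  let K : Tot Γ →ₗ[ℝ] Tot Γ := P - P ∘ₗ Tot.pullback φ ∘ₗ A
  have hA : ∀ y, A (Tot.pullback φ y) = y := Tot.randomLift_pullback hφ R₀ R₁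
  have hK : ∀ x, K x = P x - P (Tot.pullback φ (A x)) := fun x => rfl
  have hKF : ∀ {k x}, x ∈ Tot.filt Γ (k + 1) → K x ∈ Tot.filt Γ k := fun hx =>
    sub_mem (Tot.prism_filt hφ R₀ R₁ hx)
      (Tot.prism_filt hφ R₀ R₁ (Tot.pullback_randomLift_filt hφ R₀ R₁ hx))
  have hP : ∀ x, Tot.simplicial Γ (P x) + P (Tot.simplicial Γ x) = x - Tot.pullback φ (A x) :=
    Tot.simplicial_prism hφ R₀ R₁
  obtain ⟨k, hk⟩ := Tot.exists_mem_filt x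
  -- The prism operators contract ∂ only; their failure to anticommute with d is collected in `N`.
  -- It lowers the filtration because `K` does and d preserves it.
  refine exists_sub_mem_range (A := A) (K := K) (N := Tot.dR Γ ∘ₗ K + K ∘ₗ Tot.dR Γ)
    Tot.filt_zero (fun k x hx => add_mem (Tot.dR_filt (hKF hx)) (hKF (Tot.dR_filt hx))) Tot.D_D
    (Tot.D_pullback φ) (fun y => ?_) (fun x => ?_) k x hk hx
  · rw [hK, hA, sub_self]
  · have h1 := hP (Tot.pullback φ (A x))
    rw [hA, sub_self, Tot.simplicial_pullback, Tot.simplicial_randomLift] at h1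
    rw [Tot.D_eq, Tot.D_eq, map_add, LinearMap.add_apply, LinearMap.comp_apply,
      LinearMap.comp_apply, ← hP x, hK (Tot.simplicial Γ x), hK x, map_sub (Tot.simplicial Γ)]
    rw [eq_neg_of_add_eq_zero_left h1]
    abel

theorem Tot.pullback_injective (hφ : φ.IsMorita) : Function.Injective (Tot.pullback φ) := by
  obtain ⟨R₀⟩ := hφ.sub₀.nonempty_randomSection
  obtain ⟨R₁⟩ := hφ.sub₁.nonempty_randomSection
  exact Function.LeftInverse.injective (Tot.randomLift_pullback hφ R₀ R₁)

/-- Morita morphisms induce isomorphisms in cohomology. -/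
theorem Hom.IsMorita.bijective_pullback (hφ : φ.IsMorita) : Function.Bijective φ.pullback := by
  have hinj := Tot.pullback_injective hφ
  constructor
  · refine (injective_iff_map_eq_zero φ.pullback).2 fun b hb => ?_
    induction b using Submodule.Quotient.induction_on with
    | _ b =>
    obtain ⟨b, hDb⟩ := b
    obtain ⟨x, hx⟩ := (Submodule.Quotient.mk_eq_zero _).1 hb
    have hx' : Tot.D Γ x = Tot.pullback φ b := hx
    -- A primitive of φ^* b may be replaced by one of the form φ^* c; injectivity on cochains then
    -- gives b = D c.
    obtain ⟨z, c, hc⟩ := Tot.exists_sub_D_mem_range hφ x ⟨b, hx'.symm⟩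
    refine (Submodule.Quotient.mk_eq_zero _).2 ⟨c, hinj ?_⟩
    change Tot.pullback φ (Tot.D Δ c) = Tot.pullback φ b
    rw [← Tot.D_pullback, hc, map_sub, Tot.D_D, sub_zero, hx']
  · intro a
    induction a using Submodule.Quotient.induction_on with
    | _ a =>
    obtain ⟨x, hDx⟩ := a
    have hx : Tot.D Γ x = 0 := hDx
    -- A cocycle has coboundary 0 = φ^* 0, hence is cohomologous to some φ^* b; injectivity on
    -- cochains makes `b` a cocycle.
    obtain ⟨z, b, hb⟩ := Tot.exists_sub_D_mem_range hφ x ⟨0, by rw [map_zero, hx]⟩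
    have hDb : Tot.D Δ b = 0 := hinj (by
      rw [← Tot.D_pullback, hb, map_sub, Tot.D_D, hx, sub_zero, map_zero])
    refine ⟨Submodule.Quotient.mk ⟨b, hDb⟩, ?_⟩
    refine (Submodule.Quotient.eq _).2 ⟨-z, ?_⟩
    change Tot.D Γ (-z) = Tot.pullback φ b - x
    rw [hb, map_neg]
    abel

end MoritaInvariance

/-! ### Functoriality of the pullback and of products -/

section Functoriality

variable {Γ Δ Λ : Lie2Groupoid.{u}}

theorem Hom.ext_data {f g : Hom Γ Δ} (h₀ : f.f₀ = g.f₀) (h₁ : f.f₁ = g.f₁) (h₂ : f.f₂ = g.f₂) :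
    f = g := by
  cases f
  cases g
  dsimp only at h₀ h₁ h₂
  subst h₀ h₁ h₂
  rfl

theorem Tot.pullback_comp (g : Hom Δ Λ) (f : Hom Γ Δ) (x : Tot Λ) :
    Tot.pullback (g.comp f) x = Tot.pullback f (Tot.pullback g x) := by
  suffices h : Tot.pullback (g.comp f) = Tot.pullback f ∘ₗ Tot.pullback g from
    congrArg (fun L : Tot Λ →ₗ[ℝ] Tot Γ => L x) h
  refine Tot.hom_ext fun p q α => ?_
  simp only [LinearMap.comp_apply, Tot.pullback, Tot.desc_of]
  rfl

theorem Hom.pullback_comp (g : Hom Δ Λ) (f : Hom Γ Δ) (a : Cohomology Λ) :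
    (g.comp f).pullback a = f.pullback (g.pullback a) := by
  induction a using Submodule.Quotient.induction_on with
  | _ a => exact congrArg Submodule.Quotient.mk (Subtype.ext (Tot.pullback_comp g f a.1))

theorem Tot.pullback_cup (f : Hom Γ Δ) (x y : Tot Δ) :
    Tot.pullback f (Tot.cup Δ x y) = Tot.cup Γ (Tot.pullback f x) (Tot.pullback f y) := by
  suffices h : (Tot.cup Δ).compr₂ (Tot.pullback f) =
      (Tot.cup Γ).compl₁₂ (Tot.pullback f) (Tot.pullback f) from
    congrArg (fun L : Tot Δ →ₗ[ℝ] Tot Δ →ₗ[ℝ] Tot Γ => L x y) h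
  refine Tot.hom_ext fun a b α => Tot.hom_ext fun a' b' β => ?_
  simp only [LinearMap.compr₂_apply, LinearMap.compl₁₂_apply, Tot.pullback, Tot.desc_of,
    LinearMap.comp_apply]
  rw [Tot.cup_of rfl rfl, Tot.cup_of rfl rfl, Tot.desc_of]
  rfl

theorem Hom.pullback_cup (f : Hom Γ Δ) (a b : Cohomology Δ) :
    f.pullback (cup Δ a b) = cup Γ (f.pullback a) (f.pullback b) := by
  induction a using Submodule.Quotient.induction_on with
  | _ a =>
  induction b using Submodule.Quotient.induction_on with
  | _ b => exact congrArg Submodule.Quotient.mk (Subtype.ext (Tot.pullback_cup f a.1 b.1))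

/-- Since pullback is multiplicative, cross products formed on different spaces become cup products
on a common one, where they can be compared. -/
theorem Hom.pullback_cross {Γ' Ξ : Lie2Groupoid.{u}} (f : Hom Ξ Λ) (p : Hom Λ Γ) (p' : Hom Λ Γ')
    (a : Cohomology Γ) (b : Cohomology Γ') : f.pullback (cross p p' (a ⊗ₜ b)) =
      cup Ξ ((p.comp f).pullback a) ((p'.comp f).pullback b) := by
  rw [Hom.pullback_comp, Hom.pullback_comp, ← Hom.pullback_cup]
  rfl

theorem Hom.pullback_id_of_eq {f : Hom Γ Γ} (h₀ : ∀ x, f.f₀ x = x) (h₁ : ∀ x, f.f₁ x = x)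
    (h₂ : ∀ x, f.f₂ x = x) (a : Cohomology Γ) : f.pullback a = a := by
  induction a using Submodule.Quotient.induction_on with
  | _ a =>
  refine congrArg Submodule.Quotient.mk (Subtype.ext ?_)
  change Tot.pullback f a.1 = a.1
  suffices h : Tot.pullback f = LinearMap.id from congrArg (fun L : Tot Γ →ₗ[ℝ] Tot Γ => L a.1) h
  refine Tot.hom_ext fun p q α => ?_
  rw [Tot.pullback, Tot.desc_of, LinearMap.comp_apply, LinearMap.id_apply]
  congr 1
  have e : Nerve.map (q := q) f = id := funext fun x =>
    Nerve.ext (funext fun _ => h₀ _) (funext fun _ => funext fun _ => funext fun _ => h₁ _)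
      (funext fun _ => funext fun _ => funext fun _ => funext fun _ => funext fun _ => h₂ _)
  exact (Form.pullback_congr _ dSmooth_id e α).trans rfl

/-! ### Pullbacks along zigzags, and the Whitney sum formula. -/

theorem map_linearInverse {V W : Type*} [AddCommGroup V] [Module ℝ V] [AddCommGroup W] [Module ℝ W]
    {f : V →ₗ[ℝ] W} (hf : Function.Bijective f) (y : W) : f (linearInverse f y) = y := by
  rw [linearInverse, dif_pos hf]
  exact LinearEquiv.apply_symm_apply (LinearEquiv.ofBijective f hf) y

theorem GenMor.pullback_comp {Δ Λ : Lie2Groupoid.{u}} (G : GenMor Δ Λ) :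
    ∀ {Γ : Lie2Groupoid.{u}} (F : GenMor Γ Δ),
      (GenMor.comp G F).pullback = F.pullback ∘ₗ G.pullback
  | _, .refl _ => rfl
  | _, .fwd f F => by
    rw [GenMor.comp, GenMor.pullback, GenMor.pullback_comp G F, GenMor.pullback,
      LinearMap.comp_assoc]
  | _, .bwd φ hφ F => by
    rw [GenMor.comp, GenMor.pullback, GenMor.pullback_comp G F, GenMor.pullback,
      LinearMap.comp_assoc]

/-- This determines the pullback along a span with no inverse in sight, and is the only form in
which spans enter the Whitney sum formula. -/
theorem GenMor.pullback_span {E : Lie2Groupoid.{u}} (φ : Hom E Γ) (hφ : φ.IsMorita) (f : Hom E Δ)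
    (a : Cohomology Δ) : φ.pullback ((GenMor.span φ hφ f).pullback a) = f.pullback a :=
  map_linearInverse hφ.bijective_pullback _

/-- The pullback to E ×_Γ E' is injective on cohomology, and there both sides are the cup product of
the pullbacks of `a` and `b` through E and E'. -/
theorem charMap_whitneySum {X X' : CrossedModule.{u}} {E E' : Lie2Groupoid.{u}}
    (φ : Hom E Γ) (hφ : φ.IsMorita) (f : Hom E X.toLie2) (φ' : Hom E' Γ) (hφ' : φ'.IsMorita)
    (f' : Hom E' X'.toLie2) (a : Cohomology X.toLie2) (b : Cohomology X'.toLie2) :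
    (whitneySum φ hφ f φ' hφ' f').charMap (cross (X.prodFst X') (X.prodSnd X') (a ⊗ₜ b)) =
      (Hom.diag Γ).pullback (cross (Hom.fst Γ Γ) (Hom.snd Γ Γ)
        (PrincipalBundle.charMap (.span φ hφ f) a ⊗ₜ
          PrincipalBundle.charMap (.span φ' hφ' f') b)) := by
  refine (fibreProduct.toBase_morita φ hφ φ' hφ').bijective_pullback.1 ?_
  refine (GenMor.pullback_span _ _ _ _).trans ?_
  rw [Hom.pullback_cross, Hom.pullback_cross,
    -- Both projections composed with the diagonal are the identity, so over Γ the right-hand side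
    -- is a cup product of the two characteristic classes.
    Hom.pullback_id_of_eq (f := (Hom.fst Γ Γ).comp (Hom.diag Γ)) (fun _ => rfl) (fun _ => rfl)
      fun _ => rfl,
    Hom.pullback_id_of_eq (f := (Hom.snd Γ Γ).comp (Hom.diag Γ)) (fun _ => rfl) (fun _ => rfl)
      fun _ => rfl, Hom.pullback_cup]
  refine congrArg₂ (fun x y => cup _ x y) ?_ ?_
  -- For the first factor the morphism to Γ is taken through E, for the second through E'; each time
  -- the pullback of a characteristic class along its Morita leg is known.
  · rw [fibreProduct.toBase_eq, Hom.pullback_comp φ]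
    refine Eq.trans ?_ (congrArg _ (GenMor.pullback_span φ hφ f a).symm)
    rw [← Hom.pullback_comp]
    rfl
  · rw [fibreProduct.toBase, Hom.pullback_comp φ']
    refine Eq.trans ?_ (congrArg _ (GenMor.pullback_span φ' hφ' f' b).symm)
    rw [← Hom.pullback_comp]
    -- The pairing takes its map on objects from the first component. Its second component agrees
    -- with `f'` on objects because the Lie 2-group has only one object.
    refine congrArg (fun h : Hom _ X'.toLie2 => h.pullback b) (Hom.ext_data ?_ rfl rfl)
    exact funext fun _ => Subsingleton.elim (α := PUnit) _ _

end Functoriality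

end

end TwoGroupBundle

theorem corollary4p3 :
    -- Morita morphisms induce isomorphisms, so that pullbacks along zigzags are well-defined.
    (∀ (Γ Δ : Lie2Groupoid.{u}) (φ : Hom Γ Δ), φ.IsMorita → Function.Bijective φ.pullback) ∧
    -- Naturality: the characteristic map of the pullback bundle.
    (∀ (Γ Δ : Lie2Groupoid.{u}) (X : CrossedModule.{u}) (F : GenMor Γ Δ)
      (B : PrincipalBundle Δ X), (B.pullback F).charMap = F.pullback ∘ₗ B.charMap) ∧
    -- The characteristic map of a Whitney sum.
    (∀ (Γ : Lie2Groupoid.{u}) (X X' : CrossedModule.{u}) (E E' : Lie2Groupoid.{u})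
      (φ : Hom E Γ) (hφ : φ.IsMorita) (f : Hom E X.toLie2)
      (φ' : Hom E' Γ) (hφ' : φ'.IsMorita) (f' : Hom E' X'.toLie2),
      (whitneySum φ hφ f φ' hφ' f').charMap ∘ₗ cross (X.prodFst X') (X.prodSnd X') =
        (Hom.diag Γ).pullback ∘ₗ cross (Hom.fst Γ Γ) (Hom.snd Γ Γ) ∘ₗ
          TensorProduct.map (PrincipalBundle.charMap (.span φ hφ f))
            (PrincipalBundle.charMap (.span φ' hφ' f'))) := by
  refine ⟨fun Γ Δ φ hφ => hφ.bijective_pullback, fun Γ Δ X F B => GenMor.pullback_comp B F,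
    -- Linear maps on a tensor product are compared on pure tensors.
    fun Γ X X' E E' φ hφ f φ' hφ' f' => TensorProduct.ext' fun a b => ?_⟩
  exact charMap_whitneySum φ hφ f φ' hφ' f' a b
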